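/- For $d,k\in\mathbb N$ with $k\ge 1$, let $x=(x_1,\dots,x_k)$ with $x_1,\dots,x_k$ i.i.d. standard Gaussian vectors in $\mathbb R^d$, let $\sigma(z)=\operatorname{erf}(z)=\frac1{\sqrt\pi}\int_{-z}^{z}e^{-t^2}\,dt$, and for $w=(w_1,\dots,w_k)\in(\mathbb R^d)^k$ put $$p_w(x)=\sigma(w_1^\top x_1)+\prod_{l=1}^k\sigma(w_l^\top x_l).$$ For $u_0\in\mathbb R^d$ let $p_{u_0}:=p_{(u_0,\dots,u_0)}$ and $$F^{(1,k)}(w)=\mathbb E_x\Big[\tfrac12\big(p_w(x)-p_{u_0}(x)\big)^2\Big],\qquad w\in(\mathbb R^d)^k .$$ Consider gradient descent on $F^{(1,k)}$ over all of $(\mathbb R^d)^k$ (the fully connected architecture), $w^{(t+1)}=w^{(t)}-\eta_t\nabla F^{(1,k)}(w^{(t)})$, where all $kd$ coordinates of $w^{(0)}$ are independent and uniform on $\{c,-c\}$. Theorem. Fix a constant $c>0$ and sequences of positive integers $k=k(d)$ (for instance, constant) and of nonnegative integers $T=T(d)$ with $T=o(d^{k/4})$ as $d\to\infty$. Then there is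 a $d_0$ such that for all $d\ge d_0$, every $u_0\in\mathbb R^d$ with $\|u_0\|^2\ge \frac{12}{\pi^2}k^2$, and every learning rate rule with $\eta_t\in(0,1]$ for all $t$ (where $\eta_t$ may depend on $w^{(0)}$, hence on all the iterates), with probability at least $1-2k\,e^{-d^{1/3}/6}$ over $w^{(0)}$, $$F^{(1,k)}\big(w^{(T)}\big)\ge \tfrac18 .$$ -/

import Mathlib

open MeasureTheory ProbabilityTheory Filter Asymptotics

noncomputable section

namespace FCParity

/-- The error function `erf x = (1 / √π) ∫_{-x}^{x} e^{-t²} dt`. -/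
def erf (x : ℝ) : ℝ :=
  1 / Real.sqrt Real.pi * ∫ t in (-x)..x, Real.exp (-t ^ 2)

/-- The space `ℝ^d` with its Euclidean structure. -/
abbrev Vec (d : ℕ) : Type := EuclideanSpace ℝ (Fin d)

/-- The space `(ℝ^d)^k` of `k`-tuples of weight vectors, with the Euclidean structure of
`ℝ^(dk)`. -/
abbrev Weights (k d : ℕ) : Type := PiLp 2 (fun _ : Fin k => Vec d)

/-- The predictor `p_w(x) = σ(w₁ᵀx₁) + ∏ₗ σ(wₗᵀxₗ)` of the fully connected class, with `σ = erf`.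
The first index is `0 : Fin k`. -/
def predictor {k d : ℕ} [NeZero k] (w : Weights k d) (x : Fin k → Vec d) : ℝ :=
  erf (inner ℝ (w 0) (x 0)) + ∏ l : Fin k, erf (inner ℝ (w l) (x l))

/-- The tuple `(u₀, …, u₀)` of `k` copies of one vector. -/
def shared {d : ℕ} (k : ℕ) (u₀ : Vec d) : Weights k d :=
  WithLp.toLp 2 (fun _ : Fin k => u₀)

/-- The law of `x = (x₁, …, x_k)` with independent standard Gaussian `xₗ` in `ℝ^d`. -/
def inputLaw (k d : ℕ) : Measure (Fin k → Vec d) :=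
  Measure.pi (fun _ : Fin k => stdGaussian (Vec d))

/-- The objective `F(w) = 𝔼ₓ [½ (p_w(x) - p_{u₀}(x))²]`. -/
def objective {k d : ℕ} [NeZero k] (u₀ : Vec d) (w : Weights k d) : ℝ :=
  ∫ x, 1 / 2 * (predictor w x - predictor (shared k u₀) x) ^ 2 ∂(inputLaw k d)

/-- Gradient descent on the objective over all of `(ℝ^d)^k`, started at `w₀`, with step size
`η t` in iteration `t`: `w⁽ᵗ⁺¹⁾ = w⁽ᵗ⁾ - ηₜ ∇F(w⁽ᵗ⁾)`. -/
def gdIterate {k d : ℕ} [NeZero k] (u₀ : Vec d) (η : ℕ → ℝ) (w₀ : Weights k d) :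
    ℕ → Weights k d
  | 0 => w₀
  | t + 1 => gdIterate u₀ η w₀ t - η t • gradient (objective u₀) (gdIterate u₀ η w₀ t)

/-- The weight tuple with coordinate `a l i` in position `i` of the `l`-th vector. -/
def ofCoords {k d : ℕ} (a : Fin k → Fin d → ℝ) : Weights k d :=
  WithLp.toLp 2 (fun l : Fin k => WithLp.toLp 2 (a l))

/-- The law of the initial weights: all `kd` coordinates are independent and uniform on
`{c, -c}`. -/
def initLaw (k d : ℕ) (c : ℝ) : Measure (Weights k d) :=
  (Measure.pi (fun _ : Fin k => Measure.pi (fun _ : Fin d =>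
    uniformOn ({c, -c} : Set ℝ)))).map ofCoords

end FCParity

end

noncomputable section

namespace FCParity

/-! Gaussian expectations of products of two `erf` neurons are arcsines
(`integral_erf_inner_mul_erf_inner`), so the objective is an explicit function of norms and inner
products. For k ≥ 2 the mixed terms vanish by independence and oddness. The loss is then a
nonnegative expected square plus a product part, which is at least ½·corr(u,u)^k - |∏ corr(w_l,u)|.
The lower bound on the norm of u gives k(1 - corr(u,u)) ≤ 0.64. By Bernoulli's inequality it is
therefore enough that one vector has overlap at most 1/20 with the target direction ν = `signal u`.
The first vector receives a signal from the single-neuron term, so a vector with index l ≠ 0 is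
used.

For l ≠ 0 the gradient is a radial term weighted by D = ∏_{j≠l} corr(w_j,w_j), minus a signal term
weighted by P = ∏_{j≠l} corr(w_j,u). If the overlaps with nonzero index are at most σ, then |P| ≤
σ^(k-2). One step increases an overlap by at most 6|P| divided by the normalizations √(1+2‖w‖²)
before and after the step (`abs_overlap_descentStep_le`).

Put a = d^(-1/48). The initial norms are c·a^(-24), the initial overlaps are at most a^16 with high
probability by Hoeffding's inequality, and T·a^(12k) ≤ ε. From there the argument is deterministic,
which is why the step sizes may depend on the initialization. There are three ranges of k.

For k ≤ 6, T ≤ ε·d^(3/2) steps are too few to halve the norms, so each drift keeps a factor of order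
1/d (`overlap_le_of_large_norm`). For k ≥ 12 the bound T·σ^(k-2) ≲ σ holds without any information
on norms (`overlap_le_of_small`).

For 7 ≤ k ≤ 11 the norms may collapse, and potentials are needed (`PhaseBound`). Small tilts
|⟪w,ν⟫|/‖perp‖ imply |P| ≤ M√D. By AM-GM, the growth of the tilt is paid for by the decrease of the
norm, which is of order D, up to a tiny remainder. The same device controls pairwise differences of
x + 4x², x = ‖w_l‖², a coordinate in which pure shrinking is non-expanding (`abs_sub_le_of_shrink`).
So the norms fall together: when the first one passes below r = a^6, all are of order r, the
overlaps are of order a^22, and the crude argument finishes (`IsDescent.overlap_le_of_balanced`). -/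

/-! ### The error function and its one-dimensional Gaussian integrals -/

lemma erf_eq_two_mul (x : ℝ) :
    erf x = 2 / √Real.pi * ∫ t in (0 : ℝ)..x, Real.exp (-t ^ 2) := by
  have hi : ∀ a b : ℝ, IntervalIntegrable (fun t : ℝ => Real.exp (-t ^ 2)) volume a b :=
    fun a b => Continuous.intervalIntegrable (by fun_prop) a b
  have h1 : ∫ t in (-x)..0, Real.exp (-t ^ 2) = ∫ t in (0 : ℝ)..x, Real.exp (-t ^ 2) := by
    have := intervalIntegral.integral_comp_neg (a := 0) (b := x)
      (fun t : ℝ => Real.exp (-t ^ 2))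
    simpa using this.symm
  rw [erf, ← intervalIntegral.integral_add_adjacent_intervals (hi (-x) 0) (hi 0 x), h1]
  ring

lemma hasDerivAt_erf (x : ℝ) : HasDerivAt erf (2 / √Real.pi * Real.exp (-x ^ 2)) x := by
  have h : HasDerivAt (fun x : ℝ => ∫ t in (0 : ℝ)..x, Real.exp (-t ^ 2)) (Real.exp (-x ^ 2)) x :=
    intervalIntegral.integral_hasDerivAt_right (Continuous.intervalIntegrable (by fun_prop) _ _)
      (Continuous.stronglyMeasurableAtFilter (by fun_prop) _ _) (by fun_prop)
  have : erf = fun x => 2 / √Real.pi * ∫ t in (0 : ℝ)..x, Real.exp (-t ^ 2) :=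
    funext erf_eq_two_mul
  rw [this]
  exact h.const_mul _

@[fun_prop]
lemma continuous_erf : Continuous erf :=
  continuous_iff_continuousAt.2 fun x => (hasDerivAt_erf x).continuousAt

@[fun_prop]
lemma measurable_erf : Measurable erf := continuous_erf.measurable

lemma erf_neg (x : ℝ) : erf (-x) = -erf x := by
  simp only [erf, neg_neg]
  rw [intervalIntegral.integral_symm]
  ring

@[simp]
lemma erf_zero : erf 0 = 0 := by simp [erf]

lemma abs_erf_le_one (x : ℝ) : |erf x| ≤ 1 := by
  have key : ∀ y : ℝ, 0 ≤ y → |erf y| ≤ 1 := by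
    intro y hy
    have hi : Integrable (fun t : ℝ => Real.exp (-t ^ 2)) := by
      simpa using integrable_exp_neg_mul_sq (b := 1) one_pos
    have h0 : 0 ≤ ∫ t in (-y)..y, Real.exp (-t ^ 2) :=
      intervalIntegral.integral_nonneg (by linarith) fun t _ => (Real.exp_pos _).le
    have h1 : ∫ t in (-y)..y, Real.exp (-t ^ 2) ≤ √Real.pi := by
      rw [intervalIntegral.integral_of_le (by linarith)]
      have h2 := integral_gaussian 1
      simp only [neg_mul, one_mul, div_one] at h2
      rw [← h2]
      exact setIntegral_le_integral hi (Eventually.of_forall fun t => (Real.exp_pos _).le)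
    have hpi : 0 < √Real.pi := Real.sqrt_pos.2 Real.pi_pos
    rw [erf, abs_of_nonneg (by positivity), one_div, inv_mul_le_iff₀ hpi]
    simpa using h1
  rcases le_total 0 x with h | h
  · exact key x h
  · have := key (-x) (by linarith)
    rwa [erf_neg, abs_neg] at this

/-- Dominated differentiation, with bound (2/√π)|fB|. The integrals below are found by matching this
derivative, and the value at 0, with a closed form. -/
lemma hasDerivAt_integral_mul_erf {Ω : Type*} [MeasurableSpace Ω] {μ : Measure Ω}
    {f A B : Ω → ℝ} (hf : Integrable f μ) (hA : Measurable A) (hB : Measurable B)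
    (hfB : Integrable (fun ω => f ω * B ω) μ) (t : ℝ) :
    HasDerivAt (fun t => ∫ ω, f ω * erf (A ω + t * B ω) ∂μ)
      (∫ ω, f ω * B ω * (2 / √Real.pi * Real.exp (-(A ω + t * B ω) ^ 2)) ∂μ) t := by
  have hc : 0 ≤ 2 / √Real.pi := by positivity
  refine (hasDerivAt_integral_of_dominated_loc_of_deriv_le
    (F := fun t ω => f ω * erf (A ω + t * B ω))
    (F' := fun t ω => f ω * B ω * (2 / √Real.pi * Real.exp (-(A ω + t * B ω) ^ 2)))
    (bound := fun ω => 2 / √Real.pi * |f ω * B ω|) (s := Set.univ) Filter.univ_mem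
    (Eventually.of_forall fun t => ?_) ?_ ?_ ?_ ?_ ?_).2
  · exact hf.aestronglyMeasurable.mul (by fun_prop)
  · refine hf.mono (hf.aestronglyMeasurable.mul (by fun_prop)) (Eventually.of_forall fun ω => ?_)
    rw [norm_mul, Real.norm_eq_abs (erf _)]
    exact mul_le_of_le_one_right (norm_nonneg _) (abs_erf_le_one _)
  · exact hfB.aestronglyMeasurable.mul (by fun_prop)
  · refine Eventually.of_forall fun ω t _ => ?_
    rw [norm_mul, Real.norm_eq_abs, mul_comm, Real.norm_eq_abs, abs_of_nonneg (by positivity)]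
    refine mul_le_mul_of_nonneg_right ?_ (abs_nonneg _)
    refine mul_le_of_le_one_right hc (Real.exp_le_one_iff.2 ?_)
    nlinarith [sq_nonneg (A ω + t * B ω)]
  · exact (hfB.abs).const_mul _
  · refine Eventually.of_forall fun ω t _ => ?_
    have h1 : HasDerivAt (fun t => A ω + t * B ω) (B ω) t := by
      simpa using ((hasDerivAt_id t).mul_const (B ω)).const_add (A ω)
    have := ((hasDerivAt_erf _).comp t h1).const_mul (f ω)
    exact this.congr_deriv (by ring)

/-- Multiplying the standard Gaussian density by exp(-cg²) gives, up to normalization, the density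
of variance 1/(1+2c). -/
lemma integral_mul_exp_neg_mul_sq_gaussianReal (f : ℝ → ℝ) {c : ℝ} (hc : 0 ≤ c) :
    ∫ g, f g * Real.exp (-c * g ^ 2) ∂(gaussianReal 0 1) =
      (√(1 + 2 * c))⁻¹ * ∫ g, f g ∂(gaussianReal 0 (Real.toNNReal (1 + 2 * c)⁻¹)) := by
  have h0 : 0 < 1 + 2 * c := by positivity
  have hv : Real.toNNReal (1 + 2 * c)⁻¹ ≠ 0 := by
    simpa [Real.toNNReal_eq_zero] using h0
  rw [integral_gaussianReal_eq_integral_smul one_ne_zero,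
    integral_gaussianReal_eq_integral_smul hv, ← integral_const_mul]
  congr 1
  ext g
  simp only [gaussianPDFReal, smul_eq_mul, sub_zero, NNReal.coe_one, mul_one,
    Real.coe_toNNReal _ (inv_pos.2 h0).le]
  have h1 : √(2 * Real.pi * (1 + 2 * c)⁻¹) = √(2 * Real.pi) * (√(1 + 2 * c))⁻¹ := by
    rw [Real.sqrt_mul (by positivity), Real.sqrt_inv]
  have h2 : Real.exp (-g ^ 2 / (2 * (1 + 2 * c)⁻¹)) =
      Real.exp (-g ^ 2 / 2) * Real.exp (-c * g ^ 2) := by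
    rw [← Real.exp_add]
    congr 1
    field_simp
    ring
  have h3 : √(1 + 2 * c) ≠ 0 := (Real.sqrt_pos.2 h0).ne'
  rw [h1, h2]
  field_simp

lemma integral_exp_neg_sq_affine_gaussianReal (a s : ℝ) :
    ∫ g, Real.exp (-(a + s * g) ^ 2) ∂(gaussianReal 0 1) =
      (√(1 + 2 * s ^ 2))⁻¹ * Real.exp (-(a / √(1 + 2 * s ^ 2)) ^ 2) := by
  have h0 : (0 : ℝ) < 1 + 2 * s ^ 2 := by positivity
  have h : ∀ g : ℝ, Real.exp (-(a + s * g) ^ 2) =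
      Real.exp (-a ^ 2) * Real.exp (-2 * a * s * g) * Real.exp (-(s ^ 2) * g ^ 2) := by
    intro g
    rw [← Real.exp_add, ← Real.exp_add]
    congr 1
    ring
  simp_rw [h]
  rw [integral_mul_exp_neg_mul_sq_gaussianReal _ (sq_nonneg s), integral_const_mul]
  have hm := congrFun (mgf_fun_id_gaussianReal (μ := 0)
    (v := Real.toNNReal (1 + 2 * s ^ 2)⁻¹)) (-2 * a * s)
  rw [mgf] at hm
  rw [hm, Real.coe_toNNReal _ (inv_pos.2 h0).le, ← Real.exp_add, div_pow, Real.sq_sqrt h0.le]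
  congr 2
  field_simp
  ring

lemma integral_sq_mul_exp_neg_mul_sq_gaussianReal {c : ℝ} (hc : 0 ≤ c) :
    ∫ g, g ^ 2 * Real.exp (-c * g ^ 2) ∂(gaussianReal 0 1) =
      (√(1 + 2 * c))⁻¹ * (1 + 2 * c)⁻¹ := by
  have h0 : 0 < 1 + 2 * c := by positivity
  rw [integral_mul_exp_neg_mul_sq_gaussianReal _ hc]
  congr 1
  have hv := variance_id_gaussianReal (μ := 0) (v := Real.toNNReal (1 + 2 * c)⁻¹)
  rw [variance_of_integral_eq_zero (by fun_prop) (by simp)] at hv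
  simpa [Real.coe_toNNReal _ (inv_pos.2 h0).le, max_eq_left h0.le] using hv

lemma eq_of_hasDerivAt_eq {f g f' : ℝ → ℝ} (hf : ∀ x, HasDerivAt f (f' x) x)
    (hg : ∀ x, HasDerivAt g (f' x) x) (h0 : f 0 = g 0) (x : ℝ) : f x = g x := by
  have h : ∀ y, HasDerivAt (fun y => f y - g y) 0 y := fun y =>
    ((hf y).sub (hg y)).congr_deriv (sub_self _)
  have := is_const_of_deriv_eq_zero (fun y => (h y).differentiableAt) (fun y => (h y).deriv) x 0
  simp only [h0, sub_self] at this
  linarith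

lemma integral_odd_gaussianReal {f : ℝ → ℝ} (hf : ∀ x, f (-x) = -f x) :
    ∫ g, f g ∂(gaussianReal 0 1) = 0 := by
  have h : (gaussianReal 0 1).map (fun x => -x) = gaussianReal 0 1 := by
    simpa using gaussianReal_map_neg (μ := 0) (v := 1)
  have h2 : ∫ g, f g ∂((gaussianReal 0 1).map (fun x => -x)) =
      ∫ g, f (-g) ∂(gaussianReal 0 1) :=
    (MeasurableEquiv.neg ℝ).measurableEmbedding.integral_map _
  rw [h] at h2
  simp_rw [hf, integral_neg] at h2
  linarith

lemma integral_erf_affine_gaussianReal (a s : ℝ) :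
    ∫ g, erf (a + s * g) ∂(gaussianReal 0 1) = erf (a / √(1 + 2 * s ^ 2)) := by
  have h0 : (0 : ℝ) < 1 + 2 * s ^ 2 := by positivity
  refine eq_of_hasDerivAt_eq (f := fun a => ∫ g, erf (a + s * g) ∂(gaussianReal 0 1))
    (g := fun a => erf (a / √(1 + 2 * s ^ 2)))
    (f' := fun a => 2 / √Real.pi *
      ((√(1 + 2 * s ^ 2))⁻¹ * Real.exp (-(a / √(1 + 2 * s ^ 2)) ^ 2))) ?_ ?_ ?_ a
  · intro x
    have := hasDerivAt_integral_mul_erf (μ := gaussianReal 0 1) (f := fun _ => 1)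
      (A := fun g => s * g) (B := fun _ => 1) (integrable_const _) (by fun_prop) (by fun_prop)
      (integrable_const _) x
    simp only [one_mul, mul_one] at this
    rw [integral_const_mul] at this
    rw [← integral_exp_neg_sq_affine_gaussianReal x s]
    simpa only [add_comm] using this
  · intro x
    have h1 : HasDerivAt (fun x => x / √(1 + 2 * s ^ 2)) (√(1 + 2 * s ^ 2))⁻¹ x := by
      simpa [div_eq_mul_inv] using (hasDerivAt_id x).mul_const (√(1 + 2 * s ^ 2))⁻¹
    have := (hasDerivAt_erf _).comp x h1
    exact this.congr_deriv (by ring)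
  · simp only [zero_add, zero_div, erf_zero]
    exact integral_odd_gaussianReal fun x => by rw [mul_neg, erf_neg]

lemma integrable_id_gaussianReal : Integrable (fun g : ℝ => g) (gaussianReal 0 1) :=
  (memLp_id_gaussianReal 1).integrable (by simp)

lemma integrable_sq_gaussianReal : Integrable (fun g : ℝ => g ^ 2) (gaussianReal 0 1) := by
  simpa using (memLp_id_gaussianReal (μ := 0) (v := 1) 2).integrable_sq

lemma integral_mul_exp_mul_erf_gaussianReal (p q : ℝ) :
    ∫ g, g * Real.exp (-(p * g) ^ 2) * erf (q * g) ∂(gaussianReal 0 1) =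
      2 / √Real.pi * (q / ((1 + 2 * p ^ 2) * √(1 + 2 * p ^ 2 + 2 * q ^ 2))) := by
  have hle : ∀ g : ℝ, Real.exp (-(p * g) ^ 2) ≤ 1 := fun g =>
    Real.exp_le_one_iff.2 (by nlinarith [sq_nonneg (p * g)])
  refine eq_of_hasDerivAt_eq
    (f := fun q => ∫ g, g * Real.exp (-(p * g) ^ 2) * erf (q * g) ∂(gaussianReal 0 1))
    (g := fun q => 2 / √Real.pi * (q / ((1 + 2 * p ^ 2) * √(1 + 2 * p ^ 2 + 2 * q ^ 2))))
    (f' := fun q => 2 / √Real.pi *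
      ((√(1 + 2 * (p ^ 2 + q ^ 2)))⁻¹ * (1 + 2 * (p ^ 2 + q ^ 2))⁻¹)) ?_ ?_ ?_ q
  · intro x
    have := hasDerivAt_integral_mul_erf (μ := gaussianReal 0 1)
      (f := fun g => g * Real.exp (-(p * g) ^ 2))
      (A := fun _ => 0) (B := fun g => g) ?_ (by fun_prop) (by fun_prop) ?_ x
    · simp only [zero_add] at this
      rw [← integral_sq_mul_exp_neg_mul_sq_gaussianReal (by positivity), ← integral_const_mul]
      refine this.congr_deriv (integral_congr_ae (Eventually.of_forall fun g => ?_))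
      dsimp only
      have : Real.exp (-(p ^ 2 + x ^ 2) * g ^ 2) =
          Real.exp (-(p * g) ^ 2) * Real.exp (-(x * g) ^ 2) := by
        rw [← Real.exp_add]
        congr 1
        ring
      rw [this]
      ring
    · refine integrable_id_gaussianReal.mono (by fun_prop) (Eventually.of_forall fun g => ?_)
      rw [norm_mul, Real.norm_eq_abs (Real.exp _), Real.abs_exp]
      exact mul_le_of_le_one_right (norm_nonneg _) (hle g)
    · refine integrable_sq_gaussianReal.mono (by fun_prop) (Eventually.of_forall fun g => ?_)
      rw [mul_right_comm, ← sq, norm_mul, Real.norm_eq_abs (Real.exp _), Real.abs_exp]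
      exact mul_le_of_le_one_right (norm_nonneg _) (hle g)
  · intro x
    have hS : 0 < 1 + 2 * p ^ 2 + 2 * x ^ 2 := by positivity
    have h1 : HasDerivAt (fun q : ℝ => 1 + 2 * p ^ 2 + 2 * q ^ 2) (4 * x) x := by
      refine (((hasDerivAt_pow 2 x).const_mul 2).const_add (1 + 2 * p ^ 2)).congr_deriv ?_
      norm_num; ring
    have h2 := (h1.sqrt hS.ne').const_mul (1 + 2 * p ^ 2)
    have hne : √(1 + 2 * p ^ 2 + 2 * x ^ 2) ≠ 0 := (Real.sqrt_pos.2 hS).ne'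
    have h3 := ((hasDerivAt_id x).div h2 (mul_ne_zero (by positivity) hne)).const_mul
      (2 / √Real.pi)
    refine h3.congr_deriv ?_
    have hsq := Real.sq_sqrt hS.le
    simp only [id]
    rw [show 1 + 2 * (p ^ 2 + x ^ 2) = 1 + 2 * p ^ 2 + 2 * x ^ 2 by ring]
    generalize √(1 + 2 * p ^ 2 + 2 * x ^ 2) = S at *
    congr 1
    have hp : 1 + 2 * p ^ 2 ≠ 0 := by positivity
    rw [← hsq]
    field_simp
    linear_combination 2 * hsq
  · simp

/-- The p-derivative is the preceding integral, whose primitive is an arctangent; the arctangent is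
turned into an arcsine at the end. -/
lemma integral_erf_mul_erf_gaussianReal (p q : ℝ) :
    ∫ g, erf (p * g) * erf (q * g) ∂(gaussianReal 0 1) =
      2 / Real.pi * Real.arcsin (2 * p * q / √((1 + 2 * p ^ 2) * (1 + 2 * q ^ 2))) := by
  have hpi : √Real.pi * √Real.pi = Real.pi := Real.mul_self_sqrt Real.pi_pos.le
  have hpi0 : √Real.pi ≠ 0 := (Real.sqrt_pos.2 Real.pi_pos).ne'
  have key : ∫ g, erf (p * g) * erf (q * g) ∂(gaussianReal 0 1) =
      2 / Real.pi * Real.arctan (2 * p * q / √(1 + 2 * p ^ 2 + 2 * q ^ 2)) := by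
    refine eq_of_hasDerivAt_eq
      (f := fun p => ∫ g, erf (p * g) * erf (q * g) ∂(gaussianReal 0 1))
      (g := fun p => 2 / Real.pi * Real.arctan (2 * p * q / √(1 + 2 * p ^ 2 + 2 * q ^ 2)))
      (f' := fun p => 2 / √Real.pi * (2 / √Real.pi *
        (q / ((1 + 2 * p ^ 2) * √(1 + 2 * p ^ 2 + 2 * q ^ 2))))) ?_ ?_ ?_ p
    · intro x
      have hm : AEStronglyMeasurable (fun g => erf (q * g)) (gaussianReal 0 1) := by fun_prop
      have := hasDerivAt_integral_mul_erf (μ := gaussianReal 0 1)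
        (f := fun g => erf (q * g))
        (A := fun _ => 0) (B := fun g => g) ?_ (by fun_prop) (by fun_prop) ?_ x
      · simp only [zero_add] at this
        rw [← integral_mul_exp_mul_erf_gaussianReal, ← integral_const_mul]
        have h2 := this.congr_deriv (integral_congr_ae (g := fun g =>
          2 / √Real.pi * (g * Real.exp (-(x * g) ^ 2) * erf (q * g)))
          (Eventually.of_forall fun g => by dsimp only; ring))
        simpa only [mul_comm (erf (q * _))] using h2
      · exact Integrable.mono (integrable_const (1 : ℝ)) hm
          (Eventually.of_forall fun g => by simpa using abs_erf_le_one _)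
      · refine integrable_id_gaussianReal.mono (by fun_prop) (Eventually.of_forall fun g => ?_)
        rw [norm_mul, Real.norm_eq_abs (erf _)]
        exact mul_le_of_le_one_left (norm_nonneg _) (abs_erf_le_one _)
    · intro x
      have hS : 0 < 1 + 2 * x ^ 2 + 2 * q ^ 2 := by positivity
      have h1 : HasDerivAt (fun p : ℝ => 1 + 2 * p ^ 2 + 2 * q ^ 2) (4 * x) x := by
        refine ((((hasDerivAt_pow 2 x).const_mul 2).const_add 1).add_const
          (2 * q ^ 2)).congr_deriv ?_
        norm_num; ring
      have hne : √(1 + 2 * x ^ 2 + 2 * q ^ 2) ≠ 0 := (Real.sqrt_pos.2 hS).ne'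
      have h2 : HasDerivAt (fun p : ℝ => 2 * p * q) (2 * q) x := by
        simpa using ((hasDerivAt_id x).const_mul 2).mul_const q
      have h3 := ((h2.div (h1.sqrt hS.ne') hne).arctan).const_mul (2 / Real.pi)
      refine h3.congr_deriv ?_
      have hsq := Real.sq_sqrt hS.le
      have hpi' : 2 / √Real.pi * (2 / √Real.pi) = 2 / Real.pi * 2 := by
        rw [div_mul_div_comm, hpi]; ring
      rw [← mul_assoc (2 / √Real.pi), hpi', mul_assoc (2 / Real.pi) 2]
      congr 1
      simp only [Pi.div_apply]
      generalize √(1 + 2 * x ^ 2 + 2 * q ^ 2) = S at *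
      have hp : 1 + 2 * x ^ 2 ≠ 0 := by positivity
      have hfac : S ^ 2 + (2 * x * q) ^ 2 = (1 + 2 * x ^ 2) * (1 + 2 * q ^ 2) := by
        rw [hsq]; ring
      have h4 : 1 + (2 * x * q / S) ^ 2 = (1 + 2 * x ^ 2) * (1 + 2 * q ^ 2) / S ^ 2 := by
        rw [← hfac]; field_simp
      have hq : 1 + 2 * q ^ 2 ≠ 0 := by positivity
      rw [h4]
      field_simp
      linear_combination 2 * q * hsq
    · simp
  have hS : 0 < 1 + 2 * p ^ 2 + 2 * q ^ 2 := by positivity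
  rw [key, Real.arctan_eq_arcsin]
  congr 2
  have hsq := Real.sq_sqrt hS.le
  have hne : 0 < √(1 + 2 * p ^ 2 + 2 * q ^ 2) := Real.sqrt_pos.2 hS
  have h4 : 1 + (2 * p * q / √(1 + 2 * p ^ 2 + 2 * q ^ 2)) ^ 2 =
      (1 + 2 * p ^ 2) * (1 + 2 * q ^ 2) / √(1 + 2 * p ^ 2 + 2 * q ^ 2) ^ 2 := by
    field_simp
    rw [hsq]; ring
  rw [h4, Real.sqrt_div (by positivity), Real.sqrt_sq hne.le, div_div_div_cancel_right₀ hne.ne']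

/-! ### The arcsine formula for correlations -/

/-- The correlation `𝔼ₓ[erf(wᵀx) erf(uᵀx)]` in closed form. -/
def corr {d : ℕ} (w u : Vec d) : ℝ :=
  2 / Real.pi * Real.arcsin
    (2 * inner ℝ w u / √((1 + 2 * ‖w‖ ^ 2) * (1 + 2 * ‖u‖ ^ 2)))

/-- Split u = r•e + f with e the direction of w and f orthogonal to e. The Gaussian variables ⟪e,x⟫
and ⟪f,x⟫ are uncorrelated, hence independent. Integrating out the second only rescales the argument
of `erf`, which leaves the one-dimensional formula. -/
lemma integral_erf_inner_mul_erf_inner {d : ℕ} (w u : Vec d) :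
    ∫ x, erf (inner ℝ w x) * erf (inner ℝ u x) ∂(stdGaussian (Vec d)) = corr w u := by
  rcases eq_or_ne w 0 with rfl | hw
  · simp [corr]
  have hw0 : 0 < ‖w‖ := norm_pos_iff.2 hw
  set e : Vec d := ‖w‖⁻¹ • w with he
  have hen : ‖e‖ = 1 := by
    rw [he, norm_smul, norm_inv, norm_norm, inv_mul_cancel₀ hw0.ne']
  have hwe : w = ‖w‖ • e := by rw [he, smul_smul, mul_inv_cancel₀ hw0.ne', one_smul]
  set r : ℝ := inner ℝ e u with hr
  set f : Vec d := u - r • e with hf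
  have hef : inner ℝ e f = 0 := by
    rw [hf, inner_sub_right, inner_smul_right, real_inner_self_eq_norm_sq, hen, ← hr]; ring
  have huf : u = r • e + f := by rw [hf]; abel
  set P := stdGaussian (Vec d) with hP
  have hpair : HasGaussianLaw (fun x : Vec d => (inner ℝ e x, inner ℝ f x)) P := by
    have := (IsGaussian.hasGaussianLaw_id (μ := P)).map_fun
      ((innerSL ℝ e).prod (innerSL ℝ f))
    simpa using this
  have hcov : cov[fun x => inner ℝ e x, fun x => inner ℝ f x; P] = 0 := by
    rw [← covarianceBilin_apply_eq_cov (μ := P) IsGaussian.memLp_two_id, hP,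
      covarianceBilin_stdGaussian]
    exact hef
  have hind := hpair.indepFun_of_covariance_eq_zero hcov
  have hlaw : ∀ v : Vec d, P.map (fun x => inner ℝ v x) =
      (gaussianReal 0 1).map (fun g => ‖v‖ * g) := by
    intro v
    have h1 : HasGaussianLaw (fun x : Vec d => inner ℝ v x) P :=
      (IsGaussian.hasGaussianLaw_id (μ := P)).map_fun (innerSL ℝ v)
    have hmean : P[fun x : Vec d => inner ℝ v x] = 0 :=
      integral_strongDual_stdGaussian (innerSL ℝ v)
    have hvar : Var[fun x : Vec d => inner ℝ v x; P] = ‖v‖ ^ 2 := by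
      have := variance_dual_stdGaussian (innerSL ℝ v)
      rwa [innerSL_apply_norm] at this
    rw [h1.map_eq_gaussianReal, hmean, hvar, gaussianReal_map_const_mul, mul_zero]
    congr 1
    ext
    simp
  have hmap : P.map (fun x : Vec d => (inner ℝ e x, inner ℝ f x)) =
      ((gaussianReal 0 1).prod ((gaussianReal 0 1).map (fun g => ‖f‖ * g))) := by
    have h1 := (indepFun_iff_map_prod_eq_prod_map_map (by fun_prop) (by fun_prop)).1 hind
    rw [h1, hlaw, hlaw, hen]
    simp
  have hu2 : ‖u‖ ^ 2 = r ^ 2 + ‖f‖ ^ 2 := by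
    rw [huf, norm_add_sq_real, inner_smul_left, hef, norm_smul, hen]
    simp
  have hwu : inner ℝ w u = ‖w‖ * r := by
    conv_lhs => rw [hwe]
    rw [inner_smul_left]; simp [hr]
  set μ1 := (gaussianReal 0 1).map (fun g : ℝ => ‖f‖ * g) with hμ1
  have : IsProbabilityMeasure μ1 := Measure.isProbabilityMeasure_map (by fun_prop)
  have hs0 : 0 < 1 + 2 * ‖f‖ ^ 2 := by positivity
  calc ∫ x, erf (inner ℝ w x) * erf (inner ℝ u x) ∂P
      = ∫ x, (fun p : ℝ × ℝ => erf (‖w‖ * p.1) * erf (r * p.1 + p.2))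
          (inner ℝ e x, inner ℝ f x) ∂P := by
        congr 1; ext x
        conv_lhs => rw [hwe, huf]
        simp [inner_add_left, inner_smul_left]
    _ = ∫ p, erf (‖w‖ * p.1) * erf (r * p.1 + p.2) ∂((gaussianReal 0 1).prod μ1) := by
        rw [← hmap, integral_map (by fun_prop) (by fun_prop)]
    _ = ∫ g, ∫ h, erf (‖w‖ * g) * erf (r * g + h) ∂μ1 ∂(gaussianReal 0 1) := by
        refine integral_prod _ (Integrable.mono (integrable_const (1 : ℝ)) (by fun_prop)
          (Eventually.of_forall fun p => ?_))
        rw [norm_mul]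
        simpa using mul_le_one₀ (abs_erf_le_one _) (abs_nonneg _) (abs_erf_le_one _)
    _ = ∫ g, erf (‖w‖ * g) * erf (r / √(1 + 2 * ‖f‖ ^ 2) * g) ∂(gaussianReal 0 1) := by
        congr 1; ext g
        rw [integral_const_mul, hμ1, integral_map (by fun_prop) (by fun_prop),
          integral_erf_affine_gaussianReal]
        ring_nf
    _ = corr w u := by
        rw [integral_erf_mul_erf_gaussianReal, corr, hwu, hu2]
        congr 2
        have h1 : 1 + 2 * (r / √(1 + 2 * ‖f‖ ^ 2)) ^ 2 =
            (1 + 2 * (r ^ 2 + ‖f‖ ^ 2)) / (1 + 2 * ‖f‖ ^ 2) := by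
          rw [div_pow, Real.sq_sqrt hs0.le]
          field_simp; ring
        rw [h1, ← mul_div_assoc (1 + 2 * ‖w‖ ^ 2), Real.sqrt_div (by positivity)]
        have := (Real.sqrt_pos.2 hs0).ne'
        field_simp

lemma integral_erf_inner {d : ℕ} (w : Vec d) :
    ∫ x, erf (inner ℝ w x) ∂(stdGaussian (Vec d)) = 0 := by
  have h := stdGaussian_map (LinearIsometryEquiv.neg ℝ (E := Vec d))
  have h2 : ∫ x, erf (inner ℝ w x) ∂((stdGaussian (Vec d)).map
      (LinearIsometryEquiv.neg ℝ (E := Vec d))) =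
      ∫ x, erf (inner ℝ w (-x)) ∂(stdGaussian (Vec d)) := by
    rw [integral_map (by fun_prop) (by fun_prop)]
    rfl
  rw [h] at h2
  simp_rw [inner_neg_right, erf_neg, integral_neg] at h2
  linarith

/-! ### Closed form of the objective -/

instance isProbabilityMeasure_inputLaw (k d : ℕ) : IsProbabilityMeasure (inputLaw k d) := by
  unfold inputLaw; infer_instance

lemma integrable_of_bounded {Ω : Type*} [MeasurableSpace Ω] {μ : Measure Ω} [IsFiniteMeasure μ]
    {f : Ω → ℝ} (hf : Measurable f) (C : ℝ) (h : ∀ ω, |f ω| ≤ C) : Integrable f μ :=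
  Integrable.mono' (integrable_const C) hf.aestronglyMeasurable (Eventually.of_forall h)

lemma abs_prod_erf_le_one {k d : ℕ} (w : Weights k d) (x : Fin k → Vec d) :
    |∏ l, erf (inner ℝ (w l) (x l))| ≤ 1 := by
  rw [Finset.abs_prod]
  exact Finset.prod_le_one (fun _ _ => abs_nonneg _) fun _ _ => abs_erf_le_one _

lemma integral_sub_two_mul_add {Ω : Type*} [MeasurableSpace Ω] {μ : Measure Ω} {f g h : Ω → ℝ}
    (hf : Integrable f μ) (hg : Integrable g μ) (hh : Integrable h μ) :
    ∫ ω, (f ω - 2 * g ω + h ω) ∂μ = (∫ ω, f ω ∂μ) - 2 * (∫ ω, g ω ∂μ) + ∫ ω, h ω ∂μ := by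
  have h1 : Integrable (fun ω => f ω - 2 * g ω) μ := hf.sub (hg.const_mul 2)
  rw [integral_add h1 hh, integral_sub hf (hg.const_mul 2), integral_const_mul]

lemma integral_inputLaw_prod {k d : ℕ} (f : Fin k → Vec d → ℝ) :
    ∫ x, ∏ l, f l (x l) ∂(inputLaw k d) = ∏ l, ∫ y, f l y ∂(stdGaussian (Vec d)) :=
  integral_fintype_prod_eq_prod f

lemma integral_prod_mul_prod {k d : ℕ} (w w' : Weights k d) :
    ∫ x, (∏ l, erf (inner ℝ (w l) (x l))) * ∏ l, erf (inner ℝ (w' l) (x l)) ∂(inputLaw k d) =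
      ∏ l, corr (w l) (w' l) := by
  simp_rw [← Finset.prod_mul_distrib, ← integral_erf_inner_mul_erf_inner]
  exact integral_inputLaw_prod fun l y => erf (inner ℝ (w l) y) * erf (inner ℝ (w' l) y)

section predictor

variable {k d : ℕ} [NeZero k] (w w' : Weights k d)

lemma measurable_predictor : Measurable (predictor w) := by
  unfold predictor; fun_prop

lemma abs_predictor_le (x : Fin k → Vec d) : |predictor w x| ≤ 2 :=
  (abs_add_le _ _).trans <|
    (add_le_add (abs_erf_le_one _) (abs_prod_erf_le_one w x)).trans_eq one_add_one_eq_two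

lemma integral_first_mul_first :
    ∫ x, erf (inner ℝ (w 0) (x 0)) * erf (inner ℝ (w' 0) (x 0)) ∂(inputLaw k d) =
      corr (w 0) (w' 0) := by
  -- A function of the first input alone is a product over all indices with the other factors equal
  -- to 1.
  have h := integral_inputLaw_prod (k := k) (d := d) fun l y =>
    if l = 0 then erf (inner ℝ (w 0) y) * erf (inner ℝ (w' 0) y) else 1
  have h1 : ∀ l : Fin k, ∫ y, (if l = 0 then erf (inner ℝ (w 0) y) * erf (inner ℝ (w' 0) y)
      else 1) ∂(stdGaussian (Vec d)) = if l = 0 then corr (w 0) (w' 0) else 1 := by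
    intro l
    split_ifs
    · exact integral_erf_inner_mul_erf_inner _ _
    · simp
  simp_rw [h1, Finset.prod_ite_eq' Finset.univ (0 : Fin k)] at h
  simpa using h

/-- The factor with index 1 is odd and independent of the rest, so it contributes a vanishing mean.
-/
lemma integral_first_mul_prod (hk : 2 ≤ k) :
    ∫ x, erf (inner ℝ (w 0) (x 0)) * ∏ l, erf (inner ℝ (w' l) (x l)) ∂(inputLaw k d) = 0 := by
  have h := integral_inputLaw_prod (k := k) (d := d) fun l y =>
    (if l = 0 then erf (inner ℝ (w 0) y) else 1) * erf (inner ℝ (w' l) y)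
  simp_rw [Finset.prod_mul_distrib, Finset.prod_ite_eq' Finset.univ (0 : Fin k)] at h
  have h1 : (⟨1, hk⟩ : Fin k) ≠ 0 := by
    simp [Fin.ext_iff]
  rw [Finset.prod_eq_zero (Finset.mem_univ (⟨1, hk⟩ : Fin k))] at h
  · simpa using h
  · simp [h1, integral_erf_inner]

lemma integral_predictor_mul_predictor (hk : 2 ≤ k) :
    ∫ x, predictor w x * predictor w' x ∂(inputLaw k d) =
      corr (w 0) (w' 0) + ∏ l, corr (w l) (w' l) := by
  have e : ∀ x : Fin k → Vec d, predictor w x * predictor w' x =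
      (erf (inner ℝ (w 0) (x 0)) * erf (inner ℝ (w' 0) (x 0)) +
        (∏ l, erf (inner ℝ (w l) (x l))) * ∏ l, erf (inner ℝ (w' l) (x l))) +
      (erf (inner ℝ (w 0) (x 0)) * (∏ l, erf (inner ℝ (w' l) (x l))) +
        erf (inner ℝ (w' 0) (x 0)) * ∏ l, erf (inner ℝ (w l) (x l))) := by
    intro x; unfold predictor; ring
  have b1 : ∀ (v v' : Weights k d), Integrable (fun x : Fin k → Vec d =>
      erf (inner ℝ (v 0) (x 0)) * erf (inner ℝ (v' 0) (x 0))) (inputLaw k d) := fun v v' =>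
    integrable_of_bounded (by fun_prop) 1 fun x => by
      rw [abs_mul]; exact mul_le_one₀ (abs_erf_le_one _) (abs_nonneg _) (abs_erf_le_one _)
  have b2 : ∀ (v v' : Weights k d), Integrable (fun x : Fin k → Vec d =>
      (∏ l, erf (inner ℝ (v l) (x l))) * ∏ l, erf (inner ℝ (v' l) (x l))) (inputLaw k d) :=
    fun v v' => integrable_of_bounded (by fun_prop) 1 fun x => by
      rw [abs_mul]
      exact mul_le_one₀ (abs_prod_erf_le_one _ _) (abs_nonneg _) (abs_prod_erf_le_one _ _)
  have b3 : ∀ (v v' : Weights k d), Integrable (fun x : Fin k → Vec d =>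
      erf (inner ℝ (v 0) (x 0)) * ∏ l, erf (inner ℝ (v' l) (x l))) (inputLaw k d) :=
    fun v v' => integrable_of_bounded (by fun_prop) 1 fun x => by
      rw [abs_mul]
      exact mul_le_one₀ (abs_erf_le_one _) (abs_nonneg _) (abs_prod_erf_le_one _ _)
  simp_rw [e]
  have b4 : Integrable (fun x : Fin k → Vec d =>
      erf (inner ℝ (w 0) (x 0)) * erf (inner ℝ (w' 0) (x 0)) +
        (∏ l, erf (inner ℝ (w l) (x l))) * ∏ l, erf (inner ℝ (w' l) (x l))) (inputLaw k d) :=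
    (b1 w w').add (b2 w w')
  have b5 : Integrable (fun x : Fin k → Vec d =>
      erf (inner ℝ (w 0) (x 0)) * (∏ l, erf (inner ℝ (w' l) (x l))) +
        erf (inner ℝ (w' 0) (x 0)) * ∏ l, erf (inner ℝ (w l) (x l))) (inputLaw k d) :=
    (b3 w w').add (b3 w' w)
  rw [integral_add b4 b5, integral_add (b1 w w') (b2 w w'), integral_add (b3 w w') (b3 w' w),
    integral_first_mul_first, integral_prod_mul_prod, integral_first_mul_prod _ _ hk,
    integral_first_mul_prod _ _ hk]
  ring

lemma integral_predictor_mul_predictor_of_eq_one (hk : k = 1) :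
    ∫ x, predictor w x * predictor w' x ∂(inputLaw k d) = 4 * corr (w 0) (w' 0) := by
  rw [← integral_first_mul_first, ← integral_const_mul]
  congr 1
  ext x
  subst hk
  simp only [predictor, Finset.univ_unique, Fin.default_eq_zero, Finset.prod_singleton]
  ring

lemma objective_eq_integral (u₀ : Vec d) :
    objective u₀ w = 1 / 2 * ((∫ x, predictor w x * predictor w x ∂(inputLaw k d)) -
      2 * (∫ x, predictor w x * predictor (shared k u₀) x ∂(inputLaw k d)) +
      ∫ x, predictor (shared k u₀) x * predictor (shared k u₀) x ∂(inputLaw k d)) := by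
  have b : ∀ v v' : Weights k d,
      Integrable (fun x => predictor v x * predictor v' x) (inputLaw k d) := fun v v' =>
    integrable_of_bounded ((measurable_predictor v).mul (measurable_predictor v')) 4 fun x => by
      rw [abs_mul]
      nlinarith [abs_predictor_le v x, abs_predictor_le v' x, abs_nonneg (predictor v x),
        abs_nonneg (predictor v' x)]
  rw [objective, ← integral_sub_two_mul_add (b _ _) (b _ _) (b _ _), ← integral_const_mul]
  congr 1
  ext x
  ring

end predictor

lemma objective_eq {k d : ℕ} [NeZero k] (hk : 2 ≤ k) (u₀ : Vec d) (w : Weights k d) :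
    objective u₀ w = 1 / 2 * (corr (w 0) (w 0) - 2 * corr (w 0) u₀ + corr u₀ u₀) +
      (1 / 2 * ∏ l, corr (w l) (w l) - ∏ l, corr (w l) u₀ + 1 / 2 * corr u₀ u₀ ^ k) := by
  rw [objective_eq_integral]
  simp_rw [integral_predictor_mul_predictor _ _ hk]
  simp only [shared, Finset.prod_const, Finset.card_univ, Fintype.card_fin]
  ring

lemma objective_eq_of_eq_one {k d : ℕ} [NeZero k] (hk : k = 1) (u₀ : Vec d) (w : Weights k d) :
    objective u₀ w = 2 * (corr (w 0) (w 0) - 2 * corr (w 0) u₀ + corr u₀ u₀) := by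
  rw [objective_eq_integral]
  simp_rw [integral_predictor_mul_predictor_of_eq_one _ _ hk]
  simp only [shared]
  ring

/-- This is the expectation of (erf(wᵀx) - erf(uᵀx))². -/
lemma corr_self_add_corr_self_nonneg {d : ℕ} (w u : Vec d) :
    0 ≤ corr w w - 2 * corr w u + corr u u := by
  have b : ∀ v v' : Vec d, Integrable (fun x : Vec d =>
      erf (inner ℝ v x) * erf (inner ℝ v' x)) (stdGaussian (Vec d)) := fun v v' =>
    integrable_of_bounded (by fun_prop) 1 fun x => by
      rw [abs_mul]; exact mul_le_one₀ (abs_erf_le_one _) (abs_nonneg _) (abs_erf_le_one _)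
  simp_rw [← integral_erf_inner_mul_erf_inner]
  rw [← integral_sub_two_mul_add (b _ _) (b _ _) (b _ _)]
  refine integral_nonneg fun x => ?_
  have : (0 : ℝ) ≤ (erf (inner ℝ w x) - erf (inner ℝ u x)) ^ 2 := sq_nonneg _
  simp only [Pi.zero_apply]
  linarith

/-! ### The gradient of the objective -/

/-- The vector `ν` with `corr w u = 2/π * arcsin (⟪w, ν⟫ / √(1 + 2‖w‖²))`. -/
def signal {d : ℕ} (u : Vec d) : Vec d := (2 / √(1 + 2 * ‖u‖ ^ 2)) • u

/-- The argument of the arcsine in `corr w u`, where `ν = signal u`. -/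
def overlap {d : ℕ} (ν w : Vec d) : ℝ := inner ℝ w ν / √(1 + 2 * ‖w‖ ^ 2)

/-- The radial coefficient of the gradient of `w ↦ corr w w`, as a function of `x = ‖w‖²`. -/
def radialCoef (x : ℝ) : ℝ := 8 / Real.pi / ((1 + 2 * x) * √(1 + 4 * x))

/-- The gradient of `w ↦ corr w u`, where `ν = signal u`. -/
def signalGrad {d : ℕ} (ν w : Vec d) : Vec d :=
  (2 / Real.pi / √(1 - overlap ν w ^ 2) / √(1 + 2 * ‖w‖ ^ 2)) •
    (ν - (2 * inner ℝ w ν / (1 + 2 * ‖w‖ ^ 2)) • w)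

/-- The expectation of `erf(wᵀx)²` as a function of `x = ‖w‖²`. -/
def selfCorr (x : ℝ) : ℝ := 2 / Real.pi * Real.arcsin (2 * x / (1 + 2 * x))

section
variable {d : ℕ} (u w : Vec d)

lemma corr_eq_arcsin_overlap : corr w u = 2 / Real.pi * Real.arcsin (overlap (signal u) w) := by
  rw [corr, overlap, signal, inner_smul_right, Real.sqrt_mul (by positivity)]
  congr 2
  field_simp

lemma corr_self : corr w w = selfCorr (‖w‖ ^ 2) := by
  rw [corr, selfCorr, real_inner_self_eq_norm_sq, Real.sqrt_mul_self (by positivity)]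

lemma norm_sq_signal : ‖signal u‖ ^ 2 = 4 * ‖u‖ ^ 2 / (1 + 2 * ‖u‖ ^ 2) := by
  rw [signal, norm_smul, mul_pow, Real.norm_eq_abs, sq_abs, div_pow, Real.sq_sqrt (by positivity)]
  ring

lemma norm_sq_signal_lt : ‖signal u‖ ^ 2 < 2 := by
  rw [norm_sq_signal, div_lt_iff₀ (by positivity)]
  linarith

lemma overlap_sq_le (ν : Vec d) :
    overlap ν w ^ 2 ≤ ‖ν‖ ^ 2 * ‖w‖ ^ 2 / (1 + 2 * ‖w‖ ^ 2) := by
  rw [overlap, div_pow, Real.sq_sqrt (by positivity)]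
  gcongr
  rw [← mul_pow, mul_comm ‖ν‖]
  exact sq_le_sq' (neg_le_of_abs_le (abs_real_inner_le_norm w ν)) (real_inner_le_norm w ν)

/-- Keeps the argument of the arcsine strictly inside (-1, 1), where it is differentiable. -/
lemma overlap_sq_lt_one {ν : Vec d} (hν : ‖ν‖ ^ 2 ≤ 2) : overlap ν w ^ 2 < 1 := by
  refine (overlap_sq_le w ν).trans_lt ?_
  rw [div_lt_one (by positivity)]
  nlinarith [sq_nonneg ‖w‖]

end

lemma hasGradientAt_iff_hasFDerivAt_innerSL {E : Type*} [NormedAddCommGroup E]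
    [InnerProductSpace ℝ E] [CompleteSpace E] {f : E → ℝ} {g w : E} :
    HasGradientAt f g w ↔ HasFDerivAt f (innerSL ℝ g) w := Iff.rfl

lemma hasFDerivAt_norm_sq_affine {d : ℕ} (a b : ℝ) (w : Vec d) :
    HasFDerivAt (fun w : Vec d => a + b * ‖w‖ ^ 2) (innerSL ℝ ((2 * b) • w)) w := by
  have h := ((hasStrictFDerivAt_norm_sq w).hasFDerivAt.const_mul b).const_add a
  refine h.congr_fderiv ?_
  ext v
  simp
  ring

lemma hasFDerivAt_div {E : Type*} [NormedAddCommGroup E] [NormedSpace ℝ E] {f g : E → ℝ}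
    {f' g' : E →L[ℝ] ℝ} {w : E} (hf : HasFDerivAt f f' w) (hg : HasFDerivAt g g' w)
    (hne : g w ≠ 0) :
    HasFDerivAt (fun y => f y / g y) ((1 / g w) • f' - (f w / g w ^ 2) • g') w := by
  simp_rw [div_eq_mul_inv]
  refine (hf.mul ((hasDerivAt_inv hne).comp_hasFDerivAt w hg)).congr_fderiv ?_
  ext v
  simp
  field_simp
  ring

lemma hasGradientAt_corr {d : ℕ} (u w : Vec d) :
    HasGradientAt (fun w => corr w u) (signalGrad (signal u) w) w := by
  set ν := signal u with hν
  simp_rw [corr_eq_arcsin_overlap]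
  rw [hasGradientAt_iff_hasFDerivAt_innerSL]
  have hx : (0 : ℝ) < 1 + 2 * ‖w‖ ^ 2 := by positivity
  have hlt := overlap_sq_lt_one w (norm_sq_signal_lt u).le
  rw [← hν] at hlt
  have hsq := (hasFDerivAt_norm_sq_affine 1 2 w).sqrt hx.ne'
  have hin : HasFDerivAt (fun w : Vec d => inner ℝ w ν) (innerSL ℝ ν) w := by
    have := (innerSL ℝ ν).hasFDerivAt (x := w)
    refine this.congr_of_eventuallyEq (Eventually.of_forall fun y => ?_)
    simp [real_inner_comm]
  have hne := (Real.sqrt_pos.2 hx).ne'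
  have h1 := hasFDerivAt_div hin hsq hne
  have h2 := (Real.hasDerivAt_arcsin (x := overlap ν w) (by nlinarith) (by nlinarith)).comp_hasFDerivAt
    w h1
  have h3 := h2.const_mul (2 / Real.pi)
  refine h3.congr_fderiv ?_
  ext v
  have hs := Real.sq_sqrt hx.le
  simp only [signalGrad, smul_apply, innerSL_apply_apply,
    sub_apply, inner_smul_left, inner_sub_left, smul_eq_mul, map_div₀,
    conj_trivial]
  have hne2 : √(1 - overlap ν w ^ 2) ≠ 0 := (Real.sqrt_pos.2 (by linarith)).ne'
  generalize √(1 + 2 * ‖w‖ ^ 2) = S at *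
  rw [← hs]
  field_simp

lemma hasGradientAt_corr_self {d : ℕ} (w : Vec d) :
    HasGradientAt (fun w => corr w w) (radialCoef (‖w‖ ^ 2) • w) w := by
  simp_rw [corr_self, selfCorr]
  rw [hasGradientAt_iff_hasFDerivAt_innerSL]
  have hx : (0 : ℝ) < 1 + 2 * ‖w‖ ^ 2 := by positivity
  have h0 := hasFDerivAt_norm_sq_affine 0 2 w
  simp only [zero_add] at h0
  have h1 := hasFDerivAt_div h0 (hasFDerivAt_norm_sq_affine 1 2 w) hx.ne'
  have hlt : 2 * ‖w‖ ^ 2 / (1 + 2 * ‖w‖ ^ 2) < 1 := by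
    rw [div_lt_one hx]; linarith
  have hgt : 0 ≤ 2 * ‖w‖ ^ 2 / (1 + 2 * ‖w‖ ^ 2) := by positivity
  have h2 := (Real.hasDerivAt_arcsin (x := 2 * ‖w‖ ^ 2 / (1 + 2 * ‖w‖ ^ 2))
    (by linarith) (by linarith)).comp_hasFDerivAt w h1
  have h3 := h2.const_mul (2 / Real.pi)
  refine h3.congr_fderiv ?_
  ext v
  have e : 1 - (2 * ‖w‖ ^ 2 / (1 + 2 * ‖w‖ ^ 2)) ^ 2 =
      (1 + 4 * ‖w‖ ^ 2) / (1 + 2 * ‖w‖ ^ 2) ^ 2 := by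
    field_simp; ring
  have h4 : √(1 + 4 * ‖w‖ ^ 2) ≠ 0 := (Real.sqrt_pos.2 (by positivity)).ne'
  rw [e, Real.sqrt_div (by positivity), Real.sqrt_sq hx.le]
  simp only [radialCoef, smul_apply, innerSL_apply_apply,
    sub_apply, inner_smul_left, smul_eq_mul, map_div₀, map_mul, map_ofNat,
    conj_trivial]
  generalize √(1 + 4 * ‖w‖ ^ 2) = S at *
  field_simp
  ring

section
variable {k d : ℕ}

/-- Chain rule along the affine map that moves only the l-th vector: a block of the full gradient is
a partial gradient. -/
lemma hasGradientAt_of_eq_comp_update {F : Weights k d → ℝ} {w : Weights k d} (l : Fin k)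
    (hF : DifferentiableAt ℝ F w) {f : Vec d → ℝ} {g : Vec d}
    (hf : ∀ v, F (WithLp.toLp 2 (Function.update w.ofLp l v)) = f v) (hg : HasGradientAt f g (w l)) :
    (gradient F w) l = g := by
  have hG := hF.hasGradientAt
  let S : Vec d →L[ℝ] Weights k d :=
    (PiLp.continuousLinearEquiv 2 ℝ (fun _ : Fin k => Vec d)).symm.toContinuousLinearMap ∘L
      (ContinuousLinearMap.single ℝ (fun _ : Fin k => Vec d) l)
  have hS : ∀ v, S v = WithLp.toLp 2 (Pi.single l v) := fun v => rfl
  have haff : ∀ v, w + S (v - w l) = WithLp.toLp 2 (Function.update w.ofLp l v) := by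
    intro v
    ext j : 1
    rw [hS]
    by_cases hj : j = l
    · subst hj; simp
    · simp [hj]
  have hd : HasFDerivAt (fun v => w + S (v - w l)) S (w l) := by
    have h1 : HasFDerivAt (fun v : Vec d => v - w l) (ContinuousLinearMap.id ℝ (Vec d)) (w l) :=
      (hasFDerivAt_id _).sub_const _
    simpa using (HasFDerivAt.comp (w l) (g := S) (f := fun v : Vec d => v - w l)
      S.hasFDerivAt h1).const_add w
  have hG' : HasFDerivAt F (innerSL ℝ (gradient F w)) (w + S (w l - w l)) := by
    simpa using hasGradientAt_iff_hasFDerivAt_innerSL.1 hG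
  have hcomp := hG'.comp (w l) hd
  have hfe : F ∘ (fun v => w + S (v - w l)) = f := by
    ext v; simp only [Function.comp, haff, hf]
  rw [hfe] at hcomp
  have huniq := hcomp.unique (hasGradientAt_iff_hasFDerivAt_innerSL.1 hg)
  refine ext_inner_right ℝ fun v => ?_
  have := congrArg (fun L : Vec d →L[ℝ] ℝ => L v) huniq
  simp only [ContinuousLinearMap.comp_apply, innerSL_apply_apply, hS] at this
  rw [← this, PiLp.inner_apply (gradient F w), Finset.sum_eq_single l]
  · simp
  · intro j _ hj; simp [hj]
  · simp

lemma differentiable_corr_apply (u : Vec d) (l : Fin k) :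
    Differentiable ℝ fun w : Weights k d => corr (w l) u := fun w =>
  (hasGradientAt_corr u (w l)).differentiableAt.comp (g := fun v => corr v u)
    (f := fun w : Weights k d => w l) w
    (PiLp.proj 2 (fun _ : Fin k => Vec d) l : Weights k d →L[ℝ] Vec d).differentiableAt

lemma differentiable_corr_self_apply (l : Fin k) :
    Differentiable ℝ fun w : Weights k d => corr (w l) (w l) := fun w =>
  (hasGradientAt_corr_self (w l)).differentiableAt.comp (g := fun v => corr v v)
    (f := fun w : Weights k d => w l) w
    (PiLp.proj 2 (fun _ : Fin k => Vec d) l : Weights k d →L[ℝ] Vec d).differentiableAt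

variable [NeZero k]

lemma differentiable_objective (hk : 2 ≤ k) (u₀ : Vec d) :
    Differentiable ℝ (objective (k := k) u₀) := by
  have h1 := differentiable_corr_apply (k := k) u₀
  have h2 := differentiable_corr_self_apply (k := k) (d := d)
  have : objective (k := k) u₀ = fun w =>
      1 / 2 * (corr (w 0) (w 0) - 2 * corr (w 0) u₀ + corr u₀ u₀) +
      (1 / 2 * ∏ l, corr (w l) (w l) - ∏ l, corr (w l) u₀ + 1 / 2 * corr u₀ u₀ ^ k) :=
    funext (objective_eq hk u₀)
  rw [this]
  fun_prop

lemma gradient_objective_apply (hk : 2 ≤ k) (u₀ : Vec d) (w : Weights k d) {l : Fin k}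
    (hl : l ≠ 0) :
    gradient (objective u₀) w l =
      ((∏ j ∈ Finset.univ.erase l, corr (w j) (w j)) / 2 * radialCoef (‖w l‖ ^ 2)) • w l -
      (∏ j ∈ Finset.univ.erase l, corr (w j) u₀) • signalGrad (signal u₀) (w l) := by
  set D := ∏ j ∈ Finset.univ.erase l, corr (w j) (w j) with hD
  set P := ∏ j ∈ Finset.univ.erase l, corr (w j) u₀ with hP
  refine hasGradientAt_of_eq_comp_update l (differentiable_objective hk u₀ w)
    (f := fun v => 1 / 2 * (corr (w 0) (w 0) - 2 * corr (w 0) u₀ + corr u₀ u₀) +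
      (1 / 2 * (corr v v * D) - corr v u₀ * P + 1 / 2 * corr u₀ u₀ ^ k)) ?_ ?_
  · intro v
    rw [objective_eq hk, ← Finset.mul_prod_erase _ _ (Finset.mem_univ l),
      ← Finset.mul_prod_erase Finset.univ (fun j => corr _ u₀) (Finset.mem_univ l), hD, hP]
    simp only [Function.update_self, Function.update_of_ne hl.symm]
    have e : ∀ g : Vec d → ℝ, ∏ j ∈ Finset.univ.erase l, g (Function.update w.ofLp l v j) =
        ∏ j ∈ Finset.univ.erase l, g (w j) := fun g =>
      Finset.prod_congr rfl fun j hj => by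
        rw [Function.update_of_ne (Finset.ne_of_mem_erase hj)]
    rw [e fun z => corr z z, e fun z => corr z u₀]
  · have h1 := hasGradientAt_iff_hasFDerivAt_innerSL.1 (hasGradientAt_corr_self (w l))
    have h2 := hasGradientAt_iff_hasFDerivAt_innerSL.1 (hasGradientAt_corr u₀ (w l))
    rw [hasGradientAt_iff_hasFDerivAt_innerSL]
    refine (((((h1.mul_const D).const_mul (1 / 2)).sub (h2.mul_const P)).add_const
      (1 / 2 * corr u₀ u₀ ^ k)).const_add _).congr_fderiv ?_
    ext v
    simp
    ring

lemma gradient_objective_apply_of_eq_one (hk : k = 1) (u₀ : Vec d) (w : Weights k d) :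
    gradient (objective u₀) w 0 =
      (4 / 2 * radialCoef (‖w 0‖ ^ 2)) • w 0 - (4 : ℝ) • signalGrad (signal u₀) (w 0) := by
  have h1 := differentiable_corr_apply (k := k) u₀
  have h2 := differentiable_corr_self_apply (k := k) (d := d)
  have hobj : objective (k := k) u₀ = fun w =>
      2 * (corr (w 0) (w 0) - 2 * corr (w 0) u₀ + corr u₀ u₀) :=
    funext (objective_eq_of_eq_one hk u₀)
  refine hasGradientAt_of_eq_comp_update 0 ?_
    (f := fun v => 2 * (corr v v - 2 * corr v u₀ + corr u₀ u₀)) ?_ ?_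
  · rw [hobj]; fun_prop
  · intro v; rw [hobj]; simp
  · have h1 := hasGradientAt_iff_hasFDerivAt_innerSL.1 (hasGradientAt_corr_self (w 0))
    have h2 := hasGradientAt_iff_hasFDerivAt_innerSL.1 (hasGradientAt_corr u₀ (w 0))
    rw [hasGradientAt_iff_hasFDerivAt_innerSL]
    refine (((h1.sub (h2.const_mul 2)).add_const (corr u₀ u₀)).const_mul 2).congr_fderiv ?_
    ext v
    simp
    ring

end

/-! ### Bounds for one gradient step -/

/-- One gradient step for a single weight vector. -/
def descentStep {d : ℕ} (ν : Vec d) (η D P : ℝ) (w : Vec d) : Vec d :=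
  w - η • ((D / 2 * radialCoef (‖w‖ ^ 2)) • w - P • signalGrad ν w)

lemma radialCoef_nonneg {x : ℝ} (hx : 0 ≤ x) : 0 ≤ radialCoef x := by
  unfold radialCoef; positivity

lemma radialCoef_le {x : ℝ} (hx : 0 ≤ x) : radialCoef x ≤ 8 / 3 / (1 + 2 * x) := by
  unfold radialCoef
  have h1 : 1 ≤ √(1 + 4 * x) := Real.one_le_sqrt.2 (by linarith)
  have h2 : 8 / Real.pi ≤ 8 / 3 := by
    gcongr; exact Real.pi_gt_three.le
  calc 8 / Real.pi / ((1 + 2 * x) * √(1 + 4 * x)) ≤ 8 / 3 / ((1 + 2 * x) * 1) := by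
        gcongr
    _ = _ := by rw [mul_one]

lemma le_radialCoef {x : ℝ} (hx : 0 ≤ x) : 2 / ((1 + 2 * x) * √(1 + 4 * x)) ≤ radialCoef x := by
  unfold radialCoef
  have h2 : 2 ≤ 8 / Real.pi := by
    rw [le_div_iff₀ Real.pi_pos]; linarith [Real.pi_le_four]
  gcongr

/-- At large norm the radial force is only O(‖w‖⁻²), so long vectors shrink slowly. -/
lemma radialCoef_mul_cube_le {r : ℝ} (hr : 0 ≤ r) : radialCoef (r ^ 2) * r ^ 3 ≤ 1 := by
  unfold radialCoef
  have h1 : 2 * r ≤ √(1 + 4 * r ^ 2) := Real.le_sqrt_of_sq_le (by nlinarith)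
  have hpos : 0 < √(1 + 4 * r ^ 2) := Real.sqrt_pos.2 (by positivity)
  rw [div_mul_eq_mul_div, div_le_one (by positivity), div_mul_eq_mul_div,
    div_le_iff₀ Real.pi_pos]
  have h2 : 4 * r ^ 3 ≤ (1 + 2 * r ^ 2) * √(1 + 4 * r ^ 2) := by
    calc 4 * r ^ 3 = 2 * r ^ 2 * (2 * r) := by ring
      _ ≤ (1 + 2 * r ^ 2) * √(1 + 4 * r ^ 2) := by gcongr; linarith
  nlinarith [Real.pi_gt_three, pow_nonneg hr 3]

lemma selfCorr_nonneg {x : ℝ} (hx : 0 ≤ x) : 0 ≤ selfCorr x := by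
  unfold selfCorr
  have := Real.arcsin_nonneg.2 (show 0 ≤ 2 * x / (1 + 2 * x) by positivity)
  positivity

lemma arcsin_le_mul {q : ℝ} (h0 : 0 ≤ q) (h1 : q ≤ 1) : Real.arcsin q ≤ Real.pi / 2 * q := by
  have h := Real.mul_le_sin (Real.arcsin_nonneg.2 h0) (Real.arcsin_le_pi_div_two q)
  rw [Real.sin_arcsin (by linarith) h1] at h
  have := Real.pi_pos
  calc Real.arcsin q = Real.pi / 2 * (2 / Real.pi * Real.arcsin q) := by field_simp
    _ ≤ _ := by gcongr

lemma le_arcsin {q : ℝ} (h0 : 0 ≤ q) (h1 : q ≤ 1) : q ≤ Real.arcsin q := by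
  have h := Real.sin_le (Real.arcsin_nonneg.2 h0)
  rwa [Real.sin_arcsin (by linarith) h1] at h

lemma two_mul_div_le_one {x : ℝ} (hx : 0 ≤ x) : 2 * x / (1 + 2 * x) ≤ 1 := by
  rw [div_le_one (by positivity)]; linarith

lemma selfCorr_le {x : ℝ} (hx : 0 ≤ x) : selfCorr x ≤ 2 * x / (1 + 2 * x) := by
  unfold selfCorr
  have := arcsin_le_mul (show 0 ≤ 2 * x / (1 + 2 * x) by positivity) (two_mul_div_le_one hx)
  have hp := Real.pi_pos
  calc _ ≤ 2 / Real.pi * (Real.pi / 2 * (2 * x / (1 + 2 * x))) := by gcongr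
    _ = _ := by field_simp

lemma selfCorr_le_one {x : ℝ} (hx : 0 ≤ x) : selfCorr x ≤ 1 :=
  (selfCorr_le hx).trans (two_mul_div_le_one hx)

lemma le_two_mul_selfCorr {x : ℝ} (hx : 0 ≤ x) : 2 * x / (1 + 2 * x) ≤ 2 * selfCorr x := by
  unfold selfCorr
  have h := le_arcsin (show 0 ≤ 2 * x / (1 + 2 * x) by positivity) (two_mul_div_le_one hx)
  have h1 : 1 ≤ 2 * (2 / Real.pi) := by
    rw [← mul_div_assoc, le_div_iff₀ Real.pi_pos]; linarith [Real.pi_le_four]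
  have h0 : 0 ≤ Real.arcsin (2 * x / (1 + 2 * x)) := h.trans' (by positivity)
  nlinarith

lemma selfCorr_pos {x : ℝ} (hx : 0 < x) : 0 < selfCorr x := by
  have := le_two_mul_selfCorr hx.le
  have : 0 < 2 * x / (1 + 2 * x) := by positivity
  linarith

section
variable {d : ℕ} {ν w : Vec d} {η D P : ℝ}

lemma abs_corr_le {u : Vec d} : |corr w u| ≤ |overlap (signal u) w| := by
  have hs := (overlap_sq_lt_one w (norm_sq_signal_lt u).le)
  rw [corr_eq_arcsin_overlap]
  generalize overlap (signal u) w = s at *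
  have key : ∀ s : ℝ, 0 ≤ s → s ≤ 1 → |2 / Real.pi * Real.arcsin s| ≤ s := by
    intro s h0 h1
    have hp := Real.pi_pos
    have h2 := Real.arcsin_nonneg.2 h0
    rw [abs_of_nonneg (by positivity)]
    calc _ ≤ 2 / Real.pi * (Real.pi / 2 * s) := by gcongr; exact arcsin_le_mul h0 h1
      _ = _ := by field_simp
  rcases le_total 0 s with h | h
  · rw [abs_of_nonneg h]; exact key s h (by nlinarith)
  · have := key (-s) (by linarith) (by nlinarith)
    rwa [Real.arcsin_neg, mul_neg, abs_neg, ← abs_of_nonpos h] at this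

lemma inner_eq_overlap_mul : inner ℝ w ν = overlap ν w * √(1 + 2 * ‖w‖ ^ 2) := by
  rw [overlap, div_mul_cancel₀]
  exact (Real.sqrt_pos.2 (by positivity)).ne'

lemma inv_sqrt_one_sub_le {s : ℝ} (hs : |s| ≤ 1 / 2) : 2 / Real.pi / √(1 - s ^ 2) ≤ 4 / 5 := by
  have h1 : 5 / 6 ≤ √(1 - s ^ 2) := by
    refine Real.le_sqrt_of_sq_le ?_
    have := sq_le_sq' (neg_le_of_abs_le hs) (le_of_abs_le hs)
    nlinarith
  have h2 : 2 / Real.pi ≤ 2 / 3 := by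
    gcongr; exact Real.pi_gt_three.le
  rw [div_le_iff₀ (by linarith)]
  nlinarith

lemma norm_signalGrad_le (hν : ‖ν‖ ^ 2 ≤ 2) (hs : |overlap ν w| ≤ 1 / 2) :
    ‖signalGrad ν w‖ ≤ 2 / √(1 + 2 * ‖w‖ ^ 2) := by
  have hx : 0 < 1 + 2 * ‖w‖ ^ 2 := by positivity
  have hb : ‖ν - (2 * inner ℝ w ν / (1 + 2 * ‖w‖ ^ 2)) • w‖ ≤ 2 := by
    have h : ‖ν - (2 * inner ℝ w ν / (1 + 2 * ‖w‖ ^ 2)) • w‖ ^ 2 ≤ 2 := by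
      rw [norm_sub_sq_real, inner_smul_right, real_inner_comm w ν, norm_smul, mul_pow,
        Real.norm_eq_abs, sq_abs]
      -- The radial correction only shortens ν.
      have e : ‖ν‖ ^ 2 - 2 * (2 * inner ℝ w ν / (1 + 2 * ‖w‖ ^ 2) * inner ℝ w ν) +
          (2 * inner ℝ w ν / (1 + 2 * ‖w‖ ^ 2)) ^ 2 * ‖w‖ ^ 2 =
          ‖ν‖ ^ 2 - 4 * (inner ℝ w ν) ^ 2 * (1 + ‖w‖ ^ 2) / (1 + 2 * ‖w‖ ^ 2) ^ 2 := by
        field_simp; ring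
      rw [e]
      have : 0 ≤ 4 * (inner ℝ w ν) ^ 2 * (1 + ‖w‖ ^ 2) / (1 + 2 * ‖w‖ ^ 2) ^ 2 := by positivity
      linarith
    nlinarith [norm_nonneg (ν - (2 * inner ℝ w ν / (1 + 2 * ‖w‖ ^ 2)) • w)]
  rw [signalGrad, norm_smul, Real.norm_eq_abs, abs_of_nonneg (by positivity), div_mul_eq_mul_div]
  gcongr
  have := inv_sqrt_one_sub_le hs
  have h0 : 0 ≤ 2 / Real.pi / √(1 - overlap ν w ^ 2) := by positivity
  calc 2 / Real.pi / √(1 - overlap ν w ^ 2) *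
        ‖ν - (2 * inner ℝ w ν / (1 + 2 * ‖w‖ ^ 2)) • w‖ ≤ 4 / 5 * 2 := by gcongr
    _ ≤ 2 := by norm_num

/-- The radial correction cancels most of ⟪w,ν⟫ and leaves ⟪w,ν⟫/(1+2‖w‖²), so the signal barely
changes the norm. -/
lemma abs_inner_signalGrad_le (hs : |overlap ν w| ≤ 1 / 2) :
    |inner ℝ w (signalGrad ν w)| ≤ |overlap ν w| / (1 + 2 * ‖w‖ ^ 2) := by
  have hx : 0 < 1 + 2 * ‖w‖ ^ 2 := by positivity
  have hne := Real.sqrt_pos.2 hx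
  have hsq := Real.sq_sqrt hx.le
  have e : inner ℝ w (signalGrad ν w) =
      (2 / Real.pi / √(1 - overlap ν w ^ 2)) * (overlap ν w / (1 + 2 * ‖w‖ ^ 2)) := by
    rw [signalGrad, inner_smul_right, inner_sub_right, inner_smul_right,
      real_inner_self_eq_norm_sq, inner_eq_overlap_mul]
    have : ‖w‖ ^ 2 = (√(1 + 2 * ‖w‖ ^ 2) ^ 2 - 1) / 2 := by rw [hsq]; ring
    generalize overlap ν w = s at *
    generalize √(1 - s ^ 2) = c
    generalize √(1 + 2 * ‖w‖ ^ 2) = S at *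
    rw [← hsq, this]
    field_simp
    ring
  have h0 : 0 ≤ 2 / Real.pi / √(1 - overlap ν w ^ 2) := by positivity
  rw [e, abs_mul, abs_of_nonneg h0, abs_div, abs_of_pos hx]
  refine mul_le_of_le_one_left (by positivity) ?_
  linarith [inv_sqrt_one_sub_le hs]

lemma descentStep_eq_add :
    descentStep ν η D P w =
      (1 - η * D / 2 * radialCoef (‖w‖ ^ 2)) • w + (η * P) • signalGrad ν w := by
  rw [descentStep]
  module

/-- The squared overlap of c•w is c²⟪w,ν⟫²/(1+2c²‖w‖²), which increases with c². -/
lemma abs_overlap_smul_le {c : ℝ} (hc : |c| ≤ 1) : |overlap ν (c • w)| ≤ |overlap ν w| := by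
  have hc2 : c ^ 2 ≤ 1 := by rw [← sq_abs]; nlinarith [abs_nonneg c]
  refine sq_le_sq.1 ?_
  rw [overlap, overlap, div_pow, div_pow, Real.sq_sqrt (by positivity),
    Real.sq_sqrt (by positivity), inner_smul_left, norm_smul, mul_pow, mul_pow, Real.norm_eq_abs,
    sq_abs, div_le_div_iff₀ (by positivity) (by positivity)]
  simp only [conj_trivial]
  have : 0 ≤ (inner ℝ w ν) ^ 2 := sq_nonneg _
  nlinarith

/-- Half of the 3 comes from the change of the inner product, half from the change of the
normalization. -/
lemma abs_overlap_add_le (hν : ‖ν‖ ^ 2 ≤ 2) (a δ : Vec d) :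
    |overlap ν (a + δ)| ≤ |overlap ν a| + 3 * ‖δ‖ / √(1 + 2 * ‖a + δ‖ ^ 2) := by
  have hν' : ‖ν‖ ≤ 3 / 2 := by nlinarith [norm_nonneg ν]
  have hpos : ∀ z : Vec d, 0 < √(1 + 2 * ‖z‖ ^ 2) := fun z => Real.sqrt_pos.2 (by positivity)
  set S' := √(1 + 2 * ‖a + δ‖ ^ 2) with hS'
  set S := √(1 + 2 * ‖a‖ ^ 2) with hS
  have hS'0 : 0 < S' := hpos _
  have h1 : |inner ℝ (a + δ) ν| ≤ |overlap ν a| * S + 3 / 2 * ‖δ‖ := by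
    rw [inner_add_left]
    refine (abs_add_le _ _).trans (add_le_add ?_ ?_)
    · rw [inner_eq_overlap_mul, abs_mul, abs_of_pos (hpos a)]
    · refine (abs_real_inner_le_norm δ ν).trans ?_
      rw [mul_comm]; gcongr
  have h2 : S ≤ S' + 3 / 2 * ‖δ‖ := by
    refine Real.sqrt_le_iff.2 ⟨by positivity, ?_⟩
    have hle : ‖a‖ ≤ ‖a + δ‖ + ‖δ‖ := by
      simpa using norm_sub_le (a + δ) δ
    have hsq : S' ^ 2 = 1 + 2 * ‖a + δ‖ ^ 2 := Real.sq_sqrt (by positivity)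
    have hS'2 : 4 / 3 * ‖a + δ‖ ≤ S' := Real.le_sqrt_of_sq_le (by nlinarith [norm_nonneg (a + δ)])
    nlinarith [norm_nonneg a, norm_nonneg δ, norm_nonneg (a + δ),
      mul_le_mul_of_nonneg_right hS'2 (norm_nonneg δ)]
  have h3 : |overlap ν a| ≤ 1 := by
    have := overlap_sq_lt_one a hν
    exact abs_le_one_iff_mul_self_le_one.2 (by nlinarith)
  rw [overlap, abs_div, abs_of_pos hS'0, div_le_iff₀ hS'0, add_mul, div_mul_cancel₀ _ hS'0.ne']
  nlinarith [abs_nonneg (overlap ν a), norm_nonneg δ,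
    mul_le_mul_of_nonneg_left h2 (abs_nonneg (overlap ν a)),
    mul_le_mul_of_nonneg_right h3 (norm_nonneg δ)]

/-- A step is a radial rescaling followed by a push along `signalGrad`. The bound 4 puts the
rescaling factor in [-1, 1], so only the push can increase the overlap. One normalization comes from
the gradient, the other from the new overlap. -/
lemma abs_overlap_descentStep_le (hν : ‖ν‖ ^ 2 ≤ 2) (hs : |overlap ν w| ≤ 1 / 2) (hη : 0 ≤ η)
    (hη1 : η ≤ 1) (hD : 0 ≤ D) (hDA : D * radialCoef (‖w‖ ^ 2) ≤ 4) :
    |overlap ν (descentStep ν η D P w)| ≤ |overlap ν w| +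
      6 * |P| / (√(1 + 2 * ‖w‖ ^ 2) * √(1 + 2 * ‖descentStep ν η D P w‖ ^ 2)) := by
  have hA := radialCoef_nonneg (sq_nonneg ‖w‖)
  have hDA0 := mul_nonneg hD hA
  have hc : |1 - η * D / 2 * radialCoef (‖w‖ ^ 2)| ≤ 1 := by
    rw [abs_le]
    constructor <;> nlinarith
  have h := abs_overlap_add_le hν ((1 - η * D / 2 * radialCoef (‖w‖ ^ 2)) • w)
    ((η * P) • signalGrad ν w)
  rw [← descentStep_eq_add] at h
  refine h.trans (add_le_add (abs_overlap_smul_le hc) ?_)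
  rw [norm_smul, Real.norm_eq_abs, abs_mul, abs_of_nonneg hη, ← div_div]
  gcongr
  have hg := norm_signalGrad_le hν hs
  calc 3 * (η * |P| * ‖signalGrad ν w‖) ≤ 3 * (1 * |P| * (2 / √(1 + 2 * ‖w‖ ^ 2))) := by
        gcongr
    _ = _ := by ring

lemma norm_le_norm_descentStep_add (hν : ‖ν‖ ^ 2 ≤ 2) (hs : |overlap ν w| ≤ 1 / 2) (hη : 0 ≤ η)
    (hη1 : η ≤ 1) (hD : 0 ≤ D) :
    ‖w‖ ≤ ‖descentStep ν η D P w‖ +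
      (D / 2 * (radialCoef (‖w‖ ^ 2) * ‖w‖) + 2 * |P| / √(1 + 2 * ‖w‖ ^ 2)) := by
  have hA := radialCoef_nonneg (sq_nonneg ‖w‖)
  have e : w = descentStep ν η D P w +
      ((η * (D / 2 * radialCoef (‖w‖ ^ 2))) • w - (η * P) • signalGrad ν w) := by
    rw [descentStep]; module
  have h := norm_add_le (descentStep ν η D P w)
    ((η * (D / 2 * radialCoef (‖w‖ ^ 2))) • w - (η * P) • signalGrad ν w)
  rw [← e] at h
  refine h.trans (add_le_add le_rfl ((norm_sub_le _ _).trans (add_le_add ?_ ?_)))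
  · rw [norm_smul, Real.norm_eq_abs, abs_of_nonneg (by positivity)]
    calc η * (D / 2 * radialCoef (‖w‖ ^ 2)) * ‖w‖ ≤ 1 * (D / 2 * radialCoef (‖w‖ ^ 2)) * ‖w‖ := by
          gcongr
      _ = _ := by ring
  · rw [norm_smul, Real.norm_eq_abs, abs_mul, abs_of_nonneg hη]
    have hg := norm_signalGrad_le hν hs
    calc η * |P| * ‖signalGrad ν w‖ ≤ 1 * |P| * (2 / √(1 + 2 * ‖w‖ ^ 2)) := by gcongr
      _ = _ := by ring

end

/-! ### Overlaps over many steps -/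

section
variable {d : ℕ} {ι : Type*} {ν : Vec d} {w : ℕ → ι → Vec d} {η : ℕ → ℝ} {D P : ℕ → ι → ℝ}

/-- Overlaps that are small enough stay small, whatever the norms of the weights are. -/
lemma overlap_le_of_small (hν : ‖ν‖ ^ 2 ≤ 2) (hη : ∀ t, 0 ≤ η t) (hη1 : ∀ t, η t ≤ 1)
    (hD : ∀ t l, 0 ≤ D t l) (hD1 : ∀ t l, D t l ≤ 1)
    (hw : ∀ t l, w (t + 1) l = descentStep ν (η t) (D t l) (P t l) (w t l)) {m : ℕ}
    (hP : ∀ t σ, (∀ l, |overlap ν (w t l)| ≤ σ) → ∀ l, |P t l| ≤ σ ^ m)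
    {σ : ℝ} (hσ0 : 0 ≤ σ) (hσ : σ ≤ 1 / 4) {n N : ℕ} (hnN : n ≤ N)
    (hN : 6 * (N : ℝ) * (2 * σ) ^ m ≤ σ) (hstart : ∀ l, |overlap ν (w n l)| ≤ σ) (l : ι) :
    |overlap ν (w N l)| ≤ 2 * σ := by
  -- As long as all overlaps are at most 2σ, each step adds at most 6(2σ)^m, and the budget for N
  -- steps is σ.
  have key : ∀ i : ℕ, n + i ≤ N → ∀ l, |overlap ν (w (n + i) l)| ≤ σ + i * (6 * (2 * σ) ^ m) := by
    intro i
    induction i with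
    | zero => intro _ l; simpa using hstart l
    | succ i ih =>
      intro hi l
      have ih := ih (by omega)
      have hiN : (i : ℝ) * (6 * (2 * σ) ^ m) ≤ σ := by
        refine le_trans ?_ hN
        have : (i : ℝ) ≤ N := by exact_mod_cast (by omega : i ≤ N)
        calc (i : ℝ) * (6 * (2 * σ) ^ m) ≤ N * (6 * (2 * σ) ^ m) := by gcongr
          _ = _ := by ring
      have hs : ∀ l, |overlap ν (w (n + i) l)| ≤ 2 * σ := fun l => (ih l).trans (by linarith)
      have hA := radialCoef_nonneg (sq_nonneg ‖w (n + i) l‖)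
      have hA1 := radialCoef_le (sq_nonneg ‖w (n + i) l‖)
      have hA2 : 8 / 3 / (1 + 2 * ‖w (n + i) l‖ ^ 2) ≤ 8 / 3 :=
        div_le_self (by norm_num) (by nlinarith [sq_nonneg ‖w (n + i) l‖])
      have hstep := abs_overlap_descentStep_le (P := P (n + i) l) hν ((hs l).trans (by linarith))
        (hη (n + i)) (hη1 _) (hD (n + i) l) (by nlinarith [hD1 (n + i) l, hD (n + i) l])
      rw [← hw] at hstep
      have hden : 1 ≤ √(1 + 2 * ‖w (n + i) l‖ ^ 2) * √(1 + 2 * ‖w (n + i + 1) l‖ ^ 2) :=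
        one_le_mul_of_one_le_of_one_le (Real.one_le_sqrt.2 (by nlinarith [sq_nonneg ‖w (n + i) l‖]))
          (Real.one_le_sqrt.2 (by nlinarith [sq_nonneg ‖w (n + i + 1) l‖]))
      have hdrift : 6 * |P (n + i) l| /
          (√(1 + 2 * ‖w (n + i) l‖ ^ 2) * √(1 + 2 * ‖w (n + i + 1) l‖ ^ 2)) ≤ 6 * (2 * σ) ^ m :=
        (div_le_self (by positivity) hden).trans (by gcongr; exact hP _ _ hs l)
      rw [← add_assoc]
      push_cast
      linarith [ih l]
  obtain ⟨i, rfl⟩ := Nat.exists_eq_add_of_le hnN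
  refine (key i le_rfl l).trans ?_
  have : (i : ℝ) * (6 * (2 * σ) ^ m) ≤ 6 * ((n + i : ℕ) : ℝ) * (2 * σ) ^ m := by
    have h1 : (i : ℝ) ≤ ((n + i : ℕ) : ℝ) := by push_cast; linarith [n.cast_nonneg (α := ℝ)]
    calc (i : ℝ) * (6 * (2 * σ) ^ m) = 6 * (i : ℝ) * (2 * σ) ^ m := by ring
      _ ≤ _ := by gcongr
  linarith

/-- As long as the number of steps is too small for the norms to shrink, the overlaps move
slowly. -/
lemma overlap_le_of_large_norm (hν : ‖ν‖ ^ 2 ≤ 2) (hη : ∀ t, 0 ≤ η t) (hη1 : ∀ t, η t ≤ 1)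
    (hD : ∀ t l, 0 ≤ D t l) (hD4 : ∀ t l, D t l ≤ 4)
    (hw : ∀ t l, w (t + 1) l = descentStep ν (η t) (D t l) (P t l) (w t l)) {Q τ ρ : ℝ}
    (hP : ∀ t, (∀ l, |overlap ν (w t l)| ≤ 2 * τ) → ∀ l, |P t l| ≤ Q)
    (hQ : 0 ≤ Q) (hτ : τ ≤ 1 / 4) (hρ : 1 ≤ ρ) {N : ℕ}
    (hN1 : (N : ℝ) * (2 / ρ ^ 2 + 2 * Q / ρ) ≤ ρ) (hN2 : (N : ℝ) * (4 * Q / ρ ^ 2) ≤ τ)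
    (hnorm : ∀ l, 2 * ρ ≤ ‖w 0 l‖) (hstart : ∀ l, |overlap ν (w 0 l)| ≤ τ) (l : ι) :
    |overlap ν (w N l)| ≤ 2 * τ := by
  have hρ0 : 0 < ρ := by linarith
  -- Overlaps and norms are controlled together: norms at least ρ slow the drift, and small overlaps
  -- bound the norm loss caused by P.
  have key : ∀ i : ℕ, i ≤ N → ∀ l, |overlap ν (w i l)| ≤ τ + i * (4 * Q / ρ ^ 2) ∧
      2 * ρ - i * (2 / ρ ^ 2 + 2 * Q / ρ) ≤ ‖w i l‖ := by
    intro i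
    induction i with
    | zero => intro _ l; simpa using ⟨hstart l, hnorm l⟩
    | succ i ih =>
      intro hi l
      have ih := ih (by omega)
      have hiN : ((i + 1 : ℕ) : ℝ) ≤ N := by exact_mod_cast hi
      have hi1 : ((i + 1 : ℕ) : ℝ) * (4 * Q / ρ ^ 2) ≤ τ := le_trans (by gcongr) hN2
      have hi2 : ((i + 1 : ℕ) : ℝ) * (2 / ρ ^ 2 + 2 * Q / ρ) ≤ ρ := le_trans (by gcongr) hN1
      have p1 : 0 ≤ 4 * Q / ρ ^ 2 := by positivity
      have p2 : 0 ≤ 2 / ρ ^ 2 + 2 * Q / ρ := by positivity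
      push_cast at hi1 hi2 ⊢
      have hs : ∀ l, |overlap ν (w i l)| ≤ 2 * τ := fun l => (ih l).1.trans (by linarith)
      have hr : ρ ≤ ‖w i l‖ := le_trans (by linarith) (ih l).2
      have hr0 : 0 < ‖w i l‖ := by linarith
      have hA0 := radialCoef_nonneg (sq_nonneg ‖w i l‖)
      have hA := radialCoef_mul_cube_le (norm_nonneg (w i l))
      have hPl := hP i hs l
      -- 7/5 is a rational lower bound for √2; used twice, it turns the drift constant 6 into less
      -- than 4.
      have hsqrt : ∀ z : ℝ, ρ ≤ z → ρ * (7 / 5) ≤ √(1 + 2 * z ^ 2) := fun z hz =>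
        Real.le_sqrt_of_sq_le (by nlinarith)
      have hnrm := norm_le_norm_descentStep_add (P := P i l) hν ((hs l).trans (by linarith))
        (hη i) (hη1 i) (hD i l)
      rw [← hw] at hnrm
      have hloss1 : D i l / 2 * (radialCoef (‖w i l‖ ^ 2) * ‖w i l‖) ≤ 2 / ρ ^ 2 := by
        have h1 : radialCoef (‖w i l‖ ^ 2) * ‖w i l‖ ≤ 1 / ρ ^ 2 := by
          rw [le_div_iff₀ (by positivity)]
          refine le_trans ?_ hA
          calc _ ≤ radialCoef (‖w i l‖ ^ 2) * ‖w i l‖ * ‖w i l‖ ^ 2 := by gcongr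
            _ = _ := by ring
        calc _ ≤ 4 / 2 * (1 / ρ ^ 2) := by gcongr; exact hD4 i l
          _ = _ := by ring
      have hloss2 : 2 * |P i l| / √(1 + 2 * ‖w i l‖ ^ 2) ≤ 2 * Q / ρ := by
        gcongr
        linarith [hsqrt _ hr]
      have hnorm' : 2 * ρ - (i + 1) * (2 / ρ ^ 2 + 2 * Q / ρ) ≤ ‖w (i + 1) l‖ := by
        linarith [(ih l).2]
      have hr' : ρ ≤ ‖w (i + 1) l‖ := by linarith
      refine ⟨?_, hnorm'⟩
      have hA1 : radialCoef (‖w i l‖ ^ 2) ≤ 1 := by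
        refine le_trans ?_ hA
        exact le_mul_of_one_le_right hA0 (one_le_pow₀ (by linarith))
      have hstep := abs_overlap_descentStep_le (P := P i l) hν ((hs l).trans (by linarith))
        (hη i) (hη1 i) (hD i l) (by nlinarith [hD4 i l, hD i l])
      rw [← hw] at hstep
      have hdrift : 6 * |P i l| / (√(1 + 2 * ‖w i l‖ ^ 2) * √(1 + 2 * ‖w (i + 1) l‖ ^ 2)) ≤
          4 * Q / ρ ^ 2 := by
        calc _ ≤ 6 * Q / (ρ * (7 / 5) * (ρ * (7 / 5))) := by
              gcongr
              · exact hsqrt _ hr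
              · exact hsqrt _ hr'
          _ = 6 / (49 / 25) * Q / ρ ^ 2 := by field_simp; ring
          _ ≤ _ := by gcongr; norm_num
      linarith [(ih l).1]
  refine (key N le_rfl l).1.trans (by linarith)

end

/-! ### Radial shrinking and the balance of norms -/

lemma mul_arctan_le_arctan_mul {c z : ℝ} (hc0 : 0 ≤ c) (hc1 : c ≤ 1) (hz : 0 ≤ z) :
    c * Real.arctan z ≤ Real.arctan (c * z) := by
  have hd : ∀ y : ℝ, HasDerivAt (fun y => Real.arctan (c * y) - c * Real.arctan y)
      (1 / (1 + (c * y) ^ 2) * c - c * (1 / (1 + y ^ 2))) y := fun y => by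
    have h1 : HasDerivAt (fun y => c * y) c y := by simpa using (hasDerivAt_id y).const_mul c
    exact h1.arctan.sub ((Real.hasDerivAt_arctan y).const_mul c)
  have hmono : Monotone fun y => Real.arctan (c * y) - c * Real.arctan y := by
    refine monotone_of_deriv_nonneg (fun y => (hd y).differentiableAt) fun y => ?_
    rw [(hd y).deriv]
    have h2 : (c * y) ^ 2 ≤ y ^ 2 := by
      rw [mul_pow]; exact mul_le_of_le_one_left (sq_nonneg y) (pow_le_one₀ hc0 hc1)
    have h3 : 1 / (1 + y ^ 2) ≤ 1 / (1 + (c * y) ^ 2) := by gcongr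
    nlinarith
  have := hmono hz
  simp at this
  linarith

lemma div_arctan_le_div_arctan {y z : ℝ} (hy : 0 < y) (hyz : y ≤ z) :
    y / Real.arctan y ≤ z / Real.arctan z := by
  have hz : 0 < z := hy.trans_le hyz
  have h := mul_arctan_le_arctan_mul (c := y / z) (by positivity) ((div_le_one hz).2 hyz) hz.le
  rw [div_mul_cancel₀ _ hz.ne'] at h
  have hay : 0 < Real.arctan y := Real.arctan_pos.2 hy
  have haz : 0 < Real.arctan z := Real.arctan_pos.2 hz
  rw [div_le_div_iff₀ hay haz]
  rw [div_mul_eq_mul_div, div_le_iff₀ hz] at h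
  linarith

lemma arcsin_eq_arctan {x : ℝ} (hx : 0 ≤ x) :
    Real.arcsin (2 * x / (1 + 2 * x)) = Real.arctan (2 * x / √(1 + 4 * x)) := by
  have h4 : 0 < 1 + 4 * x := by positivity
  have hs := Real.sqrt_pos.2 h4
  have e : 1 + (2 * x / √(1 + 4 * x)) ^ 2 = (1 + 2 * x) ^ 2 / (1 + 4 * x) := by
    rw [div_pow, Real.sq_sqrt h4.le]; field_simp; ring
  rw [Real.arctan_eq_arcsin, e, Real.sqrt_div (by positivity), Real.sqrt_sq (by positivity),
    div_div_div_cancel_right₀ hs.ne']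

lemma selfCorr_mono {x y : ℝ} (hx : 0 ≤ x) (hxy : x ≤ y) : selfCorr x ≤ selfCorr y := by
  unfold selfCorr
  have hp := Real.pi_pos
  refine mul_le_mul_of_nonneg_left (Real.monotone_arcsin ?_) (by positivity)
  rw [div_le_div_iff₀ (by linarith) (by linarith)]
  nlinarith

lemma radialCoef_anti {x y : ℝ} (hx : 0 ≤ x) (hxy : x ≤ y) : radialCoef y ≤ radialCoef x := by
  have hp := Real.pi_pos
  have := Real.sqrt_pos.2 (show 0 < 1 + 4 * x by positivity)
  have hy : 0 ≤ y := hx.trans hxy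
  unfold radialCoef; gcongr

/-- The relative shrinking rate of a weight vector with `x = ‖w‖²`, up to a factor that is common
to all the vectors. -/
def shrinkRate (x : ℝ) : ℝ := radialCoef x / selfCorr x

lemma shrinkRate_nonneg {x : ℝ} (hx : 0 ≤ x) : 0 ≤ shrinkRate x :=
  div_nonneg (radialCoef_nonneg hx) (selfCorr_nonneg hx)

lemma shrinkRate_anti {x y : ℝ} (hx : 0 < x) (hxy : x ≤ y) : shrinkRate y ≤ shrinkRate x := by
  have := selfCorr_pos hx
  have := radialCoef_nonneg hx.le
  exact div_le_div₀ this (radialCoef_anti hx.le hxy) (selfCorr_pos hx) (selfCorr_mono hx.le hxy)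

/-- With z = 2x/√(1+4x), the product splits into z/arctan z and (1+4x)/(1+2x). Both increase with x,
which motivates the coordinate x + 4x². -/
lemma shrinkRate_mul_eq {x : ℝ} (hx : 0 < x) :
    shrinkRate x * (x + 4 * x ^ 2) =
      2 * ((2 * x / √(1 + 4 * x)) / Real.arctan (2 * x / √(1 + 4 * x))) *
        ((1 + 4 * x) / (1 + 2 * x)) := by
  have h4 : 0 < 1 + 4 * x := by positivity
  have hs := Real.sqrt_pos.2 h4
  have ha : 0 < Real.arctan (2 * x / √(1 + 4 * x)) := Real.arctan_pos.2 (by positivity)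
  have hp := Real.pi_pos
  rw [shrinkRate, radialCoef, selfCorr, arcsin_eq_arctan hx.le]
  generalize Real.arctan (2 * x / √(1 + 4 * x)) = ψ at *
  generalize √(1 + 4 * x) = S at *
  field_simp
  ring

lemma shrinkRate_mul_mono {x y : ℝ} (hx : 0 < x) (hxy : x ≤ y) :
    shrinkRate x * (x + 4 * x ^ 2) ≤ shrinkRate y * (y + 4 * y ^ 2) := by
  have hy : 0 < y := hx.trans_le hxy
  rw [shrinkRate_mul_eq hx, shrinkRate_mul_eq hy]
  have hsx := Real.sqrt_pos.2 (show 0 < 1 + 4 * x by positivity)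
  have hsy := Real.sqrt_pos.2 (show 0 < 1 + 4 * y by positivity)
  have hz : 2 * x / √(1 + 4 * x) ≤ 2 * y / √(1 + 4 * y) := by
    rw [div_le_div_iff₀ hsx hsy]
    refine abs_le_of_sq_le_sq' ?_ (by positivity) |>.2
    rw [mul_pow, mul_pow (2 * y), Real.sq_sqrt (by positivity), Real.sq_sqrt (by positivity)]
    nlinarith [mul_pos hx hy, mul_nonneg (mul_pos hx hy).le (sub_nonneg.2 hxy)]
  have hax : 0 < Real.arctan (2 * x / √(1 + 4 * x)) := Real.arctan_pos.2 (by positivity)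
  have h1 := div_arctan_le_div_arctan (by positivity) hz
  have h2 : (1 + 4 * x) / (1 + 2 * x) ≤ (1 + 4 * y) / (1 + 2 * y) := by
    rw [div_le_div_iff₀ (by positivity) (by positivity)]; nlinarith
  have h0 : 0 ≤ 2 * x / √(1 + 4 * x) / Real.arctan (2 * x / √(1 + 4 * x)) := by positivity
  exact mul_le_mul (by linarith) h2 (by positivity) (by linarith)

/-- In the coordinate `x + 4x²` the radial part of a step does not increase distances. -/
lemma abs_sub_le_of_shrink {E x y : ℝ} (hE : 0 ≤ E) (hx : 0 < x) (hy : 0 < y)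
    (hEx : E * shrinkRate x ≤ 1) (hEy : E * shrinkRate y ≤ 1) {x₁ y₁ : ℝ}
    (hx₁ : x₁ = (1 - E * shrinkRate x) ^ 2 * x) (hy₁ : y₁ = (1 - E * shrinkRate y) ^ 2 * y) :
    |x₁ + 4 * x₁ ^ 2 - (y₁ + 4 * y₁ ^ 2)| ≤ |x + 4 * x ^ 2 - (y + 4 * y ^ 2)| := by
  wlog hxy : x ≤ y generalizing x y x₁ y₁
  · rw [abs_sub_comm, abs_sub_comm (x + 4 * x ^ 2)]
    exact this hy hx hEy hEx hy₁ hx₁ (le_of_not_ge hxy)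
  set a := E * shrinkRate x with ha
  set b := E * shrinkRate y with hb
  have hb0 : 0 ≤ b := mul_nonneg hE (shrinkRate_nonneg hy.le)
  have hba : b ≤ a := mul_le_mul_of_nonneg_left (shrinkRate_anti hx hxy) hE
  have hmono : a * (x + 4 * x ^ 2) ≤ b * (y + 4 * y ^ 2) := by
    have := mul_le_mul_of_nonneg_left (shrinkRate_mul_mono hx hxy) hE
    rw [ha, hb]; linarith
  have hsq : (1 - a) ^ 2 ≤ (1 - b) ^ 2 := pow_le_pow_left₀ (by linarith) (by linarith) 2
  have hmono2 : a * x ^ 2 ≤ b * y ^ 2 := by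
    have h1 : x / (1 + 4 * x) ≤ y / (1 + 4 * y) := by
      rw [div_le_div_iff₀ (by positivity) (by positivity)]; nlinarith
    have h2 : ∀ z : ℝ, 0 < z → z ^ 2 = (z + 4 * z ^ 2) * (z / (1 + 4 * z)) := fun z hz => by
      field_simp
    rw [h2 x hx, h2 y hy, ← mul_assoc, ← mul_assoc]
    exact mul_le_mul hmono h1 (by positivity) (by positivity)
  -- The larger vector loses more in this coordinate, while `hle` below shows that the order is
  -- kept; hence the gap cannot widen.
  have hloss : x + 4 * x ^ 2 - (x₁ + 4 * x₁ ^ 2) ≤ y + 4 * y ^ 2 - (y₁ + 4 * y₁ ^ 2) := by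
    have e : ∀ c z : ℝ, z + 4 * z ^ 2 - ((1 - c) ^ 2 * z + 4 * ((1 - c) ^ 2 * z) ^ 2) =
        (2 - c) * (c * (z + 4 * z ^ 2) + 4 * (c * z ^ 2 * (1 - c) ^ 2)) := fun c z => by ring
    rw [hx₁, hy₁, e, e]
    have h3 : a * x ^ 2 * (1 - a) ^ 2 ≤ b * y ^ 2 * (1 - b) ^ 2 :=
      mul_le_mul hmono2 hsq (sq_nonneg _) (by positivity)
    have ha0 : 0 ≤ a := hb0.trans hba
    have h4 : 0 ≤ a * (x + 4 * x ^ 2) + 4 * (a * x ^ 2 * (1 - a) ^ 2) := by positivity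
    exact mul_le_mul (by linarith) (by linarith) h4 (by linarith)
  have hle : x₁ ≤ y₁ := by
    rw [hx₁, hy₁]
    exact mul_le_mul hsq hxy hx.le (sq_nonneg _)
  have hx₁0 : 0 ≤ x₁ := by rw [hx₁]; positivity
  have hf : x₁ + 4 * x₁ ^ 2 ≤ y₁ + 4 * y₁ ^ 2 := by nlinarith
  rw [abs_sub_comm, abs_of_nonneg (by linarith), abs_sub_comm, abs_of_nonneg (by nlinarith)]
  linarith

/-- Used with a = √D: an error of order √D is charged to a gain of order D plus a constant. -/
lemma mul_le_mul_sq_add_sq_div {a p q : ℝ} (hp : 0 < p) : q * a ≤ p * a ^ 2 + q ^ 2 / (4 * p) := by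
  have h : p * a ^ 2 + q ^ 2 / (4 * p) - q * a = (2 * p * a - q) ^ 2 / (4 * p) := by
    field_simp; ring
  have : 0 ≤ (2 * p * a - q) ^ 2 / (4 * p) := by positivity
  linarith

/-! ### Growth of the tilt towards the target -/

section
variable {d : ℕ} {ν w : Vec d} {η D P : ℝ}

/-- The component of `w` orthogonal to `ν`. -/
def perp (ν w : Vec d) : Vec d := w - (inner ℝ w ν / ‖ν‖ ^ 2) • ν

lemma norm_sq_eq_perp (hν : 1 ≤ ‖ν‖ ^ 2) :
    ‖w‖ ^ 2 = ‖perp ν w‖ ^ 2 + inner ℝ w ν ^ 2 / ‖ν‖ ^ 2 := by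
  have h0 : ‖ν‖ ^ 2 ≠ 0 := by linarith
  rw [perp, norm_sub_sq_real, inner_smul_right, norm_smul, mul_pow, Real.norm_eq_abs, sq_abs]
  field_simp
  ring

/-- The coefficient of `ν` in `signalGrad`. -/
def signalCoef (ν w : Vec d) : ℝ :=
  2 / Real.pi / √(1 - overlap ν w ^ 2) / √(1 + 2 * ‖w‖ ^ 2)

/-- The total radial coefficient of a step. -/
def stepRate (ν : Vec d) (D P : ℝ) (w : Vec d) : ℝ :=
  D / 2 * radialCoef (‖w‖ ^ 2) +
    P * signalCoef ν w * (2 * inner ℝ w ν / (1 + 2 * ‖w‖ ^ 2))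

lemma descentStep_eq : descentStep ν η D P w =
    (1 - η * stepRate ν D P w) • w + (η * P * signalCoef ν w) • ν := by
  rw [descentStep, signalGrad, stepRate, ← signalCoef]
  module

lemma inner_descentStep : inner ℝ (descentStep ν η D P w) ν =
    (1 - η * stepRate ν D P w) * inner ℝ w ν + η * P * signalCoef ν w * ‖ν‖ ^ 2 := by
  rw [descentStep_eq, inner_add_left, inner_smul_left, inner_smul_left,
    real_inner_self_eq_norm_sq]
  simp

lemma perp_descentStep (hν : 1 ≤ ‖ν‖ ^ 2) : perp ν (descentStep ν η D P w) =
    (1 - η * stepRate ν D P w) • perp ν w := by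
  have h0 : ‖ν‖ ^ 2 ≠ 0 := by linarith
  rw [perp, inner_descentStep, perp, add_div, mul_div_cancel_right₀ _ h0, descentStep_eq,
    mul_div_assoc]
  module

/-- The factor ‖w‖²/(1+2‖w‖²) is kept because it is at most corr(w,w); this is what later yields |P|
≤ M√D. -/
lemma overlap_sq_le_of_inner_le (hν : 1 ≤ ‖ν‖ ^ 2) {t : ℝ}
    (hm : |inner ℝ w ν| ≤ t * ‖perp ν w‖) :
    overlap ν w ^ 2 ≤ t ^ 2 * (‖w‖ ^ 2 / (1 + 2 * ‖w‖ ^ 2)) := by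
  rw [overlap, div_pow, Real.sq_sqrt (by positivity), ← mul_div_assoc]
  gcongr
  rw [← sq_abs]
  have h1 : |inner ℝ w ν| ^ 2 ≤ (t * ‖perp ν w‖) ^ 2 := pow_le_pow_left₀ (abs_nonneg _) hm 2
  refine h1.trans ?_
  rw [mul_pow]
  gcongr
  have := norm_sq_eq_perp (w := w) hν
  have h2 : 0 ≤ inner ℝ w ν ^ 2 / ‖ν‖ ^ 2 := by positivity
  exact abs_le_of_sq_le_sq' (by linarith) (norm_nonneg _) |>.2

lemma abs_overlap_le_of_inner_le (hν : 1 ≤ ‖ν‖ ^ 2) {t : ℝ} (ht : 0 ≤ t)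
    (hm : |inner ℝ w ν| ≤ t * ‖perp ν w‖) : |overlap ν w| ≤ t := by
  refine abs_le_of_sq_le_sq ((overlap_sq_le_of_inner_le hν hm).trans ?_) ht
  refine mul_le_of_le_one_right (sq_nonneg t) ?_
  rw [div_le_one (by positivity)]
  linarith [sq_nonneg ‖w‖]

/-- AM-GM: the tilt growth, of order √D, is at most K times the radial decrease of V plus a
remainder. The remainder needs a lower bound on V³·A·S², with A the radial coefficient and S =
√(1+2x); it follows from A·S²·√(1+4x) ≥ 2. -/
lemma signal_drift_le {V x D M K r : ℝ} (hV : 0 < V) (hD : 0 ≤ D) (hx0 : 0 ≤ x)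
    (hxV2 : x ≤ 5 / 4 * V ^ 2) (hr : 0 < r) (hr1 : r ≤ 1)
    (hrx : r ^ 2 ≤ x) (hK : 0 < K) :
    4 * (M * √D) / (V * √(1 + 2 * x)) ≤
      K * (D * radialCoef x * V / 2) + 32 * M ^ 2 / (K * r ^ 3) := by
  set A := radialCoef x with hA
  set S := √(1 + 2 * x) with hS
  have hS0 : 0 < S := Real.sqrt_pos.2 (by positivity)
  have hSsq : S ^ 2 = 1 + 2 * x := Real.sq_sqrt (by positivity)
  set Q := √(1 + 4 * x) with hQ
  have hQ0 : 0 < Q := Real.sqrt_pos.2 (by positivity)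
  have hApos : 0 < A := lt_of_lt_of_le (by positivity) (le_radialCoef hx0)
  have hamgm := mul_le_mul_sq_add_sq_div (a := √D) (q := 4 * M / (V * S))
    (p := K * A * V / 2) (by positivity)
  rw [Real.sq_sqrt hD] at hamgm
  have hAS : 2 ≤ A * S ^ 2 * Q := by
    have := le_radialCoef hx0
    rw [div_le_iff₀ (by positivity)] at this
    rw [hSsq]; linarith
  have hQV : Q ≤ 1 + 3 * V := Real.sqrt_le_iff.2 ⟨by positivity, by nlinarith⟩
  have hrV : 4 / 5 * r ≤ V := abs_le_of_sq_le_sq' (by nlinarith) hV.le |>.2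
  have hV3 : Q * r ^ 3 ≤ 8 * V ^ 3 := by
    refine (mul_le_mul_of_nonneg_right hQV (by positivity)).trans ?_
    set v := 5 / 4 * V with hv
    have hrv : r ≤ v := by linarith
    have hr3 : r ^ 3 ≤ v ^ 3 := by gcongr
    have hr2 : r ^ 3 ≤ v ^ 2 := by
      calc r ^ 3 = r ^ 2 * r := by ring
        _ ≤ v ^ 2 * 1 := by gcongr
        _ = v ^ 2 := mul_one _
    have h1 : V * r ^ 3 ≤ V * v ^ 2 := by gcongr
    have e1 : v ^ 3 = 125 / 64 * V ^ 3 := by rw [hv]; ring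
    have e2 : V * v ^ 2 = 25 / 16 * V ^ 3 := by rw [hv]; ring
    have : 0 < V ^ 3 := by positivity
    linarith
  have hq : (4 * M / (V * S)) ^ 2 / (4 * (K * A * V / 2)) ≤ 32 * M ^ 2 / (K * r ^ 3) := by
    have e3 : (4 * M / (V * S)) ^ 2 / (4 * (K * A * V / 2)) =
        8 * M ^ 2 / (K * (V ^ 3 * (A * S ^ 2))) := by
      field_simp; ring
    rw [e3, div_le_div_iff₀ (by positivity) (by positivity)]
    have h9 : r ^ 3 ≤ 4 * (V ^ 3 * (A * S ^ 2)) := by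
      have h10 : Q * r ^ 3 * (A * S ^ 2) ≤ 8 * V ^ 3 * (A * S ^ 2) := by gcongr
      have h11 : 2 * r ^ 3 ≤ A * S ^ 2 * Q * r ^ 3 := by gcongr
      linarith
    have h12 : 0 ≤ 8 * M ^ 2 * K := by positivity
    linarith [mul_le_mul_of_nonneg_left h9 h12]
  calc 4 * (M * √D) / (V * S) = 4 * M / (V * S) * √D := by ring
    _ ≤ K * A * V / 2 * D + (4 * M / (V * S)) ^ 2 / (4 * (K * A * V / 2)) := hamgm
    _ ≤ _ := by linarith

/-- The angle to `ν` grows slowly while the norm of the weight vector is not too small. -/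
lemma tilt_descentStep_le (hν : 1 ≤ ‖ν‖ ^ 2) (hν2 : ‖ν‖ ^ 2 ≤ 2) (hη : 0 ≤ η) (hη1 : η ≤ 1)
    (hD : 0 ≤ D) (hD1 : D ≤ 1) (hDA : D * radialCoef (‖w‖ ^ 2) ≤ 8 / 9) {t M K K' r : ℝ}
    (hV : 0 < ‖perp ν w‖) (ht1 : t ≤ 1 / 2)
    (hm : |inner ℝ w ν| ≤ t * ‖perp ν w‖) (hP1 : |P| ≤ 1 / 40) (hM : 0 ≤ M) (hPM : |P| ≤ M * √D)
    (hr : 0 < r) (hr1 : r ≤ 1) (hrw : r ≤ ‖w‖) (hK : 0 < K)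
    (hK' : 32 * M ^ 2 / (K * r ^ 3) + K * M * t ≤ K') :
    0 < ‖perp ν (descentStep ν η D P w)‖ ∧
      |inner ℝ (descentStep ν η D P w) ν| / ‖perp ν (descentStep ν η D P w)‖ +
        K * ‖perp ν (descentStep ν η D P w)‖ ≤
      |inner ℝ w ν| / ‖perp ν w‖ + K * ‖perp ν w‖ + K' := by
  set V := ‖perp ν w‖ with hVdef
  set m := inner ℝ w ν with hmdef
  set x := ‖w‖ ^ 2 with hx
  set A := radialCoef x with hA
  set B := signalCoef ν w with hB
  set lam := stepRate ν D P w with hlam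
  set S := √(1 + 2 * x) with hS
  have hx0 : 0 ≤ x := sq_nonneg _
  have hS0 : 0 < S := Real.sqrt_pos.2 (by positivity)
  have hSsq : S ^ 2 = 1 + 2 * x := Real.sq_sqrt (by positivity)
  have hS1 : 1 ≤ S := Real.one_le_sqrt.2 (by linarith)
  have ht0 : 0 ≤ t := by
    by_contra h
    have := abs_nonneg m
    nlinarith
  have hs : |overlap ν w| ≤ 1 / 2 := (abs_overlap_le_of_inner_le hν ht0 hm).trans ht1
  have hB0 : 0 ≤ B := by rw [hB, signalCoef]; positivity
  have hBS : B ≤ 1 / S := by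
    rw [hB, signalCoef]
    gcongr
    linarith [inv_sqrt_one_sub_le hs]
  have hB1 : B ≤ 1 := hBS.trans ((div_le_one hS0).2 hS1)
  have hxV : x = V ^ 2 + m ^ 2 / ‖ν‖ ^ 2 := norm_sq_eq_perp hν
  have hm2 : m ^ 2 ≤ (t * V) ^ 2 := by
    rw [← sq_abs]; exact pow_le_pow_left₀ (abs_nonneg _) hm 2
  have hxV1 : V ^ 2 ≤ x := by
    have : 0 ≤ m ^ 2 / ‖ν‖ ^ 2 := by positivity
    linarith
  have hxV2 : x ≤ 5 / 4 * V ^ 2 := by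
    have h1 : m ^ 2 / ‖ν‖ ^ 2 ≤ m ^ 2 := div_le_self (sq_nonneg _) hν
    have h2 : (t * V) ^ 2 ≤ 1 / 4 * V ^ 2 := by 
      rw [mul_pow]; gcongr
      calc t ^ 2 ≤ (1 / 2) ^ 2 := by gcongr
        _ = 1 / 4 := by norm_num
    linarith
  have hA0 : 0 ≤ A := radialCoef_nonneg hx0
  -- the error term in the radial coefficient
  set e := B * (2 * m / (1 + 2 * x)) with he
  have heV : |e| * V ≤ t := by
    rw [he, abs_mul, abs_of_nonneg hB0, abs_div, abs_mul, abs_two, abs_of_pos (by positivity :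
      (0 : ℝ) < 1 + 2 * x)]
    have h1 : 2 * |m| * V ≤ t * (1 + 2 * x) := by
      have e1 : |m| * V ≤ t * V * V := by gcongr
      have e2 : t * V ^ 2 ≤ t * x := by gcongr
      linarith
    calc B * (2 * |m| / (1 + 2 * x)) * V = B * (2 * |m| * V / (1 + 2 * x)) := by ring
      _ ≤ 1 * t := by
        gcongr
        rwa [div_le_iff₀ (by positivity)]
      _ = t := one_mul t
  have he1 : |e| ≤ 1 := by
    rw [he, abs_mul, abs_of_nonneg hB0, abs_div, abs_mul, abs_two, abs_of_pos (by positivity :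
      (0 : ℝ) < 1 + 2 * x)]
    have h1 : 2 * |m| / (1 + 2 * x) ≤ 1 := by
      have e1 : |m| ≤ 1 / 2 * V := hm.trans (by gcongr)
      have e2 := sq_nonneg (V - 1)
      rw [div_le_one (by positivity)]; linarith
    calc B * (2 * |m| / (1 + 2 * x)) ≤ 1 * 1 := by gcongr
      _ = 1 := one_mul 1
  have hlam_eq : lam = D / 2 * A + P * e := by rw [hlam, stepRate, he]; ring
  have hPe : |P * e| ≤ |P| := by
    rw [abs_mul]; exact mul_le_of_le_one_right (abs_nonneg _) he1
  have hlam_le : lam ≤ 1 / 2 := by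
    rw [hlam_eq]
    have := le_abs_self (P * e)
    linarith
  set h := 1 - η * lam with hh
  have hh2 : 1 / 2 ≤ h := by
    rw [hh]
    have h0 : η * lam ≤ η * (1 / 2) := by gcongr
    linarith
  have hV' : ‖perp ν (descentStep ν η D P w)‖ = h * V := by
    rw [perp_descentStep hν, norm_smul, Real.norm_eq_abs, abs_of_nonneg (by linarith)]
  have hm' : |inner ℝ (descentStep ν η D P w) ν| ≤ h * |m| + η * |P| * B * 2 := by
    rw [inner_descentStep]
    refine (abs_add_le _ _).trans (add_le_add ?_ ?_)
    · rw [abs_mul, abs_of_nonneg (by linarith)]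
    · rw [abs_mul, abs_mul, abs_mul, abs_of_nonneg hη, abs_of_nonneg hB0,
        abs_of_nonneg (sq_nonneg ‖ν‖)]
      gcongr
  have hhV : 0 < h * V := by positivity
  rw [hV']
  refine ⟨hhV, ?_⟩
  -- The common factor h cancels in the ratio, so only the push along ν changes the tilt.
  have h1 : |inner ℝ (descentStep ν η D P w) ν| / (h * V) ≤ |m| / V + η * (4 * |P| / (V * S)) := by
    calc _ ≤ (h * |m| + η * |P| * B * 2) / (h * V) := by gcongr
      _ = |m| / V + η * |P| * B * 2 / (h * V) := by
        rw [add_div, mul_div_mul_left _ _ (by linarith : h ≠ 0)]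
      _ ≤ |m| / V + η * |P| * (1 / S) * 2 / (1 / 2 * V) := by gcongr
      _ = _ := by field_simp; ring
  have h2 : K * (h * V) ≤ K * V - η * (K * (D * A * V / 2)) + η * (K * M * t) := by
    have h3 : -(lam * V) ≤ -(D * A * V / 2) + |P| * t := by
      have h4 : -(P * e) * V ≤ |P| * t := by
        calc -(P * e) * V ≤ |P * e| * V := by gcongr; exact neg_le_abs _
          _ = |P| * (|e| * V) := by rw [abs_mul]; ring
          _ ≤ |P| * t := by gcongr
      rw [hlam_eq]; linarith
    have h5 : |P| ≤ M := hPM.trans (mul_le_of_le_one_right hM (Real.sqrt_le_one.2 hD1))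
    have h6 : |P| * t ≤ M * t := by gcongr
    have h7 : 0 ≤ K * η := by positivity
    have := mul_le_mul_of_nonneg_left (h3.trans (add_le_add le_rfl h6)) h7
    rw [hh]
    linarith
  have h3 : 4 * |P| / (V * S) ≤ K * (D * A * V / 2) + 32 * M ^ 2 / (K * r ^ 3) := by
    refine le_trans ?_ (signal_drift_le hV hD hx0 hxV2 hr hr1 ?_ hK)
    · gcongr
    · rw [hx]; gcongr
  have h4 : η * (4 * |P| / (V * S)) + η * (K * M * t) ≤ η * (K * (D * A * V / 2)) + K' := by
    have h5 : 0 ≤ 32 * M ^ 2 / (K * r ^ 3) + K * M * t := by positivity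
    have h6 := mul_le_mul_of_nonneg_left h3 hη
    have h7 : η * (32 * M ^ 2 / (K * r ^ 3) + K * M * t) ≤
        32 * M ^ 2 / (K * r ^ 3) + K * M * t := mul_le_of_le_one_left h5 hη1
    linarith
  linarith

end

/-! ### Perturbation of the norms by the signal -/

section
variable {d : ℕ} {ν w : Vec d} {η D P : ℝ}

lemma abs_norm_sq_descentStep_sub_le (hν : ‖ν‖ ^ 2 ≤ 2) (hη : 0 ≤ η) (hη1 : η ≤ 1) (hD : 0 ≤ D)
    (hDA : D * radialCoef (‖w‖ ^ 2) ≤ 2) {σ : ℝ} (hs : |overlap ν w| ≤ σ) (hσ : σ ≤ 1 / 2) :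
    |‖descentStep ν η D P w‖ ^ 2 - (1 - η * D / 2 * radialCoef (‖w‖ ^ 2)) ^ 2 * ‖w‖ ^ 2| ≤
      η * (|P| * (2 * σ + 4 * |P|)) / (1 + 2 * ‖w‖ ^ 2) := by
  set x := ‖w‖ ^ 2 with hx
  have hx0 : 0 ≤ x := sq_nonneg _
  set θ := η * D / 2 * radialCoef x with hθ
  have hA0 := radialCoef_nonneg hx0
  have hθ0 : 0 ≤ θ := by positivity
  have hθ1 : θ ≤ 1 := by
    have : θ = η * (D * radialCoef x / 2) := by rw [hθ]; ring
    rw [this]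
    exact mul_le_one₀ hη1 (by positivity) (by linarith)
  have hg := norm_signalGrad_le hν (hs.trans hσ)
  have hin := abs_inner_signalGrad_le (hs.trans hσ)
  have e : ‖descentStep ν η D P w‖ ^ 2 - (1 - θ) ^ 2 * x =
      2 * (1 - θ) * (η * P) * inner ℝ w (signalGrad ν w) +
        (η * P) ^ 2 * ‖signalGrad ν w‖ ^ 2 := by
    rw [descentStep_eq_add, norm_add_sq_real, norm_smul, norm_smul, inner_smul_left,
      inner_smul_right, mul_pow, mul_pow, Real.norm_eq_abs, Real.norm_eq_abs, sq_abs, sq_abs]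
    simp only [conj_trivial, ← hx, ← hθ]
    ring
  have hg2 : ‖signalGrad ν w‖ ^ 2 ≤ 4 / (1 + 2 * x) := by
    calc _ ≤ (2 / √(1 + 2 * x)) ^ 2 := by gcongr
      _ = _ := by rw [div_pow, Real.sq_sqrt (by positivity)]; norm_num
  rw [e]
  refine (abs_add_le _ _).trans ?_
  rw [abs_mul, abs_mul, abs_mul, abs_mul, abs_two, abs_of_nonneg (by linarith : 0 ≤ 1 - θ),
    abs_of_nonneg hη, abs_of_nonneg (by positivity : 0 ≤ (η * P) ^ 2 * ‖signalGrad ν w‖ ^ 2)]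
  have h1 : 2 * (1 - θ) * (η * |P|) * |inner ℝ w (signalGrad ν w)| ≤
      2 * 1 * (η * |P|) * (σ / (1 + 2 * x)) := by
    gcongr
    · linarith
    · exact hin.trans (by gcongr)
  have h2 : (η * P) ^ 2 * ‖signalGrad ν w‖ ^ 2 ≤ η * |P| ^ 2 * (4 / (1 + 2 * x)) := by
    have : (η * P) ^ 2 ≤ η * |P| ^ 2 := by
      rw [mul_pow, sq_abs]
      gcongr
      nlinarith
    gcongr
  calc _ ≤ 2 * 1 * (η * |P|) * (σ / (1 + 2 * x)) + η * |P| ^ 2 * (4 / (1 + 2 * x)) :=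
        add_le_add h1 h2
    _ = _ := by ring

lemma one_div_radialCoef_mul_le {y r X : ℝ} (hr : 0 < r) (hr1 : r ≤ 1) (hry : r ≤ y)
    (hyX : y ≤ X) : 1 / (radialCoef (y ^ 2) * y ^ 2) ≤ 3 / r ^ 2 + 2 * X := by
  have hy : 0 < y := hr.trans_le hry
  have hS : √(1 + 4 * y ^ 2) ≤ 1 + 2 * y := Real.sqrt_le_iff.2 ⟨by positivity, by nlinarith⟩
  have hS0 := Real.sqrt_pos.2 (show 0 < 1 + 4 * y ^ 2 by positivity)
  have hA2 := le_radialCoef (sq_nonneg y)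
  have hc : 0 < 2 / ((1 + 2 * y ^ 2) * √(1 + 4 * y ^ 2)) * y ^ 2 := by positivity
  have h1 : 1 / (radialCoef (y ^ 2) * y ^ 2) ≤
      1 / (2 / ((1 + 2 * y ^ 2) * √(1 + 4 * y ^ 2)) * y ^ 2) := by gcongr
  have h2 : 1 / (2 / ((1 + 2 * y ^ 2) * √(1 + 4 * y ^ 2)) * y ^ 2) =
      (1 + 2 * y ^ 2) * √(1 + 4 * y ^ 2) / (2 * y ^ 2) := by field_simp
  have h3 : (1 + 2 * y ^ 2) * √(1 + 4 * y ^ 2) / (2 * y ^ 2) ≤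
      (1 + 2 * y ^ 2) * (1 + 2 * y) / (2 * y ^ 2) := by gcongr
  have h4 : (1 + 2 * y ^ 2) * (1 + 2 * y) / (2 * y ^ 2) =
      1 / 2 * (1 / y ^ 2) + 1 / y + 1 + 2 * y := by field_simp; ring
  have h5 : 1 / y ^ 2 ≤ 1 / r ^ 2 := by gcongr
  have h6 : 1 / y ≤ 1 / r := by gcongr
  have h7 : 1 / r ≤ 1 / r ^ 2 := by gcongr; nlinarith
  have h8 : 1 ≤ 1 / r ^ 2 := by rw [le_div_iff₀ (by positivity)]; nlinarith
  have h9 : 3 / r ^ 2 = 3 * (1 / r ^ 2) := by ring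
  rw [h9]
  linarith

/-- AM-GM again, with 450 = (5·6)²/2. The five copies of ε cover four for the coordinate x + 4x² and
one for the norm itself. -/
lemma five_mul_le_drift {ε σ M D K K' y r X : ℝ} (hr : 0 < r) (hr1 : r ≤ 1) (hry : r ≤ y)
    (hyX : y ≤ X) (hK : 0 < K) (hD : 0 ≤ D) (hε : ε ≤ 6 * σ * M * √D)
    (hK' : 450 * σ ^ 2 * M ^ 2 / K * (3 / r ^ 2 + 2 * X) ≤ K') :
    5 * ε ≤ K * (D * radialCoef (y ^ 2) / 2 * y ^ 2) + K' := by
  have hy : 0 < y := hr.trans_le hry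
  have hS0 := Real.sqrt_pos.2 (show 0 < 1 + 4 * y ^ 2 by positivity)
  have hA : 0 < radialCoef (y ^ 2) :=
    lt_of_lt_of_le (by positivity) (le_radialCoef (sq_nonneg y))
  have h1 := one_div_radialCoef_mul_le hr hr1 hry hyX
  have hamgm := mul_le_mul_sq_add_sq_div (a := √D) (q := 30 * σ * M)
    (p := K * radialCoef (y ^ 2) * y ^ 2 / 2) (by positivity)
  rw [Real.sq_sqrt hD] at hamgm
  have e : (30 * σ * M) ^ 2 / (4 * (K * radialCoef (y ^ 2) * y ^ 2 / 2)) =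
      450 * σ ^ 2 * M ^ 2 / K * (1 / (radialCoef (y ^ 2) * y ^ 2)) := by
    field_simp
    ring
  rw [e] at hamgm
  have h2 := mul_le_mul_of_nonneg_left h1 (show 0 ≤ 450 * σ ^ 2 * M ^ 2 / K by positivity)
  linarith

/-- The error of a step in the coordinate `x + 4x²`, and the decrease of `x`. -/
lemma norm_sq_descentStep_bounds (hν : ‖ν‖ ^ 2 ≤ 2) (hη : 0 ≤ η) (hη1 : η ≤ 1) (hD : 0 ≤ D)
    (hD1 : D ≤ 1) (hDA : D * radialCoef (‖w‖ ^ 2) ≤ 8 / 9) {σ M K K' r X : ℝ}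
    (hs : |overlap ν w| ≤ σ) (hσ : σ ≤ 1 / 40) (hM : 0 ≤ M) (hMσ : M ≤ σ) (hPM : |P| ≤ M * √D)
    (hr : 0 < r) (hr1 : r ≤ 1) (hrw : r ≤ ‖w‖) (hwX : ‖w‖ ≤ X) (hK : 0 < K) (hK1 : K ≤ 1)
    (hK' : 450 * σ ^ 2 * M ^ 2 / K * (3 / r ^ 2 + 2 * X) ≤ K') {x₁ : ℝ}
    (hx₁ : x₁ = (1 - η * D / 2 * radialCoef (‖w‖ ^ 2)) ^ 2 * ‖w‖ ^ 2) :
    |‖descentStep ν η D P w‖ ^ 2 + 4 * (‖descentStep ν η D P w‖ ^ 2) ^ 2 -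
        (x₁ + 4 * x₁ ^ 2)| + K * ‖descentStep ν η D P w‖ ^ 2 ≤ K * ‖w‖ ^ 2 + K' := by
  have hσ0 : 0 ≤ σ := (abs_nonneg _).trans hs
  have hξ := abs_norm_sq_descentStep_sub_le (P := P) hν hη hη1 hD (hDA.trans (by norm_num)) hs
    (by linarith)
  rw [← hx₁] at hξ
  set x' := ‖descentStep ν η D P w‖ ^ 2 with hx'
  set x := ‖w‖ ^ 2 with hx
  have hx0 : 0 ≤ x := sq_nonneg _
  have hx'0 : 0 ≤ x' := sq_nonneg _
  set A := radialCoef x with hA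
  have hA0 : 0 ≤ A := radialCoef_nonneg hx0
  have hPM1 : |P| ≤ M := hPM.trans (mul_le_of_le_one_right hM (Real.sqrt_le_one.2 hD1))
  set ε := |P| * (2 * σ + 4 * |P|) with hε
  have hε0 : 0 ≤ ε := by positivity
  have hε1 : ε ≤ 6 * σ * M * √D := by
    calc ε ≤ M * √D * (2 * σ + 4 * σ) := by rw [hε]; gcongr; linarith
      _ = _ := by ring
  have hε2 : ε ≤ 1 / 8 := by
    calc ε ≤ 1 / 40 * (2 * (1 / 40) + 4 * (1 / 40)) := by rw [hε]; gcongr <;> linarith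
      _ ≤ _ := by norm_num
  set θ := η * D / 2 * A with hθ
  have hθ0 : 0 ≤ θ := by positivity
  have hθe : θ = η * (D * A / 2) := by rw [hθ]; ring
  have hθ1 : θ ≤ 1 := by
    rw [hθe]; exact mul_le_one₀ hη1 (by positivity) (by linarith)
  have hx₁0 : 0 ≤ x₁ := by rw [hx₁]; positivity
  have hx₁θ : x₁ ≤ x - θ * x := by
    rw [hx₁]
    have h1 : (1 - θ) ^ 2 ≤ 1 - θ := by
      rw [sq]; exact mul_le_of_le_one_left (by linarith) (by linarith)
    linarith [mul_le_mul_of_nonneg_right h1 hx0]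
  have hx₁x : x₁ ≤ x := by linarith [mul_nonneg hθ0 hx0]
  have hηε : 0 ≤ η * ε := by positivity
  have hηε2 : η * ε ≤ 1 / 8 := (mul_le_of_le_one_left hε0 hη1).trans hε2
  have hξ1 : |x' - x₁| ≤ η * ε := hξ.trans (div_le_self hηε (by linarith))
  have hx'x : x' ≤ x₁ + η * ε := by linarith [le_abs_self (x' - x₁)]
  -- The slope 1+4(x'+x₁) of the coordinate is absorbed by the factor 1/(1+2x) in the perturbation
  -- of x.
  have hf : |x' + 4 * x' ^ 2 - (x₁ + 4 * x₁ ^ 2)| ≤ 4 * (η * ε) := by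
    have e : x' + 4 * x' ^ 2 - (x₁ + 4 * x₁ ^ 2) = (x' - x₁) * (1 + 4 * (x' + x₁)) := by ring
    rw [e, abs_mul, abs_of_nonneg (by positivity : 0 ≤ 1 + 4 * (x' + x₁))]
    calc |x' - x₁| * (1 + 4 * (x' + x₁)) ≤ η * ε / (1 + 2 * x) * (4 * (1 + 2 * x)) := by
          gcongr; linarith
      _ = 4 * (η * ε) := by field_simp
  have hdrift : 5 * ε ≤ K * (D * A / 2 * x) + K' :=
    five_mul_le_drift hr hr1 hrw hwX hK hD hε1 hK'
  have hfin : 4 * (η * ε) + K * x' ≤ K * x + K' := by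
    have h1 : K * x' ≤ K * x - K * (θ * x) + η * ε := by
      have h2 : K * x' ≤ K * (x - θ * x + η * ε) := by gcongr; linarith
      have h3 : K * (η * ε) ≤ η * ε := mul_le_of_le_one_left hηε hK1
      linarith
    have hK'0 : 0 ≤ K' := by
      have hX0 : 0 ≤ X := (norm_nonneg w).trans hwX
      exact le_trans (by positivity) hK'
    have h4 : η * (5 * ε) ≤ η * (K * (D * A / 2 * x)) + K' := by
      have := mul_le_mul_of_nonneg_left hdrift hη
      have h5 : η * K' ≤ K' := mul_le_of_le_one_left hK'0 hη1
      linarith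
    rw [hθe] at h1
    linarith
  linarith

end

/-- The norms of two weight vectors stay close to each other. -/
lemma abs_sub_descentStep_le {d : ℕ} {ν w v : Vec d} {η C D D' P P' : ℝ} (hν : ‖ν‖ ^ 2 ≤ 2)
    (hη : 0 ≤ η) (hη1 : η ≤ 1) (hC : 0 ≤ C)
    (hDC : D * selfCorr (‖w‖ ^ 2) = C) (hDC' : D' * selfCorr (‖v‖ ^ 2) = C)
    (hD1 : D ≤ 1) (hD1' : D' ≤ 1)
    (hDA : D * radialCoef (‖w‖ ^ 2) ≤ 8 / 9) (hDA' : D' * radialCoef (‖v‖ ^ 2) ≤ 8 / 9)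
    {σ M K K' r X : ℝ} (hs : |overlap ν w| ≤ σ) (hs' : |overlap ν v| ≤ σ) (hσ : σ ≤ 1 / 40)
    (hM : 0 ≤ M) (hMσ : M ≤ σ) (hPM : |P| ≤ M * √D) (hPM' : |P'| ≤ M * √D')
    (hr : 0 < r) (hr1 : r ≤ 1) (hrw : r ≤ ‖w‖) (hrv : r ≤ ‖v‖) (hwX : ‖w‖ ≤ X) (hvX : ‖v‖ ≤ X)
    (hK : 0 < K) (hK1 : K ≤ 1)
    (hK' : 450 * σ ^ 2 * M ^ 2 / K * (3 / r ^ 2 + 2 * X) ≤ K') :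
    |‖descentStep ν η D P w‖ ^ 2 + 4 * (‖descentStep ν η D P w‖ ^ 2) ^ 2 -
        (‖descentStep ν η D' P' v‖ ^ 2 + 4 * (‖descentStep ν η D' P' v‖ ^ 2) ^ 2)| +
      K * (‖descentStep ν η D P w‖ ^ 2 + ‖descentStep ν η D' P' v‖ ^ 2) ≤
    |‖w‖ ^ 2 + 4 * (‖w‖ ^ 2) ^ 2 - (‖v‖ ^ 2 + 4 * (‖v‖ ^ 2) ^ 2)| +
      K * (‖w‖ ^ 2 + ‖v‖ ^ 2) + 2 * K' := by
  have key : ∀ {z : Vec d} {δ : ℝ}, r ≤ ‖z‖ → δ * selfCorr (‖z‖ ^ 2) = C →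
      δ * radialCoef (‖z‖ ^ 2) ≤ 8 / 9 → 0 ≤ δ ∧ 0 < ‖z‖ ^ 2 ∧
        η * δ / 2 * radialCoef (‖z‖ ^ 2) = η * C / 2 * shrinkRate (‖z‖ ^ 2) ∧
        η * C / 2 * shrinkRate (‖z‖ ^ 2) ≤ 1 := by
    intro z δ hrz hδC hδA
    have hz : 0 < ‖z‖ ^ 2 := by
      have := hr.trans_le hrz; positivity
    have hsz := selfCorr_pos hz
    have hδ0 : 0 ≤ δ := by
      by_contra h
      have := mul_neg_of_neg_of_pos (not_le.1 h) hsz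
      linarith
    have e : η * δ / 2 * radialCoef (‖z‖ ^ 2) = η * C / 2 * shrinkRate (‖z‖ ^ 2) := by
      rw [shrinkRate, ← hδC]; field_simp
    refine ⟨hδ0, hz, e, ?_⟩
    rw [← e]
    have hA0 := radialCoef_nonneg hz.le
    have : η * (δ * radialCoef (‖z‖ ^ 2)) ≤ 1 * (8 / 9) := by gcongr
    linarith
  obtain ⟨hD, hw0, ew, hEw⟩ := key hrw hDC hDA
  obtain ⟨hD', hv0, ev, hEv⟩ := key hrv hDC' hDA'
  have h1 := norm_sq_descentStep_bounds hν hη hη1 hD hD1 hDA hs hσ hM hMσ hPM hr hr1 hrw hwX hK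
    hK1 hK' rfl
  have h2 := norm_sq_descentStep_bounds hν hη hη1 hD' hD1' hDA' hs' hσ hM hMσ hPM' hr hr1 hrv hvX
    hK hK1 hK' rfl
  rw [ew] at h1
  rw [ev] at h2
  have h3 := abs_sub_le_of_shrink (E := η * C / 2) (by positivity) hw0 hv0 hEw hEv rfl rfl
  rw [abs_sub_comm] at h2
  have h4 := abs_sub_le (‖descentStep ν η D P w‖ ^ 2 + 4 * (‖descentStep ν η D P w‖ ^ 2) ^ 2)
    ((1 - η * C / 2 * shrinkRate (‖w‖ ^ 2)) ^ 2 * ‖w‖ ^ 2 +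
      4 * ((1 - η * C / 2 * shrinkRate (‖w‖ ^ 2)) ^ 2 * ‖w‖ ^ 2) ^ 2)
    (‖descentStep ν η D' P' v‖ ^ 2 + 4 * (‖descentStep ν η D' P' v‖ ^ 2) ^ 2)
  have h5 := abs_sub_le ((1 - η * C / 2 * shrinkRate (‖w‖ ^ 2)) ^ 2 * ‖w‖ ^ 2 +
      4 * ((1 - η * C / 2 * shrinkRate (‖w‖ ^ 2)) ^ 2 * ‖w‖ ^ 2) ^ 2)
    ((1 - η * C / 2 * shrinkRate (‖v‖ ^ 2)) ^ 2 * ‖v‖ ^ 2 +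
      4 * ((1 - η * C / 2 * shrinkRate (‖v‖ ^ 2)) ^ 2 * ‖v‖ ^ 2) ^ 2)
    (‖descentStep ν η D' P' v‖ ^ 2 + 4 * (‖descentStep ν η D' P' v‖ ^ 2) ^ 2)
  linarith

/-! ### Coupling between the weight vectors -/

/-- The product of the self-correlations of all weight vectors but one. -/
def restSelfCorr {k d : ℕ} (w : Weights k d) (l : Fin k) : ℝ :=
  ∏ j ∈ Finset.univ.erase l, corr (w j) (w j)

/-- The product of the correlations with the target of all weight vectors but one. -/
def restCorr {k d : ℕ} (u : Vec d) (w : Weights k d) (l : Fin k) : ℝ :=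
  ∏ j ∈ Finset.univ.erase l, corr (w j) u

section
variable {k d : ℕ} {u : Vec d} {w : Weights k d} {l : Fin k}

lemma corr_self_nonneg (v : Vec d) : 0 ≤ corr v v := by
  rw [corr_self]; exact selfCorr_nonneg (sq_nonneg _)

lemma corr_self_le_one (v : Vec d) : corr v v ≤ 1 := by
  rw [corr_self]; exact selfCorr_le_one (sq_nonneg _)

lemma restSelfCorr_nonneg : 0 ≤ restSelfCorr w l :=
  Finset.prod_nonneg fun _ _ => corr_self_nonneg _

lemma restSelfCorr_le_one : restSelfCorr w l ≤ 1 :=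
  Finset.prod_le_one (fun _ _ => corr_self_nonneg _) fun _ _ => corr_self_le_one _

lemma restSelfCorr_mul : restSelfCorr w l * selfCorr (‖w l‖ ^ 2) = ∏ j, corr (w j) (w j) := by
  rw [← corr_self, mul_comm]
  exact Finset.mul_prod_erase _ (fun j => corr (w j) (w j)) (Finset.mem_univ l)

lemma restSelfCorr_le {j : Fin k} (hj : j ≠ l) : restSelfCorr w l ≤ selfCorr (‖w j‖ ^ 2) := by
  rw [restSelfCorr, ← Finset.mul_prod_erase _ (fun j => corr (w j) (w j))
    (Finset.mem_erase.2 ⟨hj, Finset.mem_univ j⟩), ← corr_self]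
  exact mul_le_of_le_one_right (corr_self_nonneg _)
    (Finset.prod_le_one (fun _ _ => corr_self_nonneg _) fun _ _ => corr_self_le_one _)

/-- One other vector of comparable norm suffices: its self-correlation is small exactly where the
radial coefficient is large. This excludes overshooting. -/
lemma restSelfCorr_mul_radialCoef_le {j : Fin k} (hj : j ≠ l)
    (hx : ‖w j‖ ^ 2 ≤ 3 / 2 * ‖w l‖ ^ 2) :
    restSelfCorr w l * radialCoef (‖w l‖ ^ 2) ≤ 8 / 9 := by
  set x := ‖w l‖ ^ 2 with hxd
  have hx0 : 0 ≤ x := sq_nonneg _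
  have h1 : restSelfCorr w l ≤ 3 * x / (1 + 3 * x) :=
    calc _ ≤ selfCorr (‖w j‖ ^ 2) := restSelfCorr_le hj
      _ ≤ selfCorr (3 / 2 * x) := selfCorr_mono (sq_nonneg _) hx
      _ ≤ _ := (selfCorr_le (by positivity)).trans_eq (by ring)
  calc _ ≤ 3 * x / (1 + 3 * x) * (8 / 3 / (1 + 2 * x)) :=
        mul_le_mul h1 (radialCoef_le hx0) (radialCoef_nonneg hx0) (by positivity)
    _ ≤ 8 / 9 := by
        rw [div_mul_div_comm, div_le_div_iff₀ (by positivity) (by norm_num)]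
        nlinarith [sq_nonneg (x - 1 / 2), sq_nonneg (3 * x - 1)]

lemma abs_corr_le_one : |corr (w l) u| ≤ 1 := by
  refine abs_corr_le.trans ?_
  rw [← sq_le_one_iff_abs_le_one]
  exact (overlap_sq_lt_one _ (norm_sq_signal_lt u).le).le

lemma abs_prod_corr_le (l : Fin k) : |∏ j, corr (w j) u| ≤ |overlap (signal u) (w l)| := by
  rw [← Finset.mul_prod_erase _ (fun j => corr (w j) u) (Finset.mem_univ l), abs_mul]
  refine (mul_le_of_le_one_right (abs_nonneg _) ?_).trans abs_corr_le
  rw [Finset.abs_prod]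
  exact Finset.prod_le_one (fun _ _ => abs_nonneg _) fun _ _ => abs_corr_le_one

variable [NeZero k]

lemma restCorr_eq (hl : l ≠ 0) : restCorr u w l =
    corr (w 0) u * ∏ j ∈ (Finset.univ.erase l).erase 0, corr (w j) u :=
  (Finset.mul_prod_erase _ (fun j => corr (w j) u)
    (Finset.mem_erase.2 ⟨hl.symm, Finset.mem_univ _⟩)).symm

lemma card_erase_erase (hl : l ≠ 0) : ((Finset.univ.erase l).erase 0).card = k - 2 := by
  rw [Finset.card_erase_of_mem (Finset.mem_erase.2 ⟨hl.symm, Finset.mem_univ _⟩),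
    Finset.card_erase_of_mem (Finset.mem_univ _), Finset.card_univ, Fintype.card_fin]
  omega

/-- The factor of the uncontrolled first vector is bounded by 1, which leaves k - 2 small factors.
-/
lemma abs_restCorr_le_pow (hl : l ≠ 0) {σ : ℝ}
    (h : ∀ j : Fin k, j ≠ 0 → |overlap (signal u) (w j)| ≤ σ) :
    |restCorr u w l| ≤ σ ^ (k - 2) := by
  rw [restCorr_eq hl, abs_mul, Finset.abs_prod, ← card_erase_erase hl]
  refine (mul_le_of_le_one_left (Finset.prod_nonneg fun _ _ => abs_nonneg _)
    abs_corr_le_one).trans ?_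
  rw [← Finset.prod_const]
  exact Finset.prod_le_prod (fun _ _ => abs_nonneg _) fun j hj =>
    abs_corr_le.trans (h j (Finset.ne_of_mem_erase hj))

lemma div_le_selfCorr {x : ℝ} (hx : 0 ≤ x) : x / (1 + 2 * x) ≤ selfCorr x := by
  have := le_two_mul_selfCorr hx
  rw [mul_div_assoc] at this
  linarith

/-- Each factor is at most τ√corr(w_j,w_j), and 2√corr(w_0,w_0) for the first vector, so P inherits
the square root of D. -/
lemma abs_restCorr_le_sqrt (hl : l ≠ 0) {τ : ℝ} (hτ : 0 ≤ τ)
    (h : ∀ j : Fin k, j ≠ 0 → overlap (signal u) (w j) ^ 2 ≤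
      τ ^ 2 * (‖w j‖ ^ 2 / (1 + 2 * ‖w j‖ ^ 2))) :
    |restCorr u w l| ≤ 2 * τ ^ (k - 2) * √(restSelfCorr w l) := by
  have h0 : |corr (w 0) u| ≤ 2 * √(corr (w 0) (w 0)) := by
    refine abs_corr_le.trans (Real.abs_le_sqrt ?_ |>.trans_eq
      (show √(2 ^ 2 * corr (w 0) (w 0)) = _ by
        rw [Real.sqrt_mul (by norm_num), Real.sqrt_sq (by norm_num)]))
    rw [corr_self]
    have h1 := div_le_selfCorr (sq_nonneg ‖w 0‖)
    have h2 := overlap_sq_le (w := w 0) (signal u)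
    rw [mul_div_assoc] at h2
    have h3 : ‖signal u‖ ^ 2 * (‖w 0‖ ^ 2 / (1 + 2 * ‖w 0‖ ^ 2)) ≤
        2 * (‖w 0‖ ^ 2 / (1 + 2 * ‖w 0‖ ^ 2)) := by
      gcongr; exact (norm_sq_signal_lt u).le
    have := selfCorr_nonneg (sq_nonneg ‖w 0‖)
    linarith
  have hj : ∀ j ∈ (Finset.univ.erase l).erase 0, |corr (w j) u| ≤ τ * √(corr (w j) (w j)) := by
    intro j hj
    refine abs_corr_le.trans (Real.abs_le_sqrt ?_ |>.trans_eq
      (show √(τ ^ 2 * corr (w j) (w j)) = _ by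
        rw [Real.sqrt_mul (by positivity), Real.sqrt_sq hτ]))
    rw [corr_self]
    refine (h j (Finset.ne_of_mem_erase hj)).trans ?_
    gcongr
    exact div_le_selfCorr (sq_nonneg ‖w j‖)
  have hs : √(restSelfCorr w l) =
      √(corr (w 0) (w 0)) * ∏ j ∈ (Finset.univ.erase l).erase 0, √(corr (w j) (w j)) := by
    rw [restSelfCorr, ← Finset.mul_prod_erase _ (fun j => corr (w j) (w j))
      (Finset.mem_erase.2 ⟨hl.symm, Finset.mem_univ _⟩), Real.sqrt_mul (corr_self_nonneg _),
      Real.sqrt_prod _ fun _ _ => corr_self_nonneg _]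
  rw [restCorr_eq hl, abs_mul, Finset.abs_prod, hs]
  calc _ ≤ 2 * √(corr (w 0) (w 0)) *
        ∏ j ∈ (Finset.univ.erase l).erase 0, (τ * √(corr (w j) (w j))) := by
          gcongr with j hjm
          exact hj j hjm
    _ = _ := by
        rw [Finset.prod_mul_distrib, Finset.prod_const, card_erase_erase hl]
        ring

end

/-- The recursion satisfied by gradient descent in the components other than the first. -/
def IsDescent {k d : ℕ} [NeZero k] (u : Vec d) (η : ℕ → ℝ) (w : ℕ → Weights k d) : Prop :=
  ∀ t, ∀ l : Fin k, l ≠ 0 → w (t + 1) l =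
    descentStep (signal u) (η t) (restSelfCorr (w t) l) (restCorr u (w t) l) (w t l)

lemma isDescent_gdIterate {k d : ℕ} [NeZero k] (hk : 2 ≤ k) (u : Vec d) (η : ℕ → ℝ)
    (w₀ : Weights k d) : IsDescent u η (gdIterate u η w₀) := by
  intro t l hl
  rw [gdIterate, PiLp.sub_apply, PiLp.smul_apply, gradient_objective_apply hk u _ hl]
  rfl

/-- For k = 1 the predictor is 2·erf, so both weights are the constant 4. -/
lemma gdIterate_succ_of_eq_one {k d : ℕ} [NeZero k] (hk : k = 1) (u : Vec d) (η : ℕ → ℝ)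
    (w₀ : Weights k d) (t : ℕ) : gdIterate u η w₀ (t + 1) 0 =
      descentStep (signal u) (η t) 4 4 (gdIterate u η w₀ t 0) := by
  rw [gdIterate, PiLp.sub_apply, PiLp.smul_apply, gradient_objective_apply_of_eq_one hk u _]
  rfl

section
variable {k d : ℕ} [NeZero k] {u : Vec d} {η : ℕ → ℝ} {w : ℕ → Weights k d}

lemma IsDescent.overlap_le_of_small (h : IsDescent u η w) (hη : ∀ t, 0 ≤ η t)
    (hη1 : ∀ t, η t ≤ 1) {σ : ℝ} (hσ0 : 0 ≤ σ) (hσ : σ ≤ 1 / 4) {n N : ℕ} (hnN : n ≤ N)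
    (hN : 6 * (N : ℝ) * (2 * σ) ^ (k - 2) ≤ σ)
    (hstart : ∀ l : Fin k, l ≠ 0 → |overlap (signal u) (w n l)| ≤ σ) (l : Fin k) (hl : l ≠ 0) :
    |overlap (signal u) (w N l)| ≤ 2 * σ :=
  FCParity.overlap_le_of_small (ι := {l : Fin k // l ≠ 0}) (w := fun t l => w t l)
    (D := fun t l => restSelfCorr (w t) l) (P := fun t l => restCorr u (w t) l)
    (norm_sq_signal_lt u).le hη hη1
    (fun _ _ => restSelfCorr_nonneg) (fun _ _ => restSelfCorr_le_one) (fun t l => h t l l.2)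
    (fun _ _ hs l => abs_restCorr_le_pow l.2 fun j hj => hs ⟨j, hj⟩) hσ0 hσ hnN hN
    (fun l => hstart l l.2) ⟨l, hl⟩

lemma IsDescent.overlap_le_of_large_norm (h : IsDescent u η w) (hη : ∀ t, 0 ≤ η t)
    (hη1 : ∀ t, η t ≤ 1) {τ ρ : ℝ} (hτ0 : 0 ≤ τ) (hτ : τ ≤ 1 / 4) (hρ : 1 ≤ ρ) {N : ℕ}
    (hN1 : (N : ℝ) * (2 / ρ ^ 2 + 2 * (2 * τ) ^ (k - 2) / ρ) ≤ ρ)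
    (hN2 : (N : ℝ) * (4 * (2 * τ) ^ (k - 2) / ρ ^ 2) ≤ τ)
    (hnorm : ∀ l : Fin k, 2 * ρ ≤ ‖w 0 l‖)
    (hstart : ∀ l : Fin k, l ≠ 0 → |overlap (signal u) (w 0 l)| ≤ τ) (l : Fin k) (hl : l ≠ 0) :
    |overlap (signal u) (w N l)| ≤ 2 * τ :=
  FCParity.overlap_le_of_large_norm (ι := {l : Fin k // l ≠ 0}) (w := fun t l => w t l)
    (D := fun t l => restSelfCorr (w t) l) (P := fun t l => restCorr u (w t) l)
    (norm_sq_signal_lt u).le hη hη1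
    (fun _ _ => restSelfCorr_nonneg) (fun _ _ => restSelfCorr_le_one.trans (by norm_num))
    (fun t l => h t l l.2)
    (fun _ hs l => abs_restCorr_le_pow l.2 fun j hj => hs ⟨j, hj⟩) (by positivity) hτ hρ hN1 hN2
    (fun l => hnorm l) (fun l => hstart l l.2) ⟨l, hl⟩

end

/-! ### The potential argument for intermediate k -/

lemma le_mul_of_add_sq_le {x y a : ℝ} (hx : 0 ≤ x) (hxa : a ≤ x)
    (h : y + 4 * y ^ 2 ≤ x + 4 * x ^ 2 + a / 2) : y ≤ 3 / 2 * x := by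
  by_contra hlt
  push Not at hlt
  nlinarith

section
variable {k d : ℕ} [NeZero k] {u : Vec d}

/-- The potentials that control the descent while all weight vectors have norm at least `r`. -/
structure PhaseBound (u : Vec d) (w : Weights k d) (K L a b : ℝ) : Prop where
  perp_pos : ∀ l : Fin k, l ≠ 0 → 0 < ‖perp (signal u) (w l)‖
  tilt : ∀ l : Fin k, l ≠ 0 → |inner ℝ (w l) (signal u)| / ‖perp (signal u) (w l)‖ +
    K * ‖perp (signal u) (w l)‖ ≤ a
  balance : ∀ l j : Fin k, l ≠ 0 → j ≠ 0 →
    |‖w l‖ ^ 2 + 4 * (‖w l‖ ^ 2) ^ 2 - (‖w j‖ ^ 2 + 4 * (‖w j‖ ^ 2) ^ 2)| +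
      L * (‖w l‖ ^ 2 + ‖w j‖ ^ 2) ≤ b

variable {w : Weights k d} {K L a b : ℝ} {l j : Fin k}

lemma PhaseBound.abs_inner_le (h : PhaseBound u w K L a b) (hK : 0 ≤ K) (hl : l ≠ 0) :
    |inner ℝ (w l) (signal u)| ≤ a * ‖perp (signal u) (w l)‖ := by
  have h1 := h.perp_pos l hl
  rw [← div_le_iff₀ h1]
  have := h.tilt l hl
  have : 0 ≤ K * ‖perp (signal u) (w l)‖ := by positivity
  linarith

/-- The diagonal case of `balance` bounds the norm itself. -/
lemma PhaseBound.norm_sq_le (h : PhaseBound u w K L a b) (hL : 0 < L) (hl : l ≠ 0) {x : ℝ}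
    (hb : b ≤ 2 * (L * x)) : ‖w l‖ ^ 2 ≤ x := by
  have := h.balance l l hl hl
  rw [sub_self, abs_zero] at this
  have h2 : L * ‖w l‖ ^ 2 ≤ L * x := by linarith
  exact le_of_mul_le_mul_left h2 hL

lemma PhaseBound.norm_sq_le_mul (h : PhaseBound u w K L a b) (hL : 0 ≤ L) (hl : l ≠ 0)
    (hj : j ≠ 0) {x : ℝ} (hx : ‖w l‖ ^ 2 ≤ x) (hb : b ≤ x / 2) : ‖w j‖ ^ 2 ≤ 3 / 2 * x := by
  have h1 := h.balance l j hl hj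
  have h2 : 0 ≤ L * (‖w l‖ ^ 2 + ‖w j‖ ^ 2) := by positivity
  have h3 := neg_abs_le (‖w l‖ ^ 2 + 4 * (‖w l‖ ^ 2) ^ 2 - (‖w j‖ ^ 2 + 4 * (‖w j‖ ^ 2) ^ 2))
  have hl0 := sq_nonneg ‖w l‖
  refine le_mul_of_add_sq_le (a := x) (hl0.trans hx) le_rfl ?_
  nlinarith

lemma exists_ne_ne_zero (hk : 3 ≤ k) (l : Fin k) : ∃ j : Fin k, j ≠ l ∧ j ≠ 0 := by
  have : ((Finset.univ.erase l).erase 0).Nonempty := by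
    rw [← Finset.card_pos]
    have h1 := Finset.pred_card_le_card_erase (s := Finset.univ.erase l) (a := (0 : Fin k))
    have h2 := Finset.pred_card_le_card_erase (s := Finset.univ) (a := l)
    rw [Finset.card_univ, Fintype.card_fin] at h2
    omega
  obtain ⟨j, hj⟩ := this
  exact ⟨j, Finset.ne_of_mem_erase (Finset.mem_of_mem_erase hj), Finset.ne_of_mem_erase hj⟩

/-- The two potentials support each other: small tilts give |P| ≤ M√D, and balance supplies the
comparable vector that prevents overshooting. For k ≥ 3 such a vector exists with nonzero index. -/
lemma PhaseBound.step (h : PhaseBound u w K L a b) (hk : 3 ≤ k) (hν : 1 ≤ ‖signal u‖ ^ 2)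
    {η : ℝ} (hη : 0 ≤ η) (hη1 : η ≤ 1) {w' : Weights k d}
    (hw' : ∀ l : Fin k, l ≠ 0 → w' l =
      descentStep (signal u) η (restSelfCorr w l) (restCorr u w l) (w l))
    {σ M K' L' r X : ℝ} (hσ0 : 0 ≤ σ) (hσ : σ ≤ 1 / 40) (ha : a ≤ σ)
    (hM : 2 * σ ^ (k - 2) = M) (hMσ : M ≤ σ)
    (hr : 0 < r) (hr1 : r ≤ 1) (hrw : ∀ l : Fin k, l ≠ 0 → r ≤ ‖w l‖) (hb : b ≤ r ^ 2 / 2)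
    (hX : 0 ≤ X) (hbX : b ≤ 2 * (L * X ^ 2)) (hK : 0 < K)
    (hK' : 32 * M ^ 2 / (K * r ^ 3) + K * M * σ ≤ K') (hL : 0 < L) (hL1 : L ≤ 1)
    (hL' : 450 * σ ^ 2 * M ^ 2 / L * (3 / r ^ 2 + 2 * X) ≤ L') :
    PhaseBound u w' K L (a + K') (b + 2 * L') := by
  have hm : ∀ l : Fin k, l ≠ 0 → |inner ℝ (w l) (signal u)| ≤ σ * ‖perp (signal u) (w l)‖ :=
    fun l hl => (h.abs_inner_le hK.le hl).trans (by gcongr)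
  have hM0 : 0 ≤ M := by rw [← hM]; positivity
  have hP : ∀ l : Fin k, l ≠ 0 → |restCorr u w l| ≤ M * √(restSelfCorr w l) := fun l hl =>
    hM ▸ abs_restCorr_le_sqrt hl hσ0 fun j hj => overlap_sq_le_of_inner_le hν (hm j hj)
  have hs : ∀ l : Fin k, l ≠ 0 → |overlap (signal u) (w l)| ≤ σ := fun l hl =>
    abs_overlap_le_of_inner_le hν hσ0 (hm l hl)
  have hP1 : ∀ l : Fin k, l ≠ 0 → |restCorr u w l| ≤ 1 / 40 := fun l hl =>
    (hP l hl).trans ((mul_le_of_le_one_right hM0 (Real.sqrt_le_one.2 restSelfCorr_le_one)).trans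
      (hMσ.trans hσ))
  have hDA : ∀ l : Fin k, l ≠ 0 → restSelfCorr w l * radialCoef (‖w l‖ ^ 2) ≤ 8 / 9 := by
    intro l hl
    obtain ⟨j, hjl, hj⟩ := exists_ne_ne_zero hk l
    refine restSelfCorr_mul_radialCoef_le hjl (h.norm_sq_le_mul hL.le hl hj le_rfl ?_)
    have : r ^ 2 ≤ ‖w l‖ ^ 2 := by gcongr; exact hrw l hl
    linarith
  have hwX : ∀ l : Fin k, l ≠ 0 → ‖w l‖ ≤ X := fun l hl =>
    abs_le_of_sq_le_sq' (h.norm_sq_le hL hl hbX) hX |>.2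
  have htilt := fun l (hl : l ≠ 0) => tilt_descentStep_le hν (norm_sq_signal_lt u).le hη hη1
    restSelfCorr_nonneg restSelfCorr_le_one (hDA l hl) (h.perp_pos l hl) (by linarith) (hm l hl)
    (hP1 l hl) hM0 (hP l hl) hr hr1 (hrw l hl) hK hK'
  refine ⟨fun l hl => ?_, fun l hl => ?_, fun l j hl hj => ?_⟩
  · rw [hw' l hl]; exact (htilt l hl).1
  · rw [hw' l hl]; linarith [(htilt l hl).2, h.tilt l hl]
  · rw [hw' l hl, hw' j hj]
    have := abs_sub_descentStep_le (norm_sq_signal_lt u).le hη hη1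
      (Finset.prod_nonneg fun j _ => corr_self_nonneg (w j)) restSelfCorr_mul
      (restSelfCorr_mul (w := w)) restSelfCorr_le_one restSelfCorr_le_one (hDA l hl) (hDA j hj)
      (hs l hl) (hs j hj) hσ hM0 hMσ (hP l hl) (hP j hj) hr hr1 (hrw l hl) (hrw j hj)
      (hwX l hl) (hwX j hj) hL hL1 hL'
    linarith [h.balance l j hl hj]

end

section
variable {k d : ℕ} [NeZero k] {u : Vec d} {η : ℕ → ℝ} {w : ℕ → Weights k d}

/-- Descent started from balanced weights with a small tilt keeps all overlaps small. -/
lemma IsDescent.overlap_le_of_balanced (h : IsDescent u η w) (hk : 4 ≤ k)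
    (hν : 1 ≤ ‖signal u‖ ^ 2) (hη : ∀ t, 0 ≤ η t) (hη1 : ∀ t, η t ≤ 1)
    {τ K K' L L' r R : ℝ} (hτ : 0 < τ) (hτ1 : τ ≤ 1 / 80) (hr : 0 < r) (hr1 : r ≤ 1)
    (hR : 0 < R) (hK : 0 < K) (hL : 0 < L) (hL1 : L ≤ 1) {N : ℕ}
    (hK' : 32 * (2 * (2 * τ) ^ (k - 2)) ^ 2 / (K * r ^ 3) +
      K * (2 * (2 * τ) ^ (k - 2)) * (2 * τ) ≤ K')
    (hL' : 450 * (2 * τ) ^ 2 * (2 * (2 * τ) ^ (k - 2)) ^ 2 / L * (3 / r ^ 2 + 2 * (2 * R)) ≤ L')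
    (hKR : K * R ≤ τ / 2) (hKN : N * K' ≤ τ / 2) (hLR : L * R ^ 2 ≤ r ^ 2 / 8)
    (hLN : N * (2 * L') ≤ L * R ^ 2) (hsmall : 6 * (N : ℝ) * (2 * (3 * τ * r)) ^ (k - 2) ≤ 3 * τ * r)
    (hnorm : ∀ l : Fin k, l ≠ 0 → ‖w 0 l‖ = R)
    (hperp : ∀ l : Fin k, l ≠ 0 → 0 < ‖perp (signal u) (w 0 l)‖)
    (hstart : ∀ l : Fin k, l ≠ 0 → |inner ℝ (w 0 l) (signal u)| ≤ τ * ‖perp (signal u) (w 0 l)‖)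
    (l : Fin k) (hl : l ≠ 0) :
    |overlap (signal u) (w N l)| ≤ 6 * τ := by
  have hr2 : 0 ≤ r ^ 2 := sq_nonneg r
  have hK'0 : 0 ≤ K' := le_trans (by positivity) hK'
  have hL'0 : 0 ≤ L' := le_trans (by positivity) hL'
  have hM : 2 * (2 * τ) ^ (k - 2) ≤ 2 * τ := by
    obtain ⟨m, rfl⟩ := Nat.exists_eq_add_of_le hk
    rw [show 4 + m - 2 = m + 2 by omega, pow_add]
    have : (2 * τ) ^ m ≤ 1 := pow_le_one₀ (by positivity) (by linarith)
    nlinarith [mul_le_mul_of_nonneg_right this (sq_nonneg (2 * τ))]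
  -- Norms are bounded below only at times before t, so the conclusion still holds at the first time
  -- a norm falls below r.
  have hbound : ∀ t ≤ N, (∀ s < t, ∀ l : Fin k, l ≠ 0 → r ≤ ‖w s l‖) →
      PhaseBound u (w t) K L (τ + K * R + t * K') (2 * (L * R ^ 2) + t * (2 * L')) := by
    intro t
    induction t with
    | zero =>
      intro _ _
      refine ⟨hperp, fun l hl => ?_, fun l j hl hj => ?_⟩
      · have h1 := hperp l hl
        have h2 : ‖perp (signal u) (w 0 l)‖ ≤ R := by
          rw [← hnorm l hl]
          refine abs_le_of_sq_le_sq' ?_ (norm_nonneg _) |>.2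
          rw [norm_sq_eq_perp (w := w 0 l) hν]
          have : 0 ≤ inner ℝ (w 0 l) (signal u) ^ 2 / ‖signal u‖ ^ 2 := by positivity
          linarith
        have h3 : |inner ℝ (w 0 l) (signal u)| / ‖perp (signal u) (w 0 l)‖ ≤ τ := by
          rw [div_le_iff₀ h1]; exact hstart l hl
        have h4 : K * ‖perp (signal u) (w 0 l)‖ ≤ K * R := by gcongr
        simp only [Nat.cast_zero, zero_mul, add_zero]
        linarith
      · rw [hnorm l hl, hnorm j hj, sub_self, abs_zero]
        simp only [Nat.cast_zero, zero_mul, add_zero]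
        linarith
    | succ t ih =>
      intro ht hs
      have h0 := ih (by omega) fun s hst => hs s (by omega)
      have htN : (t : ℝ) ≤ N := by exact_mod_cast (by omega : t ≤ N)
      have e1 : (t : ℝ) * K' ≤ τ / 2 := le_trans (by gcongr) hKN
      have e2 : (t : ℝ) * (2 * L') ≤ L * R ^ 2 := le_trans (by gcongr) hLN
      have h1 := h0.step (by omega) hν (hη t) (hη1 t) (h t) (σ := 2 * τ) (by positivity)
        (by linarith) (by linarith) rfl hM hr hr1 (hs t (by omega)) (by linarith)
        (X := 2 * R) (by positivity) (by nlinarith) hK hK' hL hL1 hL'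
      push_cast
      convert h1 using 1 <;> ring
  have hfinal : ∀ t ≤ N, PhaseBound u (w t) K L (τ + K * R + t * K')
      (2 * (L * R ^ 2) + t * (2 * L')) → PhaseBound u (w t) K L (2 * τ) (r ^ 2 / 2) := by
    intro t ht hp
    have htN : (t : ℝ) ≤ N := by exact_mod_cast ht
    have e1 : (t : ℝ) * K' ≤ τ / 2 := le_trans (by gcongr) hKN
    have e2 : (t : ℝ) * (2 * L') ≤ L * R ^ 2 := le_trans (by gcongr) hLN
    exact ⟨hp.perp_pos, fun l hl => (hp.tilt l hl).trans (by linarith),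
      fun l j hl hj => (hp.balance l j hl hj).trans (by linarith)⟩
  by_cases hex : ∃ t, t < N ∧ ∃ l : Fin k, l ≠ 0 ∧ ‖w t l‖ < r
  · classical
    have hspec := Nat.find_spec hex
    set n := Nat.find hex
    obtain ⟨hnN, i, hi, hir⟩ := hspec
    have hmin : ∀ s < n, ∀ l : Fin k, l ≠ 0 → r ≤ ‖w s l‖ := by
      intro s hs l hl
      by_contra hlt
      exact Nat.find_min hex hs ⟨hs.trans hnN, l, hl, not_le.1 hlt⟩
    have hp := hfinal n hnN.le (hbound n hnN.le hmin)
    have hi2 : ‖w n i‖ ^ 2 ≤ r ^ 2 := by gcongr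
    -- Balance makes every squared norm at most 3r²/2 at this moment, and (2τ)²·3/2 = 6τ² ≤ (3τ)².
    have hstart' : ∀ j : Fin k, j ≠ 0 → |overlap (signal u) (w n j)| ≤ 3 * τ * r := by
      intro j hj
      have h1 := hp.norm_sq_le_mul hL.le hi hj hi2 le_rfl
      have h2 := overlap_sq_le_of_inner_le hν (hp.abs_inner_le hK.le hj)
      refine abs_le_of_sq_le_sq (h2.trans ?_) (by positivity)
      have h3 : ‖w n j‖ ^ 2 / (1 + 2 * ‖w n j‖ ^ 2) ≤ 3 / 2 * r ^ 2 :=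
        (div_le_self (sq_nonneg _) (by linarith [sq_nonneg ‖w n j‖])).trans h1
      calc (2 * τ) ^ 2 * (‖w n j‖ ^ 2 / (1 + 2 * ‖w n j‖ ^ 2)) ≤ (2 * τ) ^ 2 * (3 / 2 * r ^ 2) := by
            gcongr
        _ ≤ (3 * τ * r) ^ 2 := by nlinarith [sq_nonneg (τ * r)]
    have hτr : τ * r ≤ τ := mul_le_of_le_one_right hτ.le hr1
    refine (h.overlap_le_of_small hη hη1 (by positivity) (by linarith) hnN.le hsmall hstart'
      l hl).trans (by linarith)
  · push Not at hex
    have hp := hfinal N le_rfl (hbound N le_rfl hex)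
    refine (abs_overlap_le_of_inner_le hν (by positivity) (hp.abs_inner_le hK.le hl)).trans ?_
    linarith

end

/-! ### Lower bounds for the objective -/

/-- 1 - (2/π)arctan z = (2/π)arctan(1/z) ≤ 2/(πz). -/
lemma one_sub_selfCorr_le {y : ℝ} (hy : 0 < y) :
    1 - selfCorr y ≤ 2 / Real.pi * (√(1 + 4 * y) / (2 * y)) := by
  have hS : 0 < √(1 + 4 * y) := Real.sqrt_pos.2 (by positivity)
  have hz : 0 < 2 * y / √(1 + 4 * y) := by positivity
  rw [selfCorr, arcsin_eq_arctan hy.le]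
  have h1 := Real.arctan_inv_of_pos hz
  have h2 : Real.arctan (2 * y / √(1 + 4 * y))⁻¹ ≤ √(1 + 4 * y) / (2 * y) := by
    have := Real.le_tan (Real.arctan_nonneg.2 (inv_nonneg.2 hz.le)) (Real.arctan_lt_pi_div_two _)
    rw [Real.tan_arctan] at this
    exact this.trans_eq (inv_div _ _)
  have h3 : 1 = 2 / Real.pi * (Real.pi / 2) := by field_simp
  calc 1 - 2 / Real.pi * Real.arctan (2 * y / √(1 + 4 * y)) =
        2 / Real.pi * Real.arctan (2 * y / √(1 + 4 * y))⁻¹ := by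
          rw [h1]; nth_rw 1 [h3]; ring
    _ ≤ _ := by gcongr

section
variable {k d : ℕ} {u : Vec d}

lemma target_norm_sq_ge (hu : 12 / Real.pi ^ 2 * (k : ℝ) ^ 2 ≤ ‖u‖ ^ 2) :
    1.215 * (k : ℝ) ^ 2 ≤ ‖u‖ ^ 2 := by
  refine le_trans ?_ hu
  gcongr
  rw [le_div_iff₀ (by positivity)]
  have := Real.pi_lt_d4
  nlinarith [Real.pi_pos]

variable [NeZero k]

lemma one_sub_corr_self_le (hu : 12 / Real.pi ^ 2 * (k : ℝ) ^ 2 ≤ ‖u‖ ^ 2) :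
    k * (1 - corr u u) ≤ 0.64 := by
  have hk : (1 : ℝ) ≤ k := by exact_mod_cast Nat.one_le_iff_ne_zero.2 (NeZero.ne k)
  have h1 := target_norm_sq_ge hu
  rw [corr_self]
  set y : ℝ := 1.215 * (k : ℝ) ^ 2 with hy
  have hy0 : 0 < y := by positivity
  have h2 : 1 - selfCorr (‖u‖ ^ 2) ≤ 2 / Real.pi * (√(1 + 4 * y) / (2 * y)) :=
    (sub_le_sub_left (selfCorr_mono hy0.le h1) 1).trans (one_sub_selfCorr_le hy0)
  have h3 : √(1 + 4 * y) ≤ 2.43 * k :=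
    Real.sqrt_le_iff.2 ⟨by positivity, by rw [hy]; nlinarith⟩
  have h4 : 2 / Real.pi ≤ 0.637 := by
    rw [div_le_iff₀ Real.pi_pos]; linarith [Real.pi_gt_d4]
  calc k * (1 - selfCorr (‖u‖ ^ 2)) ≤ k * (0.637 * (2.43 * k / (2 * y))) := by
        gcongr
        exact h2.trans (by gcongr)
    _ = 0.637 * 2.43 / 2.43 := by rw [hy]; field_simp; norm_num
    _ ≤ 0.64 := by norm_num

lemma one_le_norm_sq_signal (hu : 12 / Real.pi ^ 2 * (k : ℝ) ^ 2 ≤ ‖u‖ ^ 2) :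
    1 ≤ ‖signal u‖ ^ 2 := by
  have hk : (1 : ℝ) ≤ k := by exact_mod_cast Nat.one_le_iff_ne_zero.2 (NeZero.ne k)
  have h1 := target_norm_sq_ge hu
  rw [norm_sq_signal, le_div_iff₀ (by positivity)]
  nlinarith

/-- Numerically, ½(1 - 0.64) - 1/20 = 0.13 > 1/8. One small overlap suffices, as the other
correlations are at most 1. -/
lemma le_objective_of_overlap_le (hk : 2 ≤ k)
    (hu : 12 / Real.pi ^ 2 * (k : ℝ) ^ 2 ≤ ‖u‖ ^ 2) {w : Weights k d} {l : Fin k}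
    (h : |overlap (signal u) (w l)| ≤ 1 / 20) : 1 / 8 ≤ objective u w := by
  have h1 := one_sub_corr_self_le hu
  have h2 := one_add_mul_le_pow (a := corr u u - 1) (by linarith [corr_self_nonneg u]) k
  rw [add_sub_cancel] at h2
  have h3 := (abs_prod_corr_le (u := u) (w := w) l).trans h
  have h4 := le_abs_self (∏ l, corr (w l) u)
  have h5 : 0 ≤ ∏ l, corr (w l) (w l) := Finset.prod_nonneg fun _ _ => corr_self_nonneg _
  have h6 := corr_self_add_corr_self_nonneg (w 0) u
  rw [objective_eq hk]
  norm_num at h1 ⊢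
  linarith

lemma le_objective_of_overlap_le_of_eq_one (hk : k = 1)
    (hu : 12 / Real.pi ^ 2 * (k : ℝ) ^ 2 ≤ ‖u‖ ^ 2) {w : Weights k d}
    (h : |overlap (signal u) (w 0)| ≤ 1 / 20) : 1 / 8 ≤ objective u w := by
  have h1 := one_sub_corr_self_le hu
  have h3 := (abs_corr_le (w := w 0) (u := u)).trans h
  have h4 := le_abs_self (corr (w 0) u)
  have h5 := corr_self_nonneg (w 0)
  rw [objective_eq_of_eq_one hk]
  rw [hk] at h1
  norm_num at h1
  linarith

end

/-! ### The random initialization -/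

lemma isProbabilityMeasure_uniformOn_pair (c : ℝ) :
    IsProbabilityMeasure (uniformOn ({c, -c} : Set ℝ)) :=
  isProbabilityMeasure_uniformOn' (Set.toFinite _) (Set.insert_nonempty _ _)
    (Set.toFinite _).measurableSet

lemma ae_uniformOn_pair (c : ℝ) : ∀ᵐ x ∂(uniformOn ({c, -c} : Set ℝ)), x ∈ ({c, -c} : Set ℝ) :=
  ae_cond_mem (Set.toFinite _).measurableSet

lemma integral_uniformOn_pair {c : ℝ} (hc : 0 < c) :
    ∫ x, x ∂(uniformOn ({c, -c} : Set ℝ)) = 0 := by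
  have hne : c ≠ -c := by linarith
  rw [uniformOn, ProbabilityTheory.cond, integral_smul_measure, Set.insert_eq,
    setIntegral_union (Set.disjoint_singleton.2 hne) (measurableSet_singleton _)
      (integrableOn_singleton (hx := by simp))
      (integrableOn_singleton (hx := by simp)),
    integral_singleton, integral_singleton]
  simp [Measure.real]

lemma hasSubgaussianMGF_uniformOn_pair {c : ℝ} (hc : 0 < c) :
    HasSubgaussianMGF (fun x : ℝ => x) (c ^ 2).toNNReal (uniformOn ({c, -c} : Set ℝ)) := by
  have := isProbabilityMeasure_uniformOn_pair c
  have h := hasSubgaussianMGF_of_mem_Icc_of_integral_eq_zero (X := fun x : ℝ => x) (a := -c)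
    (b := c) (μ := uniformOn ({c, -c} : Set ℝ)) aemeasurable_id
    ((ae_uniformOn_pair c).mono fun x hx => by
      rcases hx with rfl | rfl
      · exact ⟨by linarith, le_rfl⟩
      · exact ⟨le_rfl, by linarith⟩) (integral_uniformOn_pair hc)
  convert h using 1
  ext
  rw [Real.coe_toNNReal _ (sq_nonneg c)]
  push_cast
  rw [Real.norm_eq_abs, abs_of_nonneg (by linarith)]
  ring

/-- Hoeffding's inequality for a signed sum with signs in `{c, -c}`. -/
lemma measure_abs_sum_ge_le {d : ℕ} {c : ℝ} (hc : 0 < c) (v : Vec d) {s : ℝ} (hs : 0 ≤ s) :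
    (Measure.pi fun _ : Fin d => uniformOn ({c, -c} : Set ℝ)).real
      {a | s ≤ |∑ i, v i * a i|} ≤ 2 * Real.exp (-s ^ 2 / (2 * (c ^ 2 * ‖v‖ ^ 2))) := by
  have := isProbabilityMeasure_uniformOn_pair c
  set μ := Measure.pi fun _ : Fin d => uniformOn ({c, -c} : Set ℝ)
  have key : ∀ v : Vec d, μ.real {a | s ≤ ∑ i, v i * a i} ≤
      Real.exp (-s ^ 2 / (2 * (c ^ 2 * ‖v‖ ^ 2))) := by
    intro v
    have hind : iIndepFun (fun i (a : Fin d → ℝ) => v i * a i) μ :=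
      iIndepFun_pi (X := fun i x => v i * x) fun i => (measurable_const_mul (v i)).aemeasurable
    have hsub : ∀ i ∈ Finset.univ, HasSubgaussianMGF (fun a : Fin d → ℝ => v i * a i)
        ((v i ^ 2).toNNReal * (c ^ 2).toNNReal) μ := by
      intro i _
      rw [show (v i ^ 2).toNNReal = ⟨v i ^ 2, sq_nonneg _⟩ from Real.toNNReal_of_nonneg _]
      refine HasSubgaussianMGF.const_mul (X := fun a : Fin d → ℝ => a i) ?_ (v i)
      refine HasSubgaussianMGF.of_map (Y := fun a : Fin d → ℝ => a i) (X := fun x => x)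
        (measurable_pi_apply i).aemeasurable ?_
      rw [(measurePreserving_eval _ i).map_eq]
      exact hasSubgaussianMGF_uniformOn_pair hc
    refine (HasSubgaussianMGF.measure_sum_ge_le_of_iIndepFun hind hsub hs).trans_eq ?_
    congr 3
    push_cast
    rw [EuclideanSpace.real_norm_sq_eq, mul_comm (c ^ 2), Finset.sum_mul]
    exact Finset.sum_congr rfl fun i _ => by
      rw [Real.coe_toNNReal _ (sq_nonneg c), Real.coe_toNNReal _ (sq_nonneg (v i))]
  have h1 := key v
  have h2 := key (-v)
  rw [norm_neg] at h2
  have hsub : {a : Fin d → ℝ | s ≤ |∑ i, v i * a i|} ⊆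
      {a | s ≤ ∑ i, v i * a i} ∪ {a | s ≤ ∑ i, (-v) i * a i} := by
    intro a ha
    rcases le_abs.1 ((show s ≤ |∑ i, v i * a i| from ha)) with h | h
    · exact Or.inl h
    · right
      simpa [Finset.sum_neg_distrib] using h
  calc _ ≤ μ.real ({a | s ≤ ∑ i, v i * a i} ∪ {a | s ≤ ∑ i, (-v) i * a i}) :=
        measureReal_mono hsub
    _ ≤ _ := measureReal_union_le _ _
    _ ≤ _ := by linarith

/-- With high probability all overlaps of the initial weights with a fixed vector are small. -/
lemma le_initLaw_real {k d : ℕ} {c : ℝ} (hc : 0 < c) (v : Vec d) {s : ℝ} (hs : 0 ≤ s)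
    {S : Set (Weights k d)}
    (hS : ∀ w : Weights k d, (∀ l i, w l i ^ 2 = c ^ 2) → (∀ l, |inner ℝ (w l) v| < s) → w ∈ S) :
    1 - 2 * k * Real.exp (-s ^ 2 / (2 * (c ^ 2 * ‖v‖ ^ 2))) ≤ (initLaw k d c).real S := by
  have := isProbabilityMeasure_uniformOn_pair c
  set ν := Measure.pi fun _ : Fin d => uniformOn ({c, -c} : Set ℝ) with hν
  set μ := Measure.pi fun _ : Fin k => ν with hμ
  have hmeas : Measurable (ofCoords : (Fin k → Fin d → ℝ) → Weights k d) := by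
    refine (WithLp.measurable_toLp 2 _).comp (measurable_pi_lambda _ fun l => ?_)
    exact (WithLp.measurable_toLp 2 _).comp (measurable_pi_apply l)
  have hprob : IsProbabilityMeasure (initLaw k d c) :=
    Measure.isProbabilityMeasure_map hmeas.aemeasurable
  have hmem : ∀ᵐ a ∂μ, ∀ l i, a l i ^ 2 = c ^ 2 := by
    rw [ae_all_iff]
    intro l
    rw [ae_all_iff]
    intro i
    have h0 : ∀ᵐ x ∂(uniformOn ({c, -c} : Set ℝ)), x ^ 2 = c ^ 2 := by
      filter_upwards [ae_uniformOn_pair c] with x hx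
      rcases hx with h | h
      · rw [h]
      · rw [Set.mem_singleton_iff.1 h, neg_sq]
    have h1 : ∀ᵐ b ∂ν, b i ^ 2 = c ^ 2 :=
      (measurePreserving_eval (fun _ : Fin d => uniformOn ({c, -c} : Set ℝ))
        i).quasiMeasurePreserving.ae h0
    exact (measurePreserving_eval (fun _ : Fin k => ν) l).quasiMeasurePreserving.ae h1
  have htail : ∀ l : Fin k, μ.real {a | s ≤ |∑ i, v i * a l i|} ≤
      2 * Real.exp (-s ^ 2 / (2 * (c ^ 2 * ‖v‖ ^ 2))) := by
    intro l
    have hm : MeasurableSet {b : Fin d → ℝ | s ≤ |∑ i, v i * b i|} :=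
      measurableSet_le measurable_const (by fun_prop)
    have := (measurePreserving_eval (fun _ : Fin k => ν) l).measureReal_preimage
      hm.nullMeasurableSet
    exact this.trans_le (measure_abs_sum_ge_le hc v hs)
  have hbad : μ.real (⋃ l : Fin k, {a | s ≤ |∑ i, v i * a l i|}) ≤
      2 * k * Real.exp (-s ^ 2 / (2 * (c ^ 2 * ‖v‖ ^ 2))) := by
    refine (measureReal_iUnion_fintype_le _).trans ((Finset.sum_le_sum fun l _ => htail l).trans_eq ?_)
    rw [Finset.sum_const, Finset.card_univ, Fintype.card_fin, nsmul_eq_mul]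
    ring
  have hBm : MeasurableSet (⋃ l : Fin k, {a : Fin k → Fin d → ℝ | s ≤ |∑ i, v i * a l i|}) :=
    MeasurableSet.iUnion fun l => measurableSet_le measurable_const (by fun_prop)
  have hcompl := probReal_compl_eq_one_sub (μ := μ) hBm
  have hle : μ.real (⋃ l : Fin k, {a | s ≤ |∑ i, v i * a l i|})ᶜ ≤ (initLaw k d c).real S := by
    have h1 : μ (⋃ l : Fin k, {a | s ≤ |∑ i, v i * a l i|})ᶜ ≤ μ (ofCoords ⁻¹' S) := by
      refine measure_mono_ae ?_
      filter_upwards [hmem] with a ha hb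
      refine hS _ ha fun l => ?_
      have hb' : a ∉ ⋃ l : Fin k, {a | s ≤ |∑ i, v i * a l i|} := hb
      rw [Set.mem_iUnion] at hb'
      push Not at hb'
      have := not_le.1 (show ¬ s ≤ _ from hb' l)
      rwa [PiLp.inner_apply]
    -- This direction needs no measurability of S, so the step sizes may depend on the
    -- initialization arbitrarily.
    have h2 : μ (ofCoords ⁻¹' S) ≤ initLaw k d c S :=
      Measure.le_map_apply hmeas.aemeasurable S
    exact ENNReal.toReal_mono (measure_ne_top _ _) (h1.trans h2)
  linarith

/-! ### Arithmetic of the scales -/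

/-- The scale `a = d ^ (-1/48)` is small compared to the constants. -/
structure IsSmallScale (c ε a : ℝ) : Prop where
  c_pos : 0 < c
  eps_pos : 0 < ε
  eps_le : ε ≤ 1 / 10000
  eps_le_cube : 32 * ε ≤ c ^ 3
  pos : 0 < a
  le : a ≤ 1 / 10 ^ 9
  le_c : a ≤ c
  c_mul_le : c * a ≤ 1

section
variable {c ε a N : ℝ}

lemma IsSmallScale.one_le_radius (h : IsSmallScale c ε a) : 1 ≤ c / (2 * a ^ 24) := by
  have ha := h.pos
  have h1 : a ^ 23 ≤ 1 / 2 := by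
    calc a ^ 23 ≤ a ^ 1 :=
          pow_le_pow_of_le_one ha.le (h.le.trans (by norm_num)) (by norm_num)
      _ ≤ 1 / 2 := by rw [pow_one]; exact h.le.trans (by norm_num)
  rw [le_div_iff₀ (by positivity)]
  have h2 : a ^ 24 = a ^ 23 * a := by ring
  have h3 := mul_le_mul h1 h.le_c ha.le (by norm_num)
  linarith

lemma IsSmallScale.pow_le_sq (h : IsSmallScale c ε a) : 256 * a ^ 8 ≤ c ^ 2 := by
  have ha := h.pos
  have h1 : a ^ 6 ≤ 1 / 256 := by
    calc a ^ 6 ≤ a ^ 1 := pow_le_pow_of_le_one ha.le (h.le.trans (by norm_num)) (by norm_num)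
      _ ≤ _ := by rw [pow_one]; exact h.le.trans (by norm_num)
  have h2 : a ^ 2 ≤ c ^ 2 := by have := h.le_c; gcongr
  calc 256 * a ^ 8 = 256 * (a ^ 6 * a ^ 2) := by ring
    _ ≤ 256 * (1 / 256 * c ^ 2) := by gcongr
    _ = c ^ 2 := by ring

/-- The radius is half the initial norm. The radial loss is controlled by N·a^72, which is where 32ε
≤ c³ enters, and the loss caused by the signal by N·Q·a^24. -/
lemma IsSmallScale.large_norm_conditions (h : IsSmallScale c ε a) {Q : ℝ}
    (hN : N * a ^ 72 ≤ ε) (hNQ : N * Q * a ^ 24 ≤ 16 * ε) :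
    N * (2 / (c / (2 * a ^ 24)) ^ 2 + 2 * Q / (c / (2 * a ^ 24))) ≤ c / (2 * a ^ 24) ∧
      N * (4 * Q / (c / (2 * a ^ 24)) ^ 2) ≤ a ^ 16 := by
  have ha := h.pos
  have hc := h.c_pos
  have ha1 : a ≤ 1 := h.le.trans (by norm_num)
  have hsq := h.pow_le_sq
  have hNQ1 : N * Q * a ^ 24 ≤ 16 * 1 := by linarith [h.eps_le]
  have h24 : 256 * a ^ 24 ≤ c ^ 2 * a ^ 16 := by
    calc 256 * a ^ 24 = 256 * a ^ 8 * a ^ 16 := by ring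
      _ ≤ _ := by gcongr
  have h24' : 256 * a ^ 24 ≤ c ^ 2 :=
    h24.trans (mul_le_of_le_one_right (by positivity) (pow_le_one₀ ha.le ha1))
  have e1 : N * (2 / (c / (2 * a ^ 24)) ^ 2 + 2 * Q / (c / (2 * a ^ 24))) =
      (8 * (N * a ^ 72) / c ^ 3 + 4 * (N * Q * a ^ 24) * a ^ 24 / c ^ 2) * (c / a ^ 24) := by
    field_simp
    ring
  have e2 : N * (4 * Q / (c / (2 * a ^ 24)) ^ 2) = 16 * (N * Q * a ^ 24) * a ^ 24 / c ^ 2 := by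
    field_simp
    ring
  constructor
  · rw [e1, show c / (2 * a ^ 24) = 1 / 2 * (c / a ^ 24) by field_simp]
    gcongr
    have h1 : 8 * (N * a ^ 72) / c ^ 3 ≤ 1 / 4 := by
      rw [div_le_iff₀ (by positivity)]
      linarith [h.eps_le_cube]
    have h2 : 4 * (N * Q * a ^ 24) * a ^ 24 / c ^ 2 ≤ 1 / 4 := by
      rw [div_le_iff₀ (by positivity)]
      have : 4 * (N * Q * a ^ 24) * a ^ 24 ≤ 4 * (16 * 1) * a ^ 24 := by gcongr
      linarith
    linarith
  · rw [e2, div_le_iff₀ (by positivity)]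
    have : 16 * (N * Q * a ^ 24) * a ^ 24 ≤ 16 * (16 * 1) * a ^ 24 := by gcongr
    linarith

/-- 16(k-2) - 12k ≥ 16 exactly when k ≥ 12. At k = 12 no power of a is left, and ε ≤ 1/10000 absorbs
the constant 6·1024. -/
lemma IsSmallScale.large_order_condition (h : IsSmallScale c ε a) {k : ℕ} (hk : 12 ≤ k)
    (hN : N * a ^ (12 * k) ≤ ε) : 6 * N * (2 * a ^ 16) ^ (k - 2) ≤ a ^ 16 := by
  have ha := h.pos
  obtain ⟨m, rfl⟩ := Nat.exists_eq_add_of_le hk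
  have e : 6 * N * (2 * a ^ 16) ^ (12 + m - 2) =
      6 * 1024 * (N * a ^ (12 * (12 + m))) * (2 * a ^ 4) ^ m * a ^ 16 := by
    rw [show 12 + m - 2 = 10 + m by omega, mul_pow, mul_pow]
    ring
  have h1 : (2 * a ^ 4) ^ m ≤ 1 := by
    refine pow_le_one₀ (by positivity) ?_
    have : a ^ 4 ≤ a ^ 1 := pow_le_pow_of_le_one ha.le (h.le.trans (by norm_num)) (by norm_num)
    rw [pow_one] at this
    linarith [h.le]
  rw [e]
  refine mul_le_of_le_one_left (by positivity) ?_
  calc 6 * 1024 * (N * a ^ (12 * (12 + m))) * (2 * a ^ 4) ^ m ≤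
        6 * 1024 * (1 / 10000) * 1 := by
          have := h.eps_pos
          have h3 := hN.trans h.eps_le
          refine (mul_le_mul_of_nonneg_right (mul_le_mul_of_nonneg_left h3 (by norm_num))
            (by positivity)).trans ?_
          gcongr
    _ ≤ 1 := by norm_num

/-- Here n = k - 2. From overlaps of order a^22 the crude bound works: 22n ≥ 12n + 50 for n ≥ 5. -/
lemma IsSmallScale.small_overlap_condition (h : IsSmallScale c ε a) (hN0 : 0 ≤ N) {n : ℕ}
    (hn : 5 ≤ n) (hn' : n ≤ 9) (hN : N * a ^ (12 * (n + 2)) ≤ ε) :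
    6 * N * (2 * (3 * a ^ 16 * a ^ 6)) ^ n ≤ 3 * a ^ 16 * a ^ 6 := by
  have ha := h.pos
  have ha1 : a ≤ 1 := h.le.trans (by norm_num)
  have h1 : (2 * (3 * a ^ 16 * a ^ 6)) ^ n ≤ 6 ^ 9 * a ^ (12 * n + 50) := by
    calc (2 * (3 * a ^ 16 * a ^ 6)) ^ n = 6 ^ n * a ^ (22 * n) := by
          rw [pow_mul, ← mul_pow]; congr 1; ring
      _ ≤ _ := by
          gcongr ?_ * ?_
          · exact pow_le_pow_right₀ (by norm_num) hn'
          · exact pow_le_pow_of_le_one ha.le ha1 (by omega)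
  have h2 : a ^ 4 ≤ 1 / 10 ^ 9 :=
    (pow_le_pow_of_le_one ha.le ha1 (by norm_num : 1 ≤ 4)).trans (by rw [pow_one]; exact h.le)
  calc 6 * N * (2 * (3 * a ^ 16 * a ^ 6)) ^ n ≤ 6 * N * (6 ^ 9 * a ^ (12 * n + 50)) := by gcongr
    _ = 6 ^ 10 * (N * a ^ (12 * (n + 2))) * a ^ 4 * a ^ 22 := by ring
    _ ≤ 6 ^ 10 * (1 / 10000) * (1 / 10 ^ 9) * a ^ 22 := by
        gcongr; exact hN.trans h.eps_le
    _ ≤ 3 * a ^ 22 := by gcongr; norm_num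
    _ = _ := by ring

lemma IsSmallScale.coupling_sq_le (h : IsSmallScale c ε a) {n : ℕ} (hn : 5 ≤ n) (hn' : n ≤ 9) :
    2 * (2 * a ^ 16) ^ n ≤ 2 ^ 10 * a ^ (12 * n + 20) ∧
      (2 * (2 * a ^ 16) ^ n) ^ 2 ≤ 2 ^ 20 * a ^ (12 * n + 100) := by
  have ha := h.pos
  have ha1 : a ≤ 1 := h.le.trans (by norm_num)
  have e : 2 * (2 * a ^ 16) ^ n = 2 ^ (n + 1) * a ^ (16 * n) := by
    rw [pow_mul, mul_pow]; ring
  have h2 : (2 : ℝ) ^ (n + 1) ≤ 2 ^ 10 := pow_le_pow_right₀ (by norm_num) (by omega)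
  constructor
  · rw [e]
    gcongr ?_ * ?_
    · exact pow_le_pow_of_le_one ha.le ha1 (by omega)
  · rw [e, mul_pow, ← pow_mul a]
    have : ((2 : ℝ) ^ (n + 1)) ^ 2 ≤ 2 ^ 20 := by
      calc _ ≤ ((2 : ℝ) ^ 10) ^ 2 := by gcongr
        _ = 2 ^ 20 := by norm_num
    gcongr ?_ * ?_
    · exact pow_le_pow_of_le_one ha.le ha1 (by omega)

lemma IsSmallScale.tilt_condition (h : IsSmallScale c ε a) {n : ℕ} (hn : 5 ≤ n) (hn' : n ≤ 9) :
    32 * (2 * (2 * a ^ 16) ^ n) ^ 2 / (a ^ 40 / (2 * c) * (a ^ 6) ^ 3) +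
      a ^ 40 / (2 * c) * (2 * (2 * a ^ 16) ^ n) * (2 * a ^ 16) ≤ a ^ (12 * n + 40) / 2 := by
  have ha := h.pos
  have hc := h.c_pos
  have ha1 : a ≤ 1 := h.le.trans (by norm_num)
  obtain ⟨hM, hM2⟩ := h.coupling_sq_le hn hn'
  set M := 2 * (2 * a ^ 16) ^ n
  have h1 : 32 * M ^ 2 / (a ^ 40 / (2 * c) * (a ^ 6) ^ 3) ≤ a ^ (12 * n + 40) / 4 := by
    calc _ ≤ 32 * (2 ^ 20 * a ^ (12 * n + 100)) / (a ^ 40 / (2 * c) * (a ^ 6) ^ 3) := by gcongr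
      _ = 2 ^ 26 * (c * a) * a * a ^ (12 * n + 40) := by
          rw [show 12 * n + 100 = 12 * n + 40 + 60 by ring, pow_add a (12 * n + 40)]
          field_simp
          norm_num
      _ ≤ 2 ^ 26 * 1 * (1 / 10 ^ 9) * a ^ (12 * n + 40) := by
          gcongr
          · exact h.c_mul_le
          · exact h.le
      _ ≤ _ := by
          have : 0 ≤ a ^ (12 * n + 40) := by positivity
          linarith
  have h2 : a ^ 40 / (2 * c) * M * (2 * a ^ 16) ≤ a ^ (12 * n + 40) / 4 := by
    have h3 : a / c ≤ 1 := (div_le_one hc).2 h.le_c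
    calc _ ≤ a ^ 40 / (2 * c) * (2 ^ 10 * a ^ (12 * n + 20)) * (2 * a ^ 16) := by gcongr
      _ = 2 ^ 10 * (a / c) * a ^ 34 * a * a ^ (12 * n + 40) := by
          rw [show 12 * n + 40 = 12 * n + 20 + 20 by ring, pow_add a (12 * n + 20) 20]
          field_simp
      _ ≤ 2 ^ 10 * 1 * 1 * (1 / 10 ^ 9) * a ^ (12 * n + 40) := by
          gcongr
          · exact pow_le_one₀ ha.le ha1
          · exact h.le
      _ ≤ _ := by
          have : 0 ≤ a ^ (12 * n + 40) := by positivity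
          linarith
  linarith

lemma IsSmallScale.balance_condition (h : IsSmallScale c ε a) {n : ℕ} (hn : 5 ≤ n)
    (hn' : n ≤ 9) :
    450 * (2 * a ^ 16) ^ 2 * (2 * (2 * a ^ 16) ^ n) ^ 2 / (a ^ 60 / (8 * c ^ 2)) *
      (3 / (a ^ 6) ^ 2 + 2 * (2 * (c / a ^ 24))) ≤ a ^ (12 * n + 36) / 16 := by
  have ha := h.pos
  have hc := h.c_pos
  have ha1 : a ≤ 1 := h.le.trans (by norm_num)
  obtain ⟨-, hM2⟩ := h.coupling_sq_le hn hn'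
  set M := 2 * (2 * a ^ 16) ^ n
  have h1 : 3 / (a ^ 6) ^ 2 + 2 * (2 * (c / a ^ 24)) ≤ 7 / a ^ 25 := by
    have e : 3 / (a ^ 6) ^ 2 + 2 * (2 * (c / a ^ 24)) = (3 * a ^ 13 + 4 * (c * a)) / a ^ 25 := by
      field_simp
      ring
    rw [e]
    gcongr
    have : a ^ 13 ≤ 1 := pow_le_one₀ ha.le ha1
    linarith [h.c_mul_le]
  calc _ ≤ 450 * (2 * a ^ 16) ^ 2 * (2 ^ 20 * a ^ (12 * n + 100)) / (a ^ 60 / (8 * c ^ 2)) *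
        (7 / a ^ 25) := by gcongr
    _ = 450 * 4 * 2 ^ 20 * 8 * 7 * (c * a) ^ 2 * a ^ 5 * a ^ 4 * a ^ (12 * n + 36) := by
        rw [show 12 * n + 100 = 12 * n + 36 + 64 by ring, pow_add a (12 * n + 36)]
        field_simp
        norm_num
    _ ≤ 450 * 4 * 2 ^ 20 * 8 * 7 * 1 ^ 2 * (1 / 10 ^ 9) ^ 5 * 1 * a ^ (12 * n + 36) := by
        gcongr
        · exact h.c_mul_le
        · exact h.le
        · exact pow_le_one₀ ha.le ha1
    _ ≤ _ := by
        have : 0 ≤ a ^ (12 * n + 36) := by positivity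
        linarith

end

section
variable {d : ℕ} {ν w : Vec d} {c ε a : ℝ}

lemma IsSmallScale.abs_inner_le_perp (h : IsSmallScale c ε a) (hν : 1 ≤ ‖ν‖ ^ 2)
    (hw : ‖w‖ = c / a ^ 24) (hin : inner ℝ w ν ^ 2 ≤ 2 / 3 * (c ^ 2 / a ^ 16)) :
    0 < ‖perp ν w‖ ∧ |inner ℝ w ν| ≤ a ^ 16 * ‖perp ν w‖ := by
  have ha := h.pos
  have hc := h.c_pos
  have h1 := norm_sq_eq_perp (w := w) hν
  have h2 : inner ℝ w ν ^ 2 / ‖ν‖ ^ 2 ≤ inner ℝ w ν ^ 2 := div_le_self (sq_nonneg _) hν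
  have h3 : c ^ 2 / a ^ 48 - 2 / 3 * (c ^ 2 / a ^ 16) ≤ ‖perp ν w‖ ^ 2 := by
    have : ‖w‖ ^ 2 = c ^ 2 / a ^ 48 := by rw [hw, div_pow, ← pow_mul]
    linarith
  have h32 : a ^ 32 ≤ 1 / 2 := by
    calc a ^ 32 ≤ a ^ 1 := pow_le_pow_of_le_one ha.le (h.le.trans (by norm_num)) (by norm_num)
      _ ≤ _ := by rw [pow_one]; exact h.le.trans (by norm_num)
  have h4 : 2 / 3 * (c ^ 2 / a ^ 16) ≤
      a ^ 32 * (c ^ 2 / a ^ 48 - 2 / 3 * (c ^ 2 / a ^ 16)) := by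
    have e : a ^ 32 * (c ^ 2 / a ^ 48 - 2 / 3 * (c ^ 2 / a ^ 16)) =
        (1 - 2 / 3 * a ^ 32) * (c ^ 2 / a ^ 16) := by field_simp
    rw [e]
    gcongr
    linarith
  have h5 : 0 < ‖perp ν w‖ ^ 2 := by
    have h6 : 0 < 2 / 3 * (c ^ 2 / a ^ 16) := by positivity
    exact (pos_of_mul_pos_right (h6.trans_le h4) (by positivity)).trans_le h3
  refine ⟨?_, abs_le_of_sq_le_sq ?_ (by positivity)⟩
  · exact (norm_nonneg _).lt_of_ne' fun h0 => by rw [h0] at h5; norm_num at h5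
  · calc inner ℝ w ν ^ 2 ≤ _ := hin
      _ ≤ a ^ 32 * ‖perp ν w‖ ^ 2 := h4.trans (by gcongr)
      _ = _ := by ring

end

/-- Gradient descent from a typical initialization stays away from the target. -/
lemma IsSmallScale.le_objective_gdIterate {k d : ℕ} [NeZero k] {c ε a : ℝ}
    (h : IsSmallScale c ε a) {u : Vec d} (hu : 12 / Real.pi ^ 2 * (k : ℝ) ^ 2 ≤ ‖u‖ ^ 2)
    {η : ℕ → ℝ} (hη : ∀ t, 0 < η t ∧ η t ≤ 1) {w₀ : Weights k d} {N : ℕ}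
    (hN : N * a ^ (12 * k) ≤ ε) (hw : ∀ l, ‖w₀ l‖ = c / a ^ 24)
    (hin : ∀ l, inner ℝ (w₀ l) (signal u) ^ 2 ≤ 2 / 3 * (c ^ 2 / a ^ 16)) :
    1 / 8 ≤ objective u (gdIterate u η w₀ N) := by
  have ha := h.pos
  have hc := h.c_pos
  have ha1 : a ≤ 1 := h.le.trans (by norm_num)
  have hν := one_le_norm_sq_signal hu
  have hη0 := fun t => (hη t).1.le
  have hη1 := fun t => (hη t).2
  have htilt := fun l => h.abs_inner_le_perp hν (hw l) (hin l)
  have hov : ∀ l, |overlap (signal u) (w₀ l)| ≤ a ^ 16 := fun l =>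
    abs_overlap_le_of_inner_le hν (by positivity) (htilt l).2
  have ha16 : a ^ 16 ≤ 1 / 10 ^ 9 :=
    (pow_le_pow_of_le_one ha.le ha1 (by norm_num : 1 ≤ 16)).trans (by rw [pow_one]; exact h.le)
  have hnorm : ∀ l, 2 * (c / (2 * a ^ 24)) ≤ ‖w₀ l‖ := fun l => by
    rw [hw l]; exact le_of_eq (by field_simp)
  rcases Nat.lt_or_ge k 2 with hk | hk
  · have hk1 : k = 1 := by have := NeZero.ne k; omega
    have hN72 : N * a ^ 72 ≤ ε := by
      refine le_trans ?_ hN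
      gcongr ?_ * ?_
      exact pow_le_pow_of_le_one ha.le ha1 (by omega)
    have hNQ : N * 4 * a ^ 24 ≤ 16 * ε := by
      have : (N : ℝ) * a ^ 24 ≤ N * a ^ (12 * k) := by
        gcongr ?_ * ?_
        exact pow_le_pow_of_le_one ha.le ha1 (by omega)
      linarith [h.eps_pos]
    obtain ⟨h1, h2⟩ := h.large_norm_conditions hN72 hNQ
    refine le_objective_of_overlap_le_of_eq_one hk1 hu ?_
    refine (FCParity.overlap_le_of_large_norm (ι := Unit) (w := fun t _ => gdIterate u η w₀ t 0)
      (D := fun _ _ => 4) (P := fun _ _ => 4) (norm_sq_signal_lt u).le hη0 hη1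
      (fun _ _ => by norm_num) (fun _ _ => le_rfl)
      (fun t _ => gdIterate_succ_of_eq_one hk1 u η w₀ t) (Q := 4) (τ := a ^ 16)
      (fun _ _ _ => by norm_num) (by norm_num) (by linarith) h.one_le_radius h1 h2
      (fun _ => hnorm 0) (fun _ => hov 0) ()).trans (by linarith)
  · have hdesc := isDescent_gdIterate hk u η w₀
    have hl : (⟨1, hk⟩ : Fin k) ≠ 0 := by
      intro h0
      have := congrArg Fin.val h0
      simp at this
    refine le_objective_of_overlap_le hk hu (l := ⟨1, hk⟩) ?_
    rcases Nat.lt_or_ge k 7 with hk7 | hk7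
    · have hN72 : N * a ^ 72 ≤ ε := by
        refine le_trans ?_ hN
        gcongr ?_ * ?_
        exact pow_le_pow_of_le_one ha.le ha1 (by omega)
      have hNQ : N * (2 * a ^ 16) ^ (k - 2) * a ^ 24 ≤ 16 * ε := by
        obtain ⟨m, rfl⟩ := Nat.exists_eq_add_of_le hk
        rw [Nat.add_sub_cancel_left]
        calc N * (2 * a ^ 16) ^ m * a ^ 24 = 2 ^ m * (N * a ^ (16 * m + 24)) := by
              rw [mul_pow, ← pow_mul, pow_add]; ring
          _ ≤ 2 ^ 4 * (N * a ^ (12 * (2 + m))) := by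
              gcongr ?_ * (_ * ?_)
              · exact pow_le_pow_right₀ (by norm_num) (by omega)
              · exact pow_le_pow_of_le_one ha.le ha1 (by omega)
          _ ≤ 16 * ε := by linarith
      obtain ⟨h1, h2⟩ := h.large_norm_conditions hN72 hNQ
      exact (hdesc.overlap_le_of_large_norm hη0 hη1 (by positivity) (by linarith)
        h.one_le_radius h1 h2 hnorm (fun l _ => hov l) _ hl).trans (by linarith)
    rcases Nat.lt_or_ge k 12 with hk12 | hk12
    · obtain ⟨n, rfl⟩ : ∃ n, k = n + 2 := ⟨k - 2, by omega⟩
      have hn : 5 ≤ n := by omega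
      have hn' : n ≤ 9 := by omega
      have hεpow : ∀ m : ℕ, N * a ^ (12 * n + 24 + m) ≤ a ^ m := fun m => by
        rw [pow_add, ← mul_assoc, show 12 * n + 24 = 12 * (n + 2) by ring]
        exact mul_le_of_le_one_left (by positivity) (hN.trans (h.eps_le.trans (by norm_num)))
      have hL1 : a ^ 60 / (8 * c ^ 2) ≤ 1 := by
        rw [div_le_one (by positivity)]
        have h1 : a ^ 2 ≤ c ^ 2 := by have := h.le_c; gcongr
        have h2 : a ^ 60 ≤ a ^ 2 := pow_le_pow_of_le_one ha.le ha1 (by norm_num)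
        linarith [sq_nonneg c]
      -- K and L are chosen to give equality in K·R ≤ τ/2 and L·R² ≤ r²/8, the largest values the
      -- initial norm R allows.
      refine (hdesc.overlap_le_of_balanced (by omega) hν hη0 hη1 (τ := a ^ 16)
        (K := a ^ 40 / (2 * c)) (K' := a ^ (12 * n + 40) / 2) (L := a ^ 60 / (8 * c ^ 2))
        (L' := a ^ (12 * n + 36) / 16) (r := a ^ 6) (R := c / a ^ 24) (by positivity)
        (by linarith) (by positivity) (pow_le_one₀ ha.le ha1) (by positivity) (by positivity)
        (by positivity) hL1 (h.tilt_condition hn hn') (h.balance_condition hn hn') ?_ ?_ ?_ ?_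
        (h.small_overlap_condition (Nat.cast_nonneg N) hn hn' hN) (fun l _ => hw l)
        (fun l _ => (htilt l).1) (fun l _ => (htilt l).2) _ hl).trans (by linarith)
      · exact le_of_eq (by field_simp)
      · have := hεpow 16
        linarith
      · exact le_of_eq (by field_simp)
      · have := hεpow 12
        have e : a ^ 60 / (8 * c ^ 2) * (c / a ^ 24) ^ 2 = a ^ 12 / 8 := by field_simp
        rw [e]
        linarith
    · exact (hdesc.overlap_le_of_small hη0 hη1 (by positivity) (by linarith) (Nat.zero_le N)
        (h.large_order_condition hk12 hN) (fun l _ => hov l) _ hl).trans (by linarith)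

end FCParity

end

/-! ### Assembly -/

theorem mainTheorem1 (c : ℝ) (hc : 0 < c) (k T : ℕ → ℕ) [∀ d, NeZero (k d)]
    (hT : (fun d : ℕ => (T d : ℝ)) =o[atTop] fun d : ℕ => (d : ℝ) ^ ((k d : ℝ) / 4)) :
    ∀ᶠ d : ℕ in atTop,
      ∀ u₀ : FCParity.Vec d, 12 / Real.pi ^ 2 * (k d : ℝ) ^ 2 ≤ ‖u₀‖ ^ 2 →
      ∀ η : FCParity.Weights (k d) d → ℕ → ℝ, (∀ w t, 0 < η w t ∧ η w t ≤ 1) →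
        1 - 2 * (k d : ℝ) * Real.exp (-((d : ℝ) ^ ((1 : ℝ) / 3)) / 6) ≤
          (FCParity.initLaw (k d) d c).real
            {w₀ | 1 / 8 ≤ FCParity.objective u₀ (FCParity.gdIterate u₀ (η w₀) w₀ (T d))} := by
  set ε : ℝ := min (1 / 10000) (c ^ 3 / 32) with hε
  have hε0 : 0 < ε := by positivity
  have hε1 : ε ≤ 1 / 10000 := min_le_left _ _
  have hε2 : 32 * ε ≤ c ^ 3 := by linarith [min_le_right (1 / 10000) (c ^ 3 / 32)]
  have hlim : Tendsto (fun d : ℕ => (d : ℝ) ^ (-(1 / 48 : ℝ))) atTop (nhds 0) :=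
    (tendsto_rpow_neg_atTop (by norm_num)).comp tendsto_natCast_atTop_atTop
  have hδ : 0 < min (1 / 10 ^ 9) (min c (1 / c)) := by positivity
  filter_upwards [hT.bound hε0, hlim.eventually (gt_mem_nhds hδ), eventually_gt_atTop 0]
    with d hTd hsmall hd u hu η hη
  have hd0 : (0 : ℝ) < d := by exact_mod_cast hd
  -- The exponent 1/48 makes √d, d^(1/3) and d^(k/4) integer powers of 1/a, namely the 24th, the
  -- 16th and the 12k-th.
  set a : ℝ := (d : ℝ) ^ (-(1 / 48 : ℝ)) with ha_def
  have ha : 0 < a := by positivity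
  obtain ⟨h1, h2⟩ := lt_min_iff.1 hsmall
  obtain ⟨h3, h4⟩ := lt_min_iff.1 h2
  have hscale : FCParity.IsSmallScale c ε a := ⟨hc, hε0, hε1, hε2, ha, h1.le, h3.le, by
    rw [lt_div_iff₀ hc] at h4; linarith⟩
  have hpow : ∀ m : ℕ, a ^ m = (d : ℝ) ^ (-(m / 48 : ℝ)) := fun m => by
    rw [ha_def, ← Real.rpow_natCast, ← Real.rpow_mul hd0.le]; congr 1; ring
  have hN : (T d : ℝ) * a ^ (12 * k d) ≤ ε := by
    rw [Real.norm_of_nonneg (by positivity), Real.norm_of_nonneg (by positivity)] at hTd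
    have e : (d : ℝ) ^ ((k d : ℝ) / 4) * a ^ (12 * k d) = 1 := by
      rw [hpow, ← Real.rpow_add hd0]
      push_cast
      rw [show (k d : ℝ) / 4 + -(12 * k d / 48) = 0 by ring, Real.rpow_zero]
    calc (T d : ℝ) * a ^ (12 * k d) ≤ ε * (d : ℝ) ^ ((k d : ℝ) / 4) * a ^ (12 * k d) := by gcongr
      _ = ε := by rw [mul_assoc, e, mul_one]
  have hda : (d : ℝ) = 1 / a ^ 48 := by
    rw [hpow, eq_div_iff (by positivity)]
    nth_rw 1 [← Real.rpow_one (d : ℝ)]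
    rw [← Real.rpow_add hd0]
    norm_num
  have hd3 : (d : ℝ) ^ ((1 : ℝ) / 3) = 1 / a ^ 16 := by
    rw [hpow, eq_div_iff (by positivity), ← Real.rpow_add hd0]
    norm_num
  have hν := FCParity.one_le_norm_sq_signal hu
  -- As ‖signal u‖² < 2, the Hoeffding exponent s²/(2c²‖signal u‖²) is at least d^(1/3)/6.
  set s : ℝ := √(2 / 3 * (c ^ 2 / a ^ 16)) with hs
  have hs2 : s ^ 2 = 2 / 3 * (c ^ 2 / a ^ 16) := Real.sq_sqrt (by positivity)
  refine le_trans ?_ (FCParity.le_initLaw_real hc (FCParity.signal u) (s := s) (Real.sqrt_nonneg _)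
    fun w hw hin => hscale.le_objective_gdIterate hu (hη w) hN (fun l => ?_) fun l => ?_)
  · have hexp : Real.exp (-s ^ 2 / (2 * (c ^ 2 * ‖FCParity.signal u‖ ^ 2))) ≤
        Real.exp (-((d : ℝ) ^ ((1 : ℝ) / 3)) / 6) := by
      rw [Real.exp_le_exp, hd3, neg_div, neg_div, neg_le_neg_iff, hs2,
        le_div_iff₀ (by positivity)]
      have := (FCParity.norm_sq_signal_lt u).le
      calc 1 / a ^ 16 / 6 * (2 * (c ^ 2 * ‖FCParity.signal u‖ ^ 2)) ≤
            1 / a ^ 16 / 6 * (2 * (c ^ 2 * 2)) := by gcongr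
        _ = _ := by ring
    have : 2 * (k d : ℝ) * Real.exp (-s ^ 2 / (2 * (c ^ 2 * ‖FCParity.signal u‖ ^ 2))) ≤
        2 * (k d : ℝ) * Real.exp (-((d : ℝ) ^ ((1 : ℝ) / 3)) / 6) := by gcongr
    linarith
  · rw [EuclideanSpace.norm_eq, Real.sqrt_eq_iff_mul_self_eq_of_pos (by positivity)]
    simp only [Real.norm_eq_abs, sq_abs, hw, Finset.sum_const, Finset.card_univ,
      Fintype.card_fin, nsmul_eq_mul]
    rw [hda]
    field_simp
  · rw [← hs2, ← sq_abs]
    have := (hin l).le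
    gcongr
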